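/- **The game.** Let $a_1\in(0,1)$, $a_2\in(1-a_1,1)$, $z_1,z_2\in(0,1)$, $r_1,r_2>0$, $\gamma_1\ge 0$, $0\le w_1<c_1<1$, $0<k_2<1-w_1$, and $D=a_1+a_2-1$. Players 1 and 2 split a unit surplus in continuous time. Player $i$ is justified with probability $z_i$; a justified player never concedes, a justified player 1 challenges at Poisson rate $\gamma_1$, and a justified player 2 always sees a challenge. A strategy of an unjustified player 1 is a pair $(F_1,G_1)$ of right-continuous nondecreasing functions on $[0,\infty)$, the probabilities of having conceded and of having challenged by time $t$ (inclusive), with $F_1,G_1\ge 0$, $F_1+G_1\le1$. A strategy of an unjustified player 2 is a pair $(F_2,q_2)$ with $F_2\colon[0,\infty)\to[0,1]$ right-continuous and nondecreasing (concession by time $t$) and $q_2\colon[0,\infty)\to[0,1]$ measurable (probability of yielding to a challenge at $t$). Write $F(0^-)=0$. Player 1's expected utilities from conceding and from challenging at time $t$ are $$U_1(t)=(1-z_2)\int_{[0,t)}a_1e^{-r_1s}dF_2(s)+[1-(1-z_2)F_2(t)]e^{-r_1t}(1-a_2)+(1-z_2)[F_2(t)-F_2(t^-)]e^{-r_1t}\tfrac{a_1+1-a_2}{2},$$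 $$V_1(t)=(1-z_2)\int_{[0,t]}a_1e^{-r_1s}dF_2(s)+[1-(1-z_2)F_2(t)]e^{-r_1t}(1-a_2-c_1D)+(1-z_2)[1-F_2(t)]e^{-r_1t}[(1-q_2(t))w_1+q_2(t)]D,$$ and player 2's from conceding at time $t$ is $$\begin{aligned}U_2(t)={}&(1-z_1)\int_{[0,t)}a_2e^{-r_2s}dF_1(s)+z_1\int_0^t[1-a_1-(1-q_2(s))k_2D]e^{-r_2s}\gamma_1e^{-\gamma_1s}ds\\&+(1-z_1)\int_{[0,t)}\{1-a_1+[1-q_2(s)](1-w_1-k_2)D\}e^{-r_2s}dG_1(s)\\&+e^{-r_2t}(1-a_1)[1-(1-z_1)F_1(t)-(1-z_1)G_1(t^-)-z_1(1-e^{-\gamma_1t})]\\&+(1-z_1)[F_1(t)-F_1(t^-)]e^{-r_2t}\tfrac{a_2+1-a_1}{2}.\end{aligned}$$ Payoffs are $u_1=\int_{[0,\infty)} U_1\,dF_1+\int_{[0,\infty)} V_1\,dG_1$ and $u_2=\int_{[0,\infty)} U_2\,dF_2$. An equilibrium is a Bayesian Nash equilibrium: each unjustified player's strategy maximizes that player's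 payoff given the other's strategy. Reputations are $$\mu_1(t)=\frac{z_1e^{-\gamma_1t}}{z_1e^{-\gamma_1t}+(1-z_1)[1-F_1(t^-)-G_1(t^-)]},\qquad \mu_2(t)=\frac{z_2}{z_2+(1-z_2)[1-F_2(t^-)]}.$$ **Notation.** Let $\lambda_1=r_2(1-a_1)/D$, $\lambda_2=r_1(1-a_2)/D$, $\nu_1^*=1-\frac{k_2}{1-w_1}$, $\mu_2^*=1-c_1$, $t_2^N=-\frac{1}{\lambda_2}\ln\mu_2^*$, and let $\mu(t;\mu^0,A,C)$ be the solution of $\mu'=A\mu+C\mu^2$, $\mu(0)=\mu^0$, that is, $1/[(\frac1{\mu^0}+\frac CA)e^{-At}-\frac CA]$ if $A\ne0$ and $1/[\frac1{\mu^0}-Ct]$ if $A=0$. If $\gamma_1\neq\lambda_1$, put $e=\frac{\gamma_1-\lambda_1}{\lambda_2}$ and $$\widetilde\mu_1(x)=\begin{cases}\dfrac{\lambda_1-\gamma_1}{\lambda_1x^{e}-\gamma_1}&\mu_2^*<x\le1,\\[2ex]\dfrac{\lambda_1-\gamma_1}{\lambda_1x^{e}+(\frac{\gamma_1}{\nu_1^*}-\gamma_1)(x/\mu_2^*)^{e}-\frac{\gamma_1}{\nu_1^*}}&0<x\le\mu_2^*;\end{cases}$$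 if $\gamma_1=\lambda_1$, put $$\widetilde\mu_1(x)=\begin{cases}\dfrac1{1-\frac{\gamma_1}{\lambda_2}\ln x}&\mu_2^*<x\le1,\\[2ex]\dfrac1{-\frac{\gamma_1}{\nu_1^*\lambda_2}\ln\frac{x}{\mu_2^*}+1-\frac{\gamma_1}{\lambda_2}\ln\mu_2^*}&0<x\le\mu_2^*.\end{cases}$$ Let $\mu_1^N=\widetilde\mu_1(\mu_2^*)$, and let $\widetilde\mu_2$ be the inverse of $\widetilde\mu_1$. For $\gamma_1\ne\lambda_1$, $$\widetilde\mu_2(y)=\begin{cases}\left[\left(1-\frac{\gamma_1}{\lambda_1}\right)\frac1y+\frac{\gamma_1}{\lambda_1}\right]^{1/e}&\mu_1^N<y\le1,\\[1.5ex]\left[\dfrac{\frac{\lambda_1-\gamma_1}{\lambda_1}\frac1y+\frac{\gamma_1}{\lambda_1\nu_1^*}}{1+\frac{1-\nu_1^*}{\nu_1^*}\frac{\gamma_1}{\lambda_1}(\mu_2^*)^{-e}}\right]^{1/e}&y\le\mu_1^N,\ \gamma_1y>(\gamma_1-\lambda_1)\nu_1^*;\end{cases}$$ for $\gamma_1=\lambda_1$,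 $\widetilde\mu_2(y)=\exp[\frac{\lambda_2}{\gamma_1}(1-\frac1y)]$ if $\mu_1^N<y\le1$ and $\widetilde\mu_2(y)=\mu_2^*\exp\big[\frac{\nu_1^*\lambda_2}{\gamma_1}(1-\frac{\gamma_1}{\lambda_2}\ln\mu_2^*-\frac1y)\big]$ if $0<y\le\mu_1^N$. If $\gamma_1>\lambda_1$ and $0<y\le(1-\lambda_1/\gamma_1)\nu_1^*$, put $\widetilde\mu_2(y)=0$. For $t\ge0$ let $$\check\mu_1(-t)=\begin{cases}\mu(-t;1,\lambda_1-\gamma_1,\gamma_1)&t<t_2^N,\\\mu(t_2^N-t;\mu_1^N,\lambda_1-\gamma_1,\gamma_1/\nu_1^*)&t\ge t_2^N,\end{cases}\qquad\check\mu_2(-t)=\mu(-t;1,\lambda_2,0).$$ **Theorem.** There is a smallest $T\ge0$ with $\check\mu_1(-T)=z_1$ or $\check\mu_2(-T)=z_2$ (that is, $T=\min\{T_1,T_2\}$, where $T_i$ solves $\check\mu_i(-T_i)=z_i$ and $T_1=\infty$ if there is no solution), and $T>0$. An equilibrium exists, and every equilibrium $(\widehat F_1,\widehat G_1,\widehat F_2,\widehat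 q_2)$, with reputations $\widehat\mu_1,\widehat\mu_2$, satisfies the following. 1. Let $\widehat\kappa_i(s)=1_{s<T}\frac{\lambda_i}{1-\widehat\mu_i(s)}$ and $\widehat\chi_1(s)=1_{s<T-t_2^N}\frac{1-\nu_1^*}{\nu_1^*}\frac{\widehat\mu_1(s)}{1-\widehat\mu_1(s)}\gamma_1$. These are the unjustified players' hazard rates of conceding and challenging: for all $t\ge0$, $\widehat F_i(t)=\widehat F_i(0)+\int_0^t\widehat f_i$ and $\widehat G_1(t)=\int_0^t\widehat g_1$, where $$\widehat f_1(t)=(1-\widehat F_1(0))e^{-\int_0^t(\widehat\kappa_1+\widehat\chi_1)}\,\widehat\kappa_1(t),\quad\widehat g_1(t)=(1-\widehat F_1(0))e^{-\int_0^t(\widehat\kappa_1+\widehat\chi_1)}\,\widehat\chi_1(t),\quad\widehat f_2(t)=(1-\widehat F_2(0))e^{-\int_0^t\widehat\kappa_2}\,\widehat\kappa_2(t).$$ Moreover, with $j\ne i$, $\widehat F_i(0)=1-\frac{z_i}{1-z_i}\big/\frac{\widetilde\mu_i(z_j)}{1-\widetilde\mu_i(z_j)}$ if $z_i<\widetilde\mu_i(z_j)$,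 and $\widehat F_i(0)=0$ otherwise. 2. If $\gamma_1>0$, then for almost every $t\in[0,T]$, $\widehat q_2(t)=\frac1{1-w_1}\left[\frac{c_1}{1-\widehat\mu_2(t)}-w_1\right]$ if $t<T-t_2^N$, and $\widehat q_2(t)=1$ if $t\ge T-t_2^N$. 3. $\widehat\mu_i(T-t)=\check\mu_i(-t)$ for $0\le t<T$, $i=1,2$. In particular $\widehat\mu_1(T)=\widehat\mu_2(T)=1$, and on $(0,T)$: $\widehat\mu_2'=\lambda_2\widehat\mu_2$; $\widehat\mu_1'=(\lambda_1-\gamma_1)\widehat\mu_1+\frac{\gamma_1}{\nu_1^*}\widehat\mu_1^2$ for $t<T-t_2^N$; and $\widehat\mu_1'=(\lambda_1-\gamma_1)\widehat\mu_1+\gamma_1\widehat\mu_1^2$ for $t>T-t_2^N$. 4. For $\{i,j\}=\{1,2\}$, player $i$'s equilibrium payoff is $$\widehat u_i=1-a_j+1_{z_i\ge\widetilde\mu_i(z_j)}\,(1-z_j)\left[1-\frac{z_j}{1-z_j}\bigg/\frac{\widetilde\mu_j(z_i)}{1-\widetilde\mu_j(z_i)}\right]D.$$ -/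

import Mathlib

open MeasureTheory

noncomputable section

/-- A bargaining game with a one-sided ultimatum (only player 1 can challenge) and a single
justified demand for each player. -/
structure BargainingGame where
  /-- justified demands -/
  (a₁ a₂ : ℝ)
  /-- prior probabilities of being justified -/
  (z₁ z₂ : ℝ)
  /-- discount rates -/
  (r₁ r₂ : ℝ)
  /-- Poisson rate at which a justified player 1 challenges -/
  γ₁ : ℝ
  /-- cost of challenging, as a fraction of the disagreement -/
  c₁ : ℝ
  /-- cost of seeing a challenge, as a fraction of the disagreement -/
  k₂ : ℝ
  /-- probability that an unjustified player 1 wins in court against an unjustified player 2 -/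
  w₁ : ℝ
  a₁_mem : 0 < a₁ ∧ a₁ < 1
  a₂_mem : 1 - a₁ < a₂ ∧ a₂ < 1
  z₁_mem : 0 < z₁ ∧ z₁ < 1
  z₂_mem : 0 < z₂ ∧ z₂ < 1
  r₁_pos : 0 < r₁
  r₂_pos : 0 < r₂
  γ₁_nonneg : 0 ≤ γ₁
  w₁_nonneg : 0 ≤ w₁
  c₁_mem : w₁ < c₁ ∧ c₁ < 1
  k₂_mem : 0 < k₂ ∧ k₂ < 1 - w₁

/-- A strategy of an unjustified player 1: `F t` (resp. `G t`) is the probability of having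
conceded (resp. challenged) by time `t`, inclusive. Both are right-continuous and nondecreasing;
they are extended by `0` to negative times, so that `F 0` is an atom at time `0`. -/
structure StrategyOne where
  F : StieltjesFunction ℝ
  G : StieltjesFunction ℝ
  F_neg : ∀ t < 0, F t = 0
  G_neg : ∀ t < 0, G t = 0
  add_le_one : ∀ t, F t + G t ≤ 1

/-- A strategy of an unjustified player 2: `F t` is the probability of having conceded by time `t`,
and `q t` is the probability of yielding to a challenge made at time `t`. -/
structure StrategyTwo where
  F : StieltjesFunction ℝ
  F_neg : ∀ t < 0, F t = 0
  F_le_one : ∀ t, F t ≤ 1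
  q : ℝ → ℝ
  q_measurable : Measurable q
  q_mem : ∀ t, 0 ≤ q t ∧ q t ≤ 1

/-- The explicit solution `μ(t; μ⁰, A, C)` of the Bernoulli equation
`μ' = A μ + C μ ^ 2`, `μ(0) = μ⁰`. -/
def bernoulliSol (t μ0 A C : ℝ) : ℝ :=
  if A = 0 then 1 / (-C * t + 1 / μ0)
  else 1 / ((1 / μ0 + C / A) * Real.exp (-A * t) - C / A)

namespace BargainingGame

variable (B : BargainingGame)

/-- The disagreement between the two players. -/
def D : ℝ := B.a₁ + B.a₂ - 1

/-! ### Payoffs and equilibrium -/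

/-- Unjustified player 1's expected utility from conceding at time `t`. Concessions of player 2
strictly before `t` are in the integral; a simultaneous concession gives an equal split. -/
def U₁ (S₂ : StrategyTwo) (t : ℝ) : ℝ :=
  (1 - B.z₂) * (∫ s in Set.Ico 0 t, B.a₁ * Real.exp (-B.r₁ * s) ∂S₂.F.measure)
    + (1 - (1 - B.z₂) * S₂.F t) * Real.exp (-B.r₁ * t) * (1 - B.a₂)
    + (1 - B.z₂) * (S₂.F t - Function.leftLim S₂.F t)
      * Real.exp (-B.r₁ * t) * ((B.a₁ + 1 - B.a₂) / 2)

/-- Unjustified player 1's expected utility from challenging at time `t`. A simultaneous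
concession of player 2 takes precedence over the challenge. -/
def V₁ (S₂ : StrategyTwo) (t : ℝ) : ℝ :=
  (1 - B.z₂) * (∫ s in Set.Icc 0 t, B.a₁ * Real.exp (-B.r₁ * s) ∂S₂.F.measure)
    + (1 - (1 - B.z₂) * S₂.F t) * Real.exp (-B.r₁ * t) * (1 - B.a₂ - B.c₁ * B.D)
    + (1 - B.z₂) * (1 - S₂.F t) * Real.exp (-B.r₁ * t)
      * ((1 - S₂.q t) * B.w₁ + S₂.q t) * B.D

/-- Unjustified player 1's expected utility from a strategy. -/
def payoff₁ (S₁ : StrategyOne) (S₂ : StrategyTwo) : ℝ :=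
  (∫ s in Set.Ici 0, B.U₁ S₂ s ∂S₁.F.measure) + ∫ s in Set.Ici 0, B.V₁ S₂ s ∂S₁.G.measure

/-- Unjustified player 2's expected utility from conceding at time `t` and yielding to challenges
according to `q`. A concession of player 2 takes precedence over a simultaneous challenge;
simultaneous concessions give an equal split. -/
def U₂ (S₁ : StrategyOne) (q : ℝ → ℝ) (t : ℝ) : ℝ :=
  (1 - B.z₁) * (∫ s in Set.Ico 0 t, B.a₂ * Real.exp (-B.r₂ * s) ∂S₁.F.measure)
    + B.z₁ * (∫ s in Set.Ico 0 t, (1 - B.a₁ - (1 - q s) * B.k₂ * B.D)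
        * Real.exp (-B.r₂ * s) * (B.γ₁ * Real.exp (-B.γ₁ * s)))
    + (1 - B.z₁) * (∫ s in Set.Ico 0 t,
        (1 - B.a₁ + (1 - q s) * (1 - B.w₁ - B.k₂) * B.D) * Real.exp (-B.r₂ * s) ∂S₁.G.measure)
    + Real.exp (-B.r₂ * t) * (1 - B.a₁)
      * (1 - (1 - B.z₁) * S₁.F t - (1 - B.z₁) * Function.leftLim S₁.G t
          - B.z₁ * (1 - Real.exp (-B.γ₁ * t)))
    + (1 - B.z₁) * (S₁.F t - Function.leftLim S₁.F t)
      * Real.exp (-B.r₂ * t) * ((B.a₂ + 1 - B.a₁) / 2)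

/-- Unjustified player 2's expected utility from a strategy. -/
def payoff₂ (S₁ : StrategyOne) (S₂ : StrategyTwo) : ℝ :=
  ∫ s in Set.Ici 0, B.U₂ S₁ S₂.q s ∂S₂.F.measure

/-- Bayesian Nash equilibrium. -/
def IsEquilibrium (S₁ : StrategyOne) (S₂ : StrategyTwo) : Prop :=
  (∀ S₁' : StrategyOne, B.payoff₁ S₁' S₂ ≤ B.payoff₁ S₁ S₂) ∧
    ∀ S₂' : StrategyTwo, B.payoff₂ S₁ S₂' ≤ B.payoff₂ S₁ S₂

/-! ### Reputations -/

/-- Player 1's reputation: the posterior probability that player 1 is justified, conditional on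
the game not having ended before time `t`. -/
def rep₁ (S₁ : StrategyOne) (t : ℝ) : ℝ :=
  B.z₁ * (1 - ∫ s in 0..t, B.γ₁ * Real.exp (-B.γ₁ * s)) /
    (B.z₁ * (1 - ∫ s in 0..t, B.γ₁ * Real.exp (-B.γ₁ * s))
      + (1 - B.z₁) * (1 - Function.leftLim S₁.F t - Function.leftLim S₁.G t))

/-- Player 2's reputation. -/
def rep₂ (S₂ : StrategyTwo) (t : ℝ) : ℝ :=
  B.z₂ / (B.z₂ + (1 - B.z₂) * (1 - Function.leftLim S₂.F t))

/-! ### The parameters of the closed form -/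

/-- Overall concession rate of player 1. -/
def lam₁ : ℝ := B.r₂ * (1 - B.a₁) / B.D

/-- Overall concession rate of player 2. -/
def lam₂ : ℝ := B.r₁ * (1 - B.a₂) / B.D

/-- Player 1's reputation after a challenge that makes player 2 indifferent. -/
def nuStar : ℝ := 1 - B.k₂ / (1 - B.w₁)

/-- The reputation of player 2 above which player 1 does not challenge. -/
def muStar : ℝ := 1 - B.c₁

/-- Time player 2's reputation needs to grow from `muStar` to `1` at rate `lam₂`: the length of
the no-challenge phase. -/
def tN : ℝ := -Real.log B.muStar / B.lam₂

/-- Player 1's reputation when player 2's reputation is `muStar`. -/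
def muN : ℝ :=
  if B.γ₁ = B.lam₁ then 1 / (1 - B.γ₁ / B.lam₂ * Real.log B.muStar)
  else (B.lam₁ - B.γ₁) / (B.lam₁ * B.muStar ^ ((B.γ₁ - B.lam₁) / B.lam₂) - B.γ₁)

/-- Player 1's reputation path run backward from `1`: `muCheck₁ (-t)` is the reputation `t` units
of time before the end. -/
def muCheck₁ (s : ℝ) : ℝ :=
  if -B.tN < s then bernoulliSol s 1 (B.lam₁ - B.γ₁) B.γ₁
  else bernoulliSol (B.tN + s) B.muN (B.lam₁ - B.γ₁) (B.γ₁ / B.nuStar)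

/-- Player 2's reputation path run backward from `1`. -/
def muCheck₂ (s : ℝ) : ℝ := bernoulliSol s 1 B.lam₂ 0

/-- The reputation coevolution curve, as player 1's reputation in terms of player 2's
reputation `x ∈ (0, 1]`. -/
def curve₁ (x : ℝ) : ℝ :=
  if B.γ₁ = B.lam₁ then
    if B.muStar < x then 1 / (-(B.γ₁ / B.lam₂) * Real.log x + 1)
    else 1 / (-(B.γ₁ / B.nuStar) * (1 / B.lam₂) * Real.log (x / B.muStar)
      + (1 - B.γ₁ / B.lam₂ * Real.log B.muStar))
  else
    if B.muStar < x then
      (B.lam₁ - B.γ₁) / (B.lam₁ * x ^ ((B.γ₁ - B.lam₁) / B.lam₂) - B.γ₁)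
    else (B.lam₁ - B.γ₁) / (B.lam₁ * x ^ ((B.γ₁ - B.lam₁) / B.lam₂)
      + (B.γ₁ / B.nuStar - B.γ₁) * (x / B.muStar) ^ ((B.γ₁ - B.lam₁) / B.lam₂)
      - B.γ₁ / B.nuStar)

/-- The reputation coevolution curve, as player 2's reputation in terms of player 1's
reputation `y ∈ (0, 1]`: the inverse of `curve₁`. If `γ₁ > lam₁`, the curve tends to the point
`((1 - lam₁ / γ₁) * nuStar, 0)`, and it is continued by `0` to smaller `y`. -/
def curve₂ (y : ℝ) : ℝ :=
  if B.γ₁ * y ≤ (B.γ₁ - B.lam₁) * B.nuStar then 0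
  else if B.γ₁ = B.lam₁ then
    if B.muN < y then Real.exp (B.lam₂ / B.γ₁ * (1 - 1 / y))
    else B.muStar * Real.exp
      ((1 - B.γ₁ / B.lam₂ * Real.log B.muStar - 1 / y) / (B.γ₁ / B.nuStar * (1 / B.lam₂)))
  else
    if B.muN < y then
      ((1 - B.γ₁ / B.lam₁) * (1 / y) + B.γ₁ / B.lam₁) ^ (B.lam₂ / (B.γ₁ - B.lam₁))
    else
      (((B.lam₁ - B.γ₁) / B.lam₁ * (1 / y) + B.γ₁ / B.lam₁ * (1 / B.nuStar)) /
        (1 + (1 - B.nuStar) / B.nuStar * (B.γ₁ / B.lam₁)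
          * B.muStar ^ ((B.lam₁ - B.γ₁) / B.lam₂))) ^ (B.lam₂ / (B.γ₁ - B.lam₁))

/-! ### Hazard rates and densities, in terms of the terminal time `T` and the reputations -/

/-- Unjustified player 1's hazard rate of conceding. -/
def kappa₁ (T : ℝ) (S₁ : StrategyOne) (s : ℝ) : ℝ :=
  if s < T then B.lam₁ / (1 - B.rep₁ S₁ s) else 0

/-- Unjustified player 2's hazard rate of conceding. -/
def kappa₂ (T : ℝ) (S₂ : StrategyTwo) (s : ℝ) : ℝ :=
  if s < T then B.lam₂ / (1 - B.rep₂ S₂ s) else 0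

/-- Unjustified player 1's hazard rate of challenging. -/
def chi₁ (T : ℝ) (S₁ : StrategyOne) (s : ℝ) : ℝ :=
  if s < T - B.tN then
    (1 - B.nuStar) / B.nuStar * (B.rep₁ S₁ s / (1 - B.rep₁ S₁ s)) * B.γ₁
  else 0

/-- Density of player 1's concession time on `(0, ∞)`. -/
def f₁ (T : ℝ) (S₁ : StrategyOne) (t : ℝ) : ℝ :=
  (1 - S₁.F 0) * Real.exp (-∫ s in 0..t, (B.kappa₁ T S₁ s + B.chi₁ T S₁ s)) * B.kappa₁ T S₁ t

/-- Density of player 1's challenge time on `(0, ∞)`. -/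
def g₁ (T : ℝ) (S₁ : StrategyOne) (t : ℝ) : ℝ :=
  (1 - S₁.F 0) * Real.exp (-∫ s in 0..t, (B.kappa₁ T S₁ s + B.chi₁ T S₁ s)) * B.chi₁ T S₁ t

/-- Density of player 2's concession time on `(0, ∞)`. -/
def f₂ (T : ℝ) (S₂ : StrategyTwo) (t : ℝ) : ℝ :=
  (1 - S₂.F 0) * Real.exp (-∫ s in 0..t, B.kappa₂ T S₂ s) * B.kappa₂ T S₂ t

/-- Player 2's equilibrium probability of yielding to a challenge at time `t ≤ T`. -/
def yieldProb (T : ℝ) (S₂ : StrategyTwo) (t : ℝ) : ℝ :=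
  if t < T - B.tN then 1 / (1 - B.w₁) * (B.c₁ / (1 - B.rep₂ S₂ t) - B.w₁) else 1

end BargainingGame

/-- `F` is, on `[0, ∞)`, an atom of mass `F 0` at time `0` plus an absolutely continuous part with
density `f`. -/
def HasAtomAndDensity (F f : ℝ → ℝ) : Prop :=
  ∀ t, 0 ≤ t → IntervalIntegrable f volume 0 t ∧ F t = F 0 + ∫ s in 0..t, f s

end

/-! Every payoff is an affine function of the gain from waiting in a war of attrition. Since `D *
lam₂ = r₁ * (1 - a₂)`, integration by parts turns the utility of conceding at `t` into the
concession payoff plus `D` times `wait₁`: discounted concessions of the opponent, minus a flow cost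
of delay while the opponent survives (`U₁_eq`). Challenging adds the net term `chalGain` (`V₁_eq`).
For player 2, yielding pays the same as conceding, so challenges enter `wait₂` only through
survival; seeing them adds a gain against unjustified challengers and a loss against justified ones
(`U₂_eq`).

In equilibrium challenges do not disturb the war. Because `w₁ < c₁`, an unjustified player 1
challenges only where player 2 yields with probability at least `theta > 0`. There player 2 could
see more often, and unprofitability of this deviation bounds every weighted mass of unjustified
challenges by the corresponding mass of justified ones (`seeG_le_seeL`). So seeing has no positive
net value, yielding always is a best response, and player 2's concession times maximize `wait₂`
(`optimal_wait₂`). The same deviation at one instant shows that `G` has no atoms (`G_continuousAt`).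

The usual war-of-attrition arguments then apply: no atoms after time 0, not two atoms at time 0, no
gaps, hence indifference while player 2 may still concede (`war_continuousAt`, `war_atom_zero`,
`war_const`, `war_indifferent`). Indifference is a differential equation for the concession
probabilities. Player 2's survival probability decays at rate `lam₂` and is bounded below by `z₂`,
so concessions end at a finite `T` (`exists_terminal`). In the last `tN` units of time player 2's
reputation exceeds `1 - c₁`, and not even certain yielding makes a challenge worthwhile. Earlier,
player 2 yields with probability below one, so deviations in both directions are available and force
unjustified challenges to be a fixed multiple of justified ones (`discHalf_G`, `G_eq`). A linear
equation with a terminal condition then determines player 1's survival (`surv₁_eq`).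

The reciprocal of player 1's reputation solves a linear equation, with solution `invRep` in backward
time. At most one player has an atom at 0, so one prior lies exactly on its backward path; by
monotonicity of the paths this determines `T` (`IsTerminal.unique`). Hence all equilibria share one
closed form (`exists_isSolution`), from which rates, reputations and payoffs are computed.
Conversely, the closed form with break-even yielding is an equilibrium (`IsSolution.isEquilibrium`).
-/

section

open Set Filter Topology Function

/-! ### Sub-distribution functions and their discounted integrals -/

/-- A Stieltjes function vanishing on negative numbers and bounded by `1`. -/
structure IsSubCDF (F : StieltjesFunction ℝ) : Prop where
  neg : ∀ t < 0, F t = 0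
  le_one : ∀ t, F t ≤ 1

namespace IsSubCDF

variable {F : StieltjesFunction ℝ}

lemma nonneg (hF : IsSubCDF F) (t : ℝ) : 0 ≤ F t := by
  have h : F (min t (-1)) = 0 := hF.neg _ (lt_of_le_of_lt (min_le_right _ _) (by norm_num))
  rw [← h]
  exact F.mono (min_le_left _ _)

lemma leftLim_le_self (F : StieltjesFunction ℝ) (t : ℝ) : leftLim F t ≤ F t := F.mono.leftLim_le le_rfl

lemma leftLim_nonneg (hF : IsSubCDF F) (t : ℝ) : 0 ≤ leftLim F t :=
  (hF.nonneg (t - 1)).trans (F.mono.le_leftLim (by linarith))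

lemma tendsto_atBot (hF : IsSubCDF F) : Tendsto F atBot (𝓝 0) := by
  refine tendsto_const_nhds.congr' ?_
  filter_upwards [eventually_lt_atBot 0] with t ht
  exact (hF.neg t ht).symm

lemma isFiniteMeasure (hF : IsSubCDF F) : IsFiniteMeasure F.measure :=
  F.isFiniteMeasure_of_forall_abs_le (C := 1) fun x =>
    abs_le.2 ⟨by linarith [hF.nonneg x], hF.le_one x⟩

lemma real_Iic (hF : IsSubCDF F) (t : ℝ) : F.measure.real (Iic t) = F t := by
  rw [measureReal_def, F.measure_Iic hF.tendsto_atBot, sub_zero, ENNReal.toReal_ofReal (hF.nonneg t)]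

lemma leftLim_of_nonpos (hF : IsSubCDF F) {t : ℝ} (ht : t ≤ 0) : leftLim F t = 0 := by
  refine leftLim_eq_of_tendsto ?_
  refine tendsto_const_nhds.congr' ?_
  filter_upwards [self_mem_nhdsWithin] with s hs
  exact (hF.neg s (lt_of_lt_of_le hs ht)).symm

lemma measure_Iio_zero (hF : IsSubCDF F) : F.measure (Iio 0) = 0 := by
  rw [F.measure_Iio hF.tendsto_atBot, hF.leftLim_of_nonpos le_rfl]; simp

lemma restrict_Ici (hF : IsSubCDF F) : F.measure.restrict (Ici 0) = F.measure := by
  rw [Measure.restrict_eq_self_of_ae_mem]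
  rw [ae_iff]
  simpa [← Iio_def] using hF.measure_Iio_zero

lemma ae_nonneg (hF : IsSubCDF F) : ∀ᵐ t ∂F.measure, 0 ≤ t := by
  rw [ae_iff]; simpa [← Iio_def] using hF.measure_Iio_zero

lemma real_Icc_zero (hF : IsSubCDF F) (t : ℝ) : F.measure.real (Icc 0 t) = F t := by
  rw [measureReal_def, F.measure_Icc, hF.leftLim_of_nonpos le_rfl, sub_zero,
    ENNReal.toReal_ofReal (hF.nonneg t)]

lemma real_Ico_zero (hF : IsSubCDF F) (t : ℝ) : F.measure.real (Ico 0 t) = leftLim F t := by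
  rw [measureReal_def, F.measure_Ico, hF.leftLim_of_nonpos le_rfl, sub_zero,
    ENNReal.toReal_ofReal (hF.leftLim_nonneg t)]

lemma real_univ_le (hF : IsSubCDF F) : F.measure.real univ ≤ 1 := by
  have := hF.isFiniteMeasure
  have h : Tendsto (fun t => F.measure (Iic t)) atTop (𝓝 (F.measure univ)) :=
    tendsto_measure_Iic_atTop _
  have h2 : F.measure univ ≤ 1 := by
    refine le_of_tendsto' h fun t => ?_
    rw [F.measure_Iic hF.tendsto_atBot, sub_zero, ← ENNReal.ofReal_one]
    exact ENNReal.ofReal_le_ofReal (hF.le_one t)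
  exact ENNReal.toReal_le_of_le_ofReal zero_le_one (by simpa using h2)

lemma tendsto_atTop (hF : IsSubCDF F) : Tendsto F atTop (𝓝 (F.measure.real univ)) := by
  have := hF.isFiniteMeasure
  have h : Tendsto (fun t => F.measure (Iic t)) atTop (𝓝 (F.measure univ)) :=
    tendsto_measure_Iic_atTop _
  exact ((ENNReal.tendsto_toReal (measure_ne_top _ _)).comp h).congr fun t => hF.real_Iic t

lemma continuousAt_iff (F : StieltjesFunction ℝ) (t : ℝ) : ContinuousAt F t ↔ leftLim F t = F t := by
  rw [F.mono.continuousAt_iff_leftLim_eq_rightLim, F.rightLim_eq]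

lemma intervalIntegrable (F : StieltjesFunction ℝ) (r a b : ℝ) :
    IntervalIntegrable (fun s => Real.exp (-r * s) * F s) volume a b :=
  (F.mono.intervalIntegrable).continuousOn_mul (by fun_prop)

lemma integrableOn_exp (F : StieltjesFunction ℝ) (r a b : ℝ) (s : Set ℝ) (hs : s ⊆ Icc a b) :
    IntegrableOn (fun s => Real.exp (-r * s)) s F.measure :=
  (Continuous.integrableOn_Icc (by fun_prop)).mono_set hs

/-- Integration by parts for the discounted mass of `[0, t)`. -/
lemma setIntegral_exp_Ico (hF : IsSubCDF F) (r : ℝ) {t : ℝ} (ht : 0 ≤ t) :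
    ∫ s in Ico 0 t, Real.exp (-r * s) ∂F.measure
      = Real.exp (-r * t) * leftLim F t + r * ∫ s in 0..t, Real.exp (-r * s) * F s := by
  have := hF.isFiniteMeasure
  -- Fubini for `r * exp (-r * u)` on `s ≤ u`: integrating over `u` gives `exp (-r * s) - exp (-r *
  -- t)`, integrating over `s` gives the mass `F u` of `[0, u]`.
  have hswap := integral_integral_swap (μ := F.measure.restrict (Ico 0 t))
    (ν := volume.restrict (Ioo 0 t))
    (f := fun s u => {p : ℝ × ℝ | p.1 ≤ p.2}.indicator (fun p => r * Real.exp (-r * p.2)) (s, u)) ?_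
  · have hin : ∀ s ∈ Ico 0 t, ∫ u in Ioo 0 t, {p : ℝ × ℝ | p.1 ≤ p.2}.indicator
        (fun p => r * Real.exp (-r * p.2)) (s, u) = Real.exp (-r * s) - Real.exp (-r * t) := by
      intro s hs
      have h1 : ∫ u in s..t, r * Real.exp (-r * u) = Real.exp (-r * s) - Real.exp (-r * t) := by
        rw [intervalIntegral.integral_eq_sub_of_hasDerivAt (f := fun u => -Real.exp (-r * u))]
        · ring
        · intro u _
          have := ((hasDerivAt_id u).const_mul (-r)).exp.neg
          refine this.congr_deriv ?_
          simp; ring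
        · exact Continuous.intervalIntegrable (by fun_prop) _ _
      rw [← h1, intervalIntegral.integral_of_le hs.2.le, integral_Ioc_eq_integral_Ioo,
        ← integral_indicator measurableSet_Ioo, ← integral_indicator measurableSet_Ioo]
      refine integral_congr_ae ?_
      have h0 : ∀ᵐ u : ℝ, u ≠ s := by simp [ae_iff]
      filter_upwards [h0] with u hu
      simp only [indicator, mem_Ioo, mem_ofPred_eq]
      have := hs.1
      have hu' := hu.lt_or_gt
      split_ifs <;> grind
    have hout : ∀ u ∈ Ioo 0 t, ∫ s in Ico 0 t, {p : ℝ × ℝ | p.1 ≤ p.2}.indicator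
        (fun p => r * Real.exp (-r * p.2)) (s, u) ∂F.measure = r * (Real.exp (-r * u) * F u) := by
      intro u hu
      have : ∀ s, {p : ℝ × ℝ | p.1 ≤ p.2}.indicator
        (fun p => r * Real.exp (-r * p.2)) (s, u)
          = (Iic u).indicator (fun _ => r * Real.exp (-r * u)) s := fun s => rfl
      simp_rw [this]
      rw [setIntegral_indicator measurableSet_Iic, setIntegral_const]
      have h2 : Ico 0 t ∩ Iic u = Icc 0 u := by
        ext s; simp only [mem_inter_iff, mem_Ico, mem_Iic, mem_Icc]; have := hu.2; grind
      rw [h2, hF.real_Icc_zero, smul_eq_mul]; ring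
    rw [setIntegral_congr_fun measurableSet_Ico hin, setIntegral_congr_fun measurableSet_Ioo hout,
      integral_sub (integrableOn_exp F r 0 t _ Ico_subset_Icc_self)
        (integrable_const _), setIntegral_const, hF.real_Ico_zero,
        integral_const_mul, ← integral_Ioc_eq_integral_Ioo, ← intervalIntegral.integral_of_le ht,
        smul_eq_mul] at hswap
    linarith
  · refine Integrable.of_bound (C := |r| * Real.exp (|r| * t)) ?_ ?_
    · refine Measurable.aestronglyMeasurable ?_
      exact Measurable.indicator (by fun_prop) (measurableSet_le measurable_fst measurable_snd)
    · rw [Measure.prod_restrict]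
      filter_upwards [ae_restrict_mem (measurableSet_Ico.prod measurableSet_Ioo)] with p hp
      simp only [uncurry]
      refine (norm_indicator_le_norm_self _ _).trans ?_
      rw [norm_mul, Real.norm_eq_abs, Real.norm_eq_abs, Real.abs_exp]
      have h1 := hp.2
      refine mul_le_mul_of_nonneg_left (Real.exp_le_exp.2 ?_) (abs_nonneg r)
      change -r * p.2 ≤ |r| * t
      calc -r * p.2 ≤ |r| * p.2 := by
            apply mul_le_mul_of_nonneg_right _ h1.1.le
            exact neg_le_abs r
        _ ≤ |r| * t := by gcongr; exact h1.2.le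

end IsSubCDF

/-! ### The gain from waiting -/

/-- Discounted mass of `[0, t)` plus half of the discounted atom at `t`. -/
noncomputable def discHalf (F : StieltjesFunction ℝ) (r t : ℝ) : ℝ :=
  (∫ s in Ico 0 t, Real.exp (-r * s) ∂F.measure) + (F t - leftLim F t) * Real.exp (-r * t) / 2

/-- Survival functions: antitone, positive, and at most `1` from time `0` on. -/
structure IsSurvival (P : ℝ → ℝ) : Prop where
  anti : Antitone P
  pos : ∀ t, 0 < P t
  le_one : ∀ t, 0 ≤ t → P t ≤ 1

/-- Gain from waiting until `t` in a war of attrition: discounted concessions of the opponent, who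
concedes according to `F` and survives with probability `P`, net of the cost of delay. -/
noncomputable def waitGain (F : StieltjesFunction ℝ) (P : ℝ → ℝ) (z r lam t : ℝ) : ℝ :=
  (1 - z) * discHalf F r t - lam * ∫ s in 0..t, Real.exp (-r * s) * P s

namespace IsSubCDF

variable {F : StieltjesFunction ℝ} {r : ℝ}

lemma setIntegral_exp_Icc (hF : IsSubCDF F) (r : ℝ) {t : ℝ} (ht : 0 ≤ t) :
    ∫ s in Icc 0 t, Real.exp (-r * s) ∂F.measure
      = (∫ s in Ico 0 t, Real.exp (-r * s) ∂F.measure)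
        + (F t - leftLim F t) * Real.exp (-r * t) := by
  have := hF.isFiniteMeasure
  rw [← Ico_union_right ht, setIntegral_union (by simp) (measurableSet_singleton t)
    (integrableOn_exp F r 0 t _ Ico_subset_Icc_self)
    (integrableOn_exp F r 0 t _ (by simpa using ht)), integral_singleton, measureReal_def,
    F.measure_singleton, ENNReal.toReal_ofReal (sub_nonneg.2 (leftLim_le_self F t)), smul_eq_mul]

lemma setIntegral_exp_mono (F : StieltjesFunction ℝ) (r : ℝ) {s t : Set ℝ} {b : ℝ}
    (hst : s ⊆ t) (ht : t ⊆ Icc 0 b) :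
    ∫ s in s, Real.exp (-r * s) ∂F.measure ≤ ∫ s in t, Real.exp (-r * s) ∂F.measure :=
  setIntegral_mono_set (integrableOn_exp F r 0 b _ ht)
    (Eventually.of_forall fun _ => (Real.exp_pos _).le) hst.eventuallyLE

lemma jump_nonneg (F : StieltjesFunction ℝ) (r t : ℝ) :
    0 ≤ (F t - leftLim F t) * Real.exp (-r * t) :=
  mul_nonneg (sub_nonneg.2 (leftLim_le_self F t)) (Real.exp_pos _).le

lemma discHalf_le_Icc (hF : IsSubCDF F) (r : ℝ) {t : ℝ} (ht : 0 ≤ t) :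
    discHalf F r t ≤ ∫ s in Icc 0 t, Real.exp (-r * s) ∂F.measure := by
  rw [hF.setIntegral_exp_Icc r ht, discHalf]
  linarith [jump_nonneg F r t]

lemma Icc_le_discHalf (F : StieltjesFunction ℝ) (r : ℝ) {t v : ℝ} (htv : t < v) :
    ∫ s in Icc 0 t, Real.exp (-r * s) ∂F.measure ≤ discHalf F r v := by
  have h := setIntegral_exp_mono F r (Icc_subset_Ico_right htv : Icc 0 t ⊆ Ico 0 v)
    Ico_subset_Icc_self
  have := jump_nonneg F r v
  rw [discHalf]; linarith

/-- Conceding at `t` earns half of the atom there and conceding earlier earns none of it, whereas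
any later time earns all of it. -/
lemma le_discHalf_sub (hF : IsSubCDF F) {s t v : ℝ} (hs : 0 ≤ s) (hst : s ≤ t) (htv : t < v) :
    (F t - leftLim F t) * Real.exp (-r * t) / 2 ≤ discHalf F r v - discHalf F r s := by
  have h1 := Icc_le_discHalf F r htv
  rw [hF.setIntegral_exp_Icc r (hs.trans hst)] at h1
  rcases hst.eq_or_lt with rfl | hst'
  · rw [discHalf.eq_def F r s]; linarith
  · have h2 := hF.discHalf_le_Icc r hs
    have h3 := setIntegral_exp_mono F r (Icc_subset_Ico_right hst' : Icc 0 s ⊆ Ico 0 t)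
      Ico_subset_Icc_self
    linarith [jump_nonneg F r t]

/-- The bound vanishes where `F` is flat and continuous, so that waiting there has only a cost. The
left limit at `s` allows for the half atom not yet counted at `s`. -/
lemma discHalf_sub_le (hF : IsSubCDF F) (hr : 0 ≤ r) {s v : ℝ} (hs : 0 ≤ s) (hsv : s ≤ v) :
    discHalf F r v - discHalf F r s ≤ F v - leftLim F s := by
  have := hF.isFiniteMeasure
  have h1 := hF.discHalf_le_Icc r (hs.trans hsv)
  have h2 : ∫ s in Icc 0 v, Real.exp (-r * s) ∂F.measure
      = (∫ s in Ico 0 s, Real.exp (-r * s) ∂F.measure)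
        + ∫ s in Icc s v, Real.exp (-r * s) ∂F.measure := by
    rw [← Ico_union_Icc_eq_Icc hs hsv, setIntegral_union _ measurableSet_Icc
      (integrableOn_exp F r 0 s _ Ico_subset_Icc_self) (integrableOn_exp F r s v _ subset_rfl)]
    rw [Set.disjoint_left]
    intro x hx hx'
    exact absurd hx'.1 (not_le.2 hx.2)
  have h3 : ∫ s in Icc s v, Real.exp (-r * s) ∂F.measure ≤ F v - leftLim F s := by
    have : F.measure.real (Icc s v) = F v - leftLim F s := by
      rw [measureReal_def, F.measure_Icc, ENNReal.toReal_ofReal]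
      exact sub_nonneg.2 (F.mono.leftLim_le hsv)
    rw [← this]
    calc ∫ s in Icc s v, Real.exp (-r * s) ∂F.measure ≤ ∫ s in Icc s v, (1 : ℝ) ∂F.measure := by
          refine setIntegral_mono_on (integrableOn_exp F r s v _ subset_rfl)
            (integrable_const _).integrableOn measurableSet_Icc fun x hx => ?_
          rw [Real.exp_le_one_iff]
          nlinarith [hx.1]
      _ = _ := by simp
  have h4 := jump_nonneg F r s
  have h5 : discHalf F r s = _ := discHalf.eq_def F r s
  linarith

lemma discHalf_eq (hF : IsSubCDF F) (r : ℝ) {t : ℝ} (ht : 0 ≤ t) :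
    discHalf F r t = Real.exp (-r * t) * (F t + leftLim F t) / 2
      + r * ∫ s in 0..t, Real.exp (-r * s) * F s := by
  rw [discHalf, hF.setIntegral_exp_Ico r ht]; ring

end IsSubCDF

namespace IsSurvival

variable {P : ℝ → ℝ}

lemma intervalIntegrable (hP : IsSurvival P) (r a b : ℝ) :
    IntervalIntegrable (fun s => Real.exp (-r * s) * P s) volume a b :=
  hP.anti.intervalIntegrable.continuousOn_mul (by fun_prop)

lemma integral_pos (hP : IsSurvival P) (r : ℝ) {a b : ℝ} (hab : a < b) :
    0 < ∫ s in a..b, Real.exp (-r * s) * P s :=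
  intervalIntegral.intervalIntegral_pos_of_pos (hP.intervalIntegrable r a b)
    (fun s => mul_pos (Real.exp_pos _) (hP.pos s)) hab

lemma integral_le (hP : IsSurvival P) {r : ℝ} (hr : 0 ≤ r) {a b : ℝ} (ha : 0 ≤ a) (hab : a ≤ b) :
    ∫ s in a..b, Real.exp (-r * s) * P s ≤ b - a := by
  have : ∫ s in a..b, (1 : ℝ) = b - a := by simp
  rw [← this]
  refine intervalIntegral.integral_mono_on hab (hP.intervalIntegrable r a b) (by simp) fun x hx => ?_
  have hx0 : 0 ≤ x := ha.trans hx.1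
  have h1 : Real.exp (-r * x) ≤ 1 := by
    rw [Real.exp_le_one_iff]; nlinarith
  exact mul_le_one₀ h1 (hP.pos x).le (hP.le_one x hx0)

lemma integral_split (hP : IsSurvival P) (r a b c : ℝ) :
    (∫ s in a..b, Real.exp (-r * s) * P s) + (∫ s in b..c, Real.exp (-r * s) * P s)
      = ∫ s in a..c, Real.exp (-r * s) * P s :=
  intervalIntegral.integral_add_adjacent_intervals (hP.intervalIntegrable r a b)
    (hP.intervalIntegrable r b c)

end IsSurvival

/-- The properties of the gain from waiting that the war of attrition rests on. -/
structure IsWaitGain (F : StieltjesFunction ℝ) (W : ℝ → ℝ) : Prop where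
  lt_of_const : ∀ s u v, 0 ≤ s → s < u → u < v → F v = F s → W v < W u
  lt_of_atom : ∀ t, 0 ≤ t → leftLim F t < F t →
    ∃ ε > 0, ∃ v > t, ∀ s, 0 ≤ s → t - ε ≤ s → s ≤ t → W s < W v
  continuousAt : ∀ t, 0 < t → ContinuousAt F t → ContinuousAt W t

lemma isWaitGain_waitGain {F : StieltjesFunction ℝ} {P : ℝ → ℝ} {z r lam : ℝ} (hF : IsSubCDF F)
    (hP : IsSurvival P) (hz : z < 1) (hr : 0 ≤ r) (hl : 0 < lam) :
    IsWaitGain F (waitGain F P z r lam) where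
  lt_of_const s u v hs hsu huv h := by
    have h1 := hF.discHalf_sub_le hr (hs.trans hsu.le) huv.le
    have h2 : F s ≤ leftLim F u := F.mono.le_leftLim hsu
    have h3 := hP.integral_pos r huv
    have h4 := hP.integral_split r 0 u v
    have h5 : (1 - z) * (discHalf F r v - discHalf F r u) ≤ 0 :=
      mul_nonpos_of_nonneg_of_nonpos (by linarith) (by linarith)
    have h6 := mul_pos hl h3
    simp only [waitGain]
    rw [← h4]; linarith
  lt_of_atom t ht h := by
    set j := (1 - z) * ((F t - leftLim F t) * Real.exp (-r * t) / 2) with hj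
    have hjpos : 0 < j := mul_pos (by linarith)
      (half_pos (mul_pos (sub_pos.2 h) (Real.exp_pos _)))
    -- The delay from `s` to `v` is at most `2 * (j / (4 * lam))`, since survival and discounting
    -- are at most one; it costs at most `j / 2`, less than the gain `j` from the other half of the
    -- atom.
    refine ⟨j / (4 * lam), by positivity, t + j / (4 * lam), by simp; positivity, ?_⟩
    intro s hs hs1 hs2
    have h1 := hF.le_discHalf_sub (r := r) (v := t + j / (4 * lam)) hs hs2 (by simp; positivity)
    have h4 := hP.integral_split r 0 s (t + j / (4 * lam))
    have hle : s ≤ t + j / (4 * lam) := by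
      have : 0 < j / (4 * lam) := by positivity
      linarith
    have h5 := hP.integral_le hr hs hle
    have h6 := mul_le_mul_of_nonneg_left h1 (by linarith : 0 ≤ 1 - z)
    have h7 : lam * (∫ s in s..(t + j / (4 * lam)), Real.exp (-r * s) * P s)
        ≤ lam * (2 * (j / (4 * lam))) := mul_le_mul_of_nonneg_left (by linarith) hl.le
    have h8 : lam * (2 * (j / (4 * lam))) = j / 2 := by field_simp; ring
    simp only [waitGain]
    rw [← h4]; linarith
  continuousAt t ht hc := by
    have hI : ContinuousAt (fun t => ∫ s in 0..t, Real.exp (-r * s) * P s) t :=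
      (intervalIntegral.continuous_primitive (fun a b => hP.intervalIntegrable r a b) 0).continuousAt
    have hI' : ContinuousAt (fun t => ∫ s in 0..t, Real.exp (-r * s) * F s) t :=
      (intervalIntegral.continuous_primitive
        (fun a b => IsSubCDF.intervalIntegrable F r a b) 0).continuousAt
    -- The left limit is squeezed between `F (x - δ / 2)` and `F x`, both close to `F t`.
    have hL : ContinuousAt (leftLim F) t := by
      rw [Metric.continuousAt_iff] at hc ⊢
      intro ε hε
      obtain ⟨δ, hδ, h⟩ := hc ε hε
      refine ⟨δ / 2, by positivity, fun x hx => ?_⟩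
      have hFt : leftLim F t = F t := by
        rw [← IsSubCDF.continuousAt_iff]; exact Metric.continuousAt_iff.2 hc
      rw [hFt]
      have h1 := h (x := x) (by linarith)
      have h2 := h (x := x - δ / 2) (by
        rw [Real.dist_eq] at hx ⊢
        rw [abs_lt] at hx ⊢
        constructor <;> linarith [hx.1, hx.2])
      have h3 : F (x - δ / 2) ≤ leftLim F x := F.mono.le_leftLim (by linarith)
      have h4 : leftLim F x ≤ F x := F.mono.leftLim_le le_rfl
      rw [Real.dist_eq, abs_lt] at h1 h2 ⊢
      constructor <;> linarith [h1.1, h1.2, h2.1, h2.2]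
    have hA : ContinuousAt (fun t => (1 - z) * (Real.exp (-r * t) * (F t + leftLim F t) / 2
      + r * ∫ s in 0..t, Real.exp (-r * s) * F s)
        - lam * ∫ s in 0..t, Real.exp (-r * s) * P s) t := by
      have hexp : ContinuousAt (fun t => Real.exp (-r * t)) t := by fun_prop
      exact (continuousAt_const.mul (((hexp.mul (hc.add hL)).div_const 2).add
        (continuousAt_const.mul hI'))).sub (continuousAt_const.mul hI)
    refine hA.congr ?_
    filter_upwards [lt_mem_nhds ht] with x hx
    rw [waitGain, hF.discHalf_eq r hx.le]

/-! ### The war of attrition: atoms, gaps and indifference -/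

/-- `F` only puts mass on maximizers of `W`, the maximum being `m`. -/
structure IsOptimalFor (F : StieltjesFunction ℝ) (W : ℝ → ℝ) (m : ℝ) : Prop where
  le : ∀ t, 0 ≤ t → W t ≤ m
  ae : ∀ᵐ t ∂F.measure, W t = m

namespace IsOptimalFor

variable {F : StieltjesFunction ℝ} {W : ℝ → ℝ} {m : ℝ}

lemma measure_eq_zero (h : IsOptimalFor F W m) {s : Set ℝ} (hs : ∀ t ∈ s, W t < m) :
    F.measure s = 0 :=
  measure_mono_null (fun t ht => (hs t ht).ne) (ae_iff.1 h.ae)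

lemma eq_of_lt (h : IsOptimalFor F W m) {s t : ℝ} (hst : s ≤ t) (hlt : ∀ u ∈ Ioc s t, W u < m) :
    F t = F s := by
  have h0 := h.measure_eq_zero hlt
  rw [F.measure_Ioc, ENNReal.ofReal_eq_zero] at h0
  linarith [F.mono hst]

lemma leftLim_eq_of_lt (h : IsOptimalFor F W m) {s t : ℝ} (hst : s ≤ t)
    (hlt : ∀ u ∈ Icc s t, W u < m) : F t = leftLim F s := by
  have h0 := h.measure_eq_zero hlt
  rw [F.measure_Icc, ENNReal.ofReal_eq_zero] at h0
  linarith [F.mono.leftLim_le hst]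

lemma eq_of_atom (h : IsOptimalFor F W m) {t : ℝ} (ht : 0 ≤ t) (hat : leftLim F t < F t) :
    W t = m := by
  by_contra hne
  have := h.leftLim_eq_of_lt (le_refl t) fun u hu => by
    obtain rfl : u = t := le_antisymm hu.2 hu.1
    exact lt_of_le_of_ne (h.le u ht) hne
  linarith

end IsOptimalFor

section War

variable {F₁ F₂ : StieltjesFunction ℝ} {W₁ W₂ : ℝ → ℝ} {m₁ m₂ : ℝ}

/-- If player 2 conceded with an atom at `t > 0`, player 1 would rather wait past `t` than concede
shortly before or at `t`. Player 1's concessions then stop on an interval ending at `t`, and player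
2 gains by conceding earlier in it. -/
lemma war_continuousAt (hW₁ : IsWaitGain F₂ W₁) (hW₂ : IsWaitGain F₁ W₂)
    (h₁ : IsOptimalFor F₁ W₁ m₁) (h₂ : IsOptimalFor F₂ W₂ m₂) {t : ℝ} (ht : 0 < t) :
    ContinuousAt F₂ t := by
  rw [IsSubCDF.continuousAt_iff]
  by_contra hne
  have hlt : leftLim F₂ t < F₂ t := lt_of_le_of_ne (F₂.mono.leftLim_le le_rfl) hne
  obtain ⟨ε, hε, v, hv, h⟩ := hW₁.lt_of_atom t ht.le hlt
  have hs0 : max 0 (t - ε) < t := max_lt ht (by linarith)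
  have hc : F₁ t = F₁ (max 0 (t - ε)) := h₁.eq_of_lt hs0.le fun u hu =>
    (h u ((le_max_left _ _).trans hu.1.le) ((le_max_right _ _).trans hu.1.le) hu.2).trans_le
      (h₁.le v (ht.le.trans hv.le))
  obtain ⟨u, hu1, hu2⟩ := exists_between hs0
  have h3 := hW₂.lt_of_const _ u t (le_max_left _ _) hu1 hu2 hc
  have h4 := h₂.eq_of_atom ht.le hlt
  have h5 := h₂.le u ((le_max_left _ _).trans hu1.le)
  linarith

/-- An atom of player 2 at 0 makes waiting a little strictly better for player 1 than conceding at
0, where a tie earns only half. -/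
lemma war_atom_zero (hW₁ : IsWaitGain F₂ W₁) (h₁ : IsOptimalFor F₁ W₁ m₁)
    (hF₁ : IsSubCDF F₁) (hF₂ : IsSubCDF F₂) (h : 0 < F₂ 0) : F₁ 0 = 0 := by
  obtain ⟨ε, hε, v, hv, h'⟩ := hW₁.lt_of_atom 0 le_rfl (by rwa [hF₂.leftLim_of_nonpos le_rfl])
  have h0 := h' 0 le_rfl (by linarith) le_rfl
  by_contra hne
  have h1 := h₁.eq_of_atom le_rfl (t := 0) (by
    rw [hF₁.leftLim_of_nonpos le_rfl]; exact lt_of_le_of_ne (hF₁.nonneg 0) (Ne.symm hne))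
  have := h₁.le v hv.le
  linarith

/-- At the right end `b` of a maximal flat interval of `F₂`, player 1 has not conceded on the
interval either, so conceding at `b` is strictly suboptimal for player 2. By continuity of `W₂` this
persists beyond `b`, which extends the flat interval. -/
lemma war_const (hW₁ : IsWaitGain F₂ W₁) (hW₂ : IsWaitGain F₁ W₂)
    (h₁ : IsOptimalFor F₁ W₁ m₁) (h₂ : IsOptimalFor F₂ W₂ m₂) {s t : ℝ} (hs : 0 ≤ s)
    (hst : s < t) (h : F₂ t = F₂ s) {v : ℝ} (hv : s ≤ v) : F₂ v = F₂ s := by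
  by_contra hne
  set S := {u | s ≤ u ∧ F₂ u = F₂ s} with hS
  have hbdd : BddAbove S := ⟨v, fun u hu => by
    by_contra hlt
    push Not at hlt
    exact hne (le_antisymm ((F₂.mono hlt.le).trans hu.2.le) (F₂.mono hv))⟩
  set b := sSup S with hb
  have htS : t ∈ S := ⟨hst.le, h⟩
  have htb : t ≤ b := le_csSup hbdd htS
  have hb0 : 0 < b := hs.trans_lt (hst.trans_le htb)
  have hsb : s < b := hst.trans_le htb
  have hlow : ∀ u, s ≤ u → u < b → F₂ u = F₂ s := fun u hu hub => by
    obtain ⟨w, hw, huw⟩ := exists_lt_of_lt_csSup ⟨t, htS⟩ hub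
    exact le_antisymm ((F₂.mono huw.le).trans hw.2.le) (F₂.mono hu)
  have hcb : ContinuousAt F₂ b := war_continuousAt hW₁ hW₂ h₁ h₂ hb0
  have hFb : F₂ b = F₂ s := by
    rw [← (IsSubCDF.continuousAt_iff F₂ b).1 hcb]
    refine leftLim_eq_of_tendsto ?_
    refine tendsto_const_nhds.congr' ?_
    filter_upwards [Ioo_mem_nhdsLT hsb] with u hu
    exact (hlow u hu.1.le hu.2).symm
  have hconst : F₁ b = F₁ s := h₁.eq_of_lt hsb.le fun u hu => by
    obtain ⟨u', h1, h2⟩ := exists_between hu.1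
    have hFu : F₂ u = F₂ s := by
      rcases hu.2.eq_or_lt with rfl | h3
      · exact hFb
      · exact hlow u hu.1.le h3
    exact (hW₁.lt_of_const s u' u hs h1 h2 hFu).trans_le (h₁.le u' (hs.trans h1.le))
  obtain ⟨u, hu1, hu2⟩ := exists_between hsb
  have hlt : W₂ b < m₂ :=
    (hW₂.lt_of_const s u b hs hu1 hu2 hconst).trans_le (h₂.le u (hs.trans hu1.le))
  have hcW : ContinuousAt W₂ b := hW₂.continuousAt b hb0 (war_continuousAt hW₂ hW₁ h₂ h₁ hb0)
  have hev := hcW.eventually (gt_mem_nhds hlt)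
  obtain ⟨δ, hδ, hball⟩ := Metric.eventually_nhds_iff.1 hev
  have hmem : b + δ / 2 ∈ S := by
    refine ⟨by linarith, ?_⟩
    rw [← hFb]
    refine h₂.eq_of_lt (by linarith) fun y hy => hball ?_
    rw [Real.dist_eq, abs_lt]; constructor <;> linarith [hy.1, hy.2]
  have := le_csSup hbdd hmem
  linarith

/-- A pause of either player makes the other stop, and by `war_const` a pause of player 2 is final.
-/
lemma war_lt (hW₁ : IsWaitGain F₂ W₁) (hW₂ : IsWaitGain F₁ W₂)
    (h₁ : IsOptimalFor F₁ W₁ m₁) (h₂ : IsOptimalFor F₂ W₂ m₂) {s t v : ℝ} (hs : 0 ≤ s)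
    (hst : s < t) (hsv : s ≤ v) (h : F₂ s < F₂ v) : F₁ s < F₁ t ∧ F₂ s < F₂ t := by
  have hlt₂ : F₂ s < F₂ t := by
    refine lt_of_le_of_ne (F₂.mono hst.le) fun heq => ?_
    rw [war_const hW₁ hW₂ h₁ h₂ hs hst heq.symm hsv] at h
    exact lt_irrefl _ h
  refine ⟨lt_of_le_of_ne (F₁.mono hst.le) fun heq => ?_, hlt₂⟩
  have := h₂.eq_of_lt hst.le fun u hu => by
    obtain ⟨u', h1, h2⟩ := exists_between hu.1
    have hFu : F₁ u = F₁ s := le_antisymm ((F₁.mono hu.2).trans heq.symm.le) (F₁.mono hu.1.le)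
    exact (hW₂.lt_of_const s u' u hs h1 h2 hFu).trans_le (h₂.le u' (hs.trans h1.le))
  linarith

lemma war_eq_of_strict {F : StieltjesFunction ℝ} {W : ℝ → ℝ} {m : ℝ} (h : IsOptimalFor F W m)
    {s : ℝ} (hs : 0 < s) (hW : ContinuousAt W s) (hlt : ∀ t, s < t → F s < F t) : W s = m := by
  by_contra hne
  have hlt' : W s < m := lt_of_le_of_ne (h.le s hs.le) hne
  obtain ⟨δ, hδ, hball⟩ := Metric.eventually_nhds_iff.1 (hW.eventually (gt_mem_nhds hlt'))
  have := h.eq_of_lt (t := s + δ / 2) (s := s) (by linarith) fun y hy => hball (by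
    rw [Real.dist_eq, abs_lt]; constructor <;> linarith [hy.1, hy.2])
  linarith [hlt (s + δ / 2) (by linarith)]

/-- While player 2 may still concede, both players are indifferent between all times. -/
lemma war_indifferent (hW₁ : IsWaitGain F₂ W₁) (hW₂ : IsWaitGain F₁ W₂)
    (h₁ : IsOptimalFor F₁ W₁ m₁) (h₂ : IsOptimalFor F₂ W₂ m₂) {s v : ℝ} (hs : 0 < s)
    (hsv : s ≤ v) (h : F₂ s < F₂ v) : W₁ s = m₁ ∧ W₂ s = m₂ := by
  have hlt := fun t (hst : s < t) => war_lt hW₁ hW₂ h₁ h₂ hs.le hst hsv h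
  exact ⟨war_eq_of_strict h₁ hs
      (hW₁.continuousAt s hs (war_continuousAt hW₁ hW₂ h₁ h₂ hs)) fun t ht => (hlt t ht).1,
    war_eq_of_strict h₂ hs
      (hW₂.continuousAt s hs (war_continuousAt hW₂ hW₁ h₂ h₁ hs)) fun t ht => (hlt t ht).2⟩

end War

/-! ### From indifference to differential equations and back -/

lemma hasDerivAt_integral_exp_mul (r : ℝ) {f : ℝ → ℝ} {t : ℝ} (hm : Measurable f)
    (hi : IntervalIntegrable (fun s => Real.exp (-r * s) * f s) volume 0 t)
    (hc : ContinuousAt f t) :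
    HasDerivAt (fun t => ∫ s in 0..t, Real.exp (-r * s) * f s) (Real.exp (-r * t) * f t) t := by
  refine intervalIntegral.integral_hasDerivAt_right hi ?_ ?_
  · exact (Measurable.stronglyMeasurable (by fun_prop)).stronglyMeasurableAtFilter
  · exact ContinuousAt.mul (by fun_prop) hc

lemma hasDerivAt_exp_const_mul (a t : ℝ) :
    HasDerivAt (fun t => Real.exp (a * t)) (a * Real.exp (a * t)) t := by
  have := ((hasDerivAt_id t).const_mul a).exp
  refine this.congr_deriv ?_
  simp [mul_comm]

lemma eq_of_hasDerivAt_zero {f : ℝ → ℝ} {a b : ℝ} (hab : a ≤ b) (hc : ContinuousOn f (Icc a b))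
    (hd : ∀ x ∈ Ioo a b, HasDerivAt f 0 x) : f b = f a := by
  rcases hab.eq_or_lt with rfl | h
  · rfl
  · obtain ⟨c, _, hc'⟩ := exists_hasDerivAt_eq_slope f (fun _ => 0) h hc hd
    rw [eq_comm, div_eq_zero_iff] at hc'
    rcases hc' with h' | h' <;> linarith

namespace IsSubCDF

variable {F : StieltjesFunction ℝ} {r : ℝ}

lemma discHalf_eq_of_continuousAt (hF : IsSubCDF F) (r : ℝ) {t : ℝ} (ht : 0 ≤ t)
    (hc : ContinuousAt F t) :
    discHalf F r t = Real.exp (-r * t) * F t + r * ∫ s in 0..t, Real.exp (-r * s) * F s := by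
  rw [hF.discHalf_eq r ht, (continuousAt_iff F t).1 hc]; ring

/-- Solving the formula for `discHalf` for `F t` expresses it through primitives of functions
continuous at `t`. Continuity of `F` thus improves to differentiability, and the terms in `r` cancel
in the derivative. -/
lemma hasDerivAt_of_discHalf (hF : IsSubCDF F) {b C : ℝ} {p : ℝ → ℝ} (hpm : Measurable p)
    (hcF : ∀ t ∈ Ioo 0 b, ContinuousAt F t) (hcp : ∀ t ∈ Ioo 0 b, ContinuousAt p t)
    (hpi : ∀ t, IntervalIntegrable (fun s => Real.exp (-r * s) * p s) volume 0 t)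
    (h : ∀ t ∈ Ioo 0 b, discHalf F r t = C + ∫ s in 0..t, Real.exp (-r * s) * p s) :
    ∀ t ∈ Ioo 0 b, HasDerivAt F (p t) t := by
  intro t ht
  have h1 := hasDerivAt_integral_exp_mul r hpm (hpi t) (hcp t ht)
  have h2 := hasDerivAt_integral_exp_mul r F.mono.measurable (intervalIntegrable F r 0 t) (hcF t ht)
  have h3 := ((hasDerivAt_exp_const_mul r t).mul ((h1.const_add C).sub (h2.const_mul r)))
  have hexp : ∀ x, Real.exp (r * x) * Real.exp (-r * x) = 1 := fun x => by
    rw [← Real.exp_add]; simp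
  have h4 : ∀ x ∈ Ioo 0 b, F x = Real.exp (r * x) * ((C + ∫ s in 0..x, Real.exp (-r * s) * p s)
      - r * ∫ s in 0..x, Real.exp (-r * s) * F s) := by
    intro x hx
    rw [← h x hx, hF.discHalf_eq_of_continuousAt r hx.1.le (hcF x hx)]
    linear_combination -(F x) * hexp x
  refine (h3.congr_of_eventuallyEq ?_).congr_deriv ?_
  · filter_upwards [Ioo_mem_nhds ht.1 ht.2] with x hx using h4 x hx
  · have := h4 t ht
    simp only [Pi.sub_apply]
    linear_combination (-r) * this + (p t - r * F t) * hexp t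

lemma hasDerivAt_of_waitGain (hF : IsSubCDF F) {P : ℝ → ℝ} (hP : IsSurvival P) {b z lam m : ℝ}
    (hz : z < 1) (hcF : ∀ t ∈ Ioo 0 b, ContinuousAt F t) (hcP : ∀ t ∈ Ioo 0 b, ContinuousAt P t)
    (h : ∀ t ∈ Ioo 0 b, waitGain F P z r lam t = m) :
    ∀ t ∈ Ioo 0 b, HasDerivAt F (lam / (1 - z) * P t) t := by
  have hz' : (1 - z) ≠ 0 := by linarith
  refine hF.hasDerivAt_of_discHalf (r := r) (C := m / (1 - z)) (hP.anti.measurable.const_mul _) hcF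
    (fun t ht => continuousAt_const.mul (hcP t ht)) (fun t => ?_) fun t ht => ?_
  · simp_rw [mul_left_comm _ (lam / (1 - z))]
    exact (hP.intervalIntegrable r 0 t).const_mul _
  · have := h t ht
    rw [waitGain] at this
    simp_rw [mul_left_comm _ (lam / (1 - z))]
    rw [intervalIntegral.integral_const_mul]
    have h' : discHalf F r t = (m + lam * ∫ s in 0..t, Real.exp (-r * s) * P s) / (1 - z) := by
      rw [eq_div_iff hz']; linarith
    rw [h']; ring

lemma waitGain_zero (hF : IsSubCDF F) (P : ℝ → ℝ) (z r lam : ℝ) :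
    waitGain F P z r lam 0 = (1 - z) * F 0 / 2 := by
  rw [waitGain, hF.discHalf_eq r le_rfl, hF.leftLim_of_nonpos le_rfl]
  simp; ring

lemma waitGain_of_hasDerivAt (hF : IsSubCDF F) {P : ℝ → ℝ} (hP : IsSurvival P) {b z lam : ℝ}
    (hz : z < 1) (hcF : ∀ t, 0 < t → ContinuousAt F t) (hcP : ∀ t ∈ Ioo 0 b, ContinuousAt P t)
    (hd : ∀ t ∈ Ioo 0 b, HasDerivAt F (lam / (1 - z) * P t) t) {t : ℝ} (ht : 0 < t) (htb : t ≤ b) :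
    waitGain F P z r lam t = (1 - z) * F 0 := by
  have hz' : (1 - z) ≠ 0 := by linarith
  -- `Φ` counts atoms in full, so it is continuous from the right at 0 and `Φ 0 = (1 - z) * F 0`. At
  -- 0 itself `waitGain` counts only half of the atom, which is why the conclusion needs `0 < t`.
  set Φ : ℝ → ℝ := fun t => (1 - z) * (Real.exp (-r * t) * F t
    + r * ∫ s in 0..t, Real.exp (-r * s) * F s) - lam * ∫ s in 0..t, Real.exp (-r * s) * P s with hΦ
  have h0 : Φ t = Φ 0 := by
    refine eq_of_hasDerivAt_zero ht.le ?_ fun x hx => ?_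
    · have hI : Continuous (fun t => ∫ s in 0..t, Real.exp (-r * s) * P s) :=
        intervalIntegral.continuous_primitive (fun a b => hP.intervalIntegrable r a b) 0
      have hI' : Continuous (fun t => ∫ s in 0..t, Real.exp (-r * s) * F s) :=
        intervalIntegral.continuous_primitive (fun a b => intervalIntegrable F r a b) 0
      have hFc : ContinuousOn F (Icc 0 t) := fun x hx => by
        rcases hx.1.eq_or_lt with rfl | hx0
        · exact (F.right_continuous 0).mono Icc_subset_Ici_self
        · exact (hcF x hx0).continuousWithinAt
      have he : ContinuousOn (fun t => Real.exp (-r * t)) (Icc 0 t) := by fun_prop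
      exact (continuousOn_const.mul ((he.mul hFc).add
        (continuousOn_const.mul hI'.continuousOn))).sub (continuousOn_const.mul hI.continuousOn)
    · have hxb : x ∈ Ioo 0 b := ⟨hx.1, hx.2.trans_le htb⟩
      have h1 := hasDerivAt_integral_exp_mul r hP.anti.measurable (hP.intervalIntegrable r 0 x)
        (hcP x hxb)
      have h2 := hasDerivAt_integral_exp_mul r F.mono.measurable (intervalIntegrable F r 0 x)
        (hcF x hx.1)
      have h3 := (((hasDerivAt_exp_const_mul (-r) x).mul (hd x hxb)).add
        (h2.const_mul r)).const_mul (1 - z)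
      refine (h3.sub (h1.const_mul lam)).congr_deriv ?_
      field_simp
      ring
  rw [waitGain, hF.discHalf_eq_of_continuousAt r ht.le (hcF t ht)]
  simpa [hΦ] using h0

lemma waitGain_le_of_const (hF : IsSubCDF F) {P : ℝ → ℝ} (hP : IsSurvival P) {b v z lam : ℝ}
    (hz : z < 1) (hr : 0 ≤ r) (hl : 0 < lam) (hb : 0 ≤ b) (hcF : ContinuousAt F b) (hbv : b ≤ v)
    (h : F v = F b) : waitGain F P z r lam v ≤ waitGain F P z r lam b := by
  have h1 := hF.discHalf_sub_le hr hb hbv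
  rw [(continuousAt_iff F b).1 hcF, h, sub_self] at h1
  have h2 := mul_nonpos_of_nonneg_of_nonpos (by linarith : 0 ≤ 1 - z) h1
  have h3 := hP.integral_split r 0 b v
  have h4 : 0 ≤ ∫ s in b..v, Real.exp (-r * s) * P s :=
    intervalIntegral.integral_nonneg hbv fun s _ => (mul_pos (Real.exp_pos _) (hP.pos s)).le
  have h5 := mul_nonneg hl.le h4
  rw [waitGain, waitGain, ← h3]
  linarith

end IsSubCDF

/-! ### Payoffs as gains from waiting -/

lemma mul_integral_exp (r t : ℝ) : r * ∫ s in 0..t, Real.exp (-r * s) = 1 - Real.exp (-r * t) := by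
  rw [← intervalIntegral.integral_const_mul,
    intervalIntegral.integral_eq_sub_of_hasDerivAt (f := fun u => -Real.exp (-r * u))]
  · simp; ring
  · intro u _
    exact (hasDerivAt_exp_const_mul (-r) u).neg.congr_deriv (by ring)
  · exact Continuous.intervalIntegrable (by fun_prop) _ _

lemma integral_exp_mul_exp (r g t : ℝ) :
    ∫ s in 0..t, Real.exp (-r * s) * (g * Real.exp (-g * s))
      = 1 - Real.exp (-r * t) * Real.exp (-g * t)
        - r * ∫ s in 0..t, Real.exp (-r * s) * Real.exp (-g * s) := by
  have h : ∫ s in 0..t, (Real.exp (-r * s) * (g * Real.exp (-g * s))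
      + r * (Real.exp (-r * s) * Real.exp (-g * s)))
      = 1 - Real.exp (-r * t) * Real.exp (-g * t) := by
    rw [intervalIntegral.integral_eq_sub_of_hasDerivAt
      (f := fun u => -(Real.exp (-r * u) * Real.exp (-g * u)))]
    · simp; ring
    · intro u _
      exact ((hasDerivAt_exp_const_mul (-r) u).mul
        (hasDerivAt_exp_const_mul (-g) u)).neg.congr_deriv (by ring)
    · exact Continuous.intervalIntegrable (by fun_prop) _ _
  rw [intervalIntegral.integral_add (Continuous.intervalIntegrable (by fun_prop) _ _)
    (Continuous.intervalIntegrable (by fun_prop) _ _), intervalIntegral.integral_const_mul] at h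
  linarith

lemma StrategyOne.isSubCDF_F (S : StrategyOne) : IsSubCDF S.F := by
  refine ⟨S.F_neg, fun t => ?_⟩
  have h1 := S.add_le_one t
  have h2 : S.G (min t (-1)) = 0 := S.G_neg _ (lt_of_le_of_lt (min_le_right _ _) (by norm_num))
  have h3 := S.G.mono (min_le_left t (-1))
  linarith

lemma StrategyOne.isSubCDF_G (S : StrategyOne) : IsSubCDF S.G :=
  ⟨S.G_neg, fun t => by linarith [S.add_le_one t, S.isSubCDF_F.nonneg t]⟩

lemma StrategyTwo.isSubCDF (S : StrategyTwo) : IsSubCDF S.F := ⟨S.F_neg, S.F_le_one⟩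

namespace BargainingGame

variable (B : BargainingGame)

lemma D_pos : 0 < B.D := by have := B.a₂_mem.1; rw [D]; linarith

lemma lam₁_pos : 0 < B.lam₁ :=
  div_pos (mul_pos B.r₂_pos (by linarith [B.a₁_mem.2])) B.D_pos

lemma lam₂_pos : 0 < B.lam₂ :=
  div_pos (mul_pos B.r₁_pos (by linarith [B.a₂_mem.2])) B.D_pos

lemma D_mul_lam₁ : B.D * B.lam₁ = B.r₂ * (1 - B.a₁) := by
  have := B.D_pos.ne'; rw [lam₁]; field_simp

lemma D_mul_lam₂ : B.D * B.lam₂ = B.r₁ * (1 - B.a₂) := by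
  have := B.D_pos.ne'; rw [lam₂]; field_simp

/-- Probability that player 1 has neither conceded nor challenged by time `t`. -/
noncomputable def surv₁ (S : StrategyOne) (t : ℝ) : ℝ :=
  1 - (1 - B.z₁) * (S.F t + S.G t) - B.z₁ * (1 - Real.exp (-B.γ₁ * t))

/-- Probability that player 2 has not conceded by time `t`. -/
noncomputable def surv₂ (S : StrategyTwo) (t : ℝ) : ℝ := 1 - (1 - B.z₂) * S.F t

lemma isSurvival_surv₁ (S : StrategyOne) : IsSurvival (B.surv₁ S) where
  anti s t hst := by
    have h1 := S.F.mono hst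
    have h2 := S.G.mono hst
    have h3 : Real.exp (-B.γ₁ * t) ≤ Real.exp (-B.γ₁ * s) := by
      rw [Real.exp_le_exp]; nlinarith [B.γ₁_nonneg]
    have h4 := mul_le_mul_of_nonneg_left (add_le_add h1 h2) (by linarith [B.z₁_mem.2] : 0 ≤ 1 - B.z₁)
    have h5 := mul_le_mul_of_nonneg_left h3 B.z₁_mem.1.le
    simp only [surv₁]; linarith
  pos t := by
    have h1 := mul_le_mul_of_nonneg_left (S.add_le_one t) (by linarith [B.z₁_mem.2] : 0 ≤ 1 - B.z₁)
    have h2 := mul_pos B.z₁_mem.1 (Real.exp_pos (-B.γ₁ * t))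
    simp only [surv₁]; linarith
  le_one t ht := by
    have h1 := mul_nonneg (by linarith [B.z₁_mem.2] : 0 ≤ 1 - B.z₁)
      (add_nonneg (S.isSubCDF_F.nonneg t) (S.isSubCDF_G.nonneg t))
    have h2 : Real.exp (-B.γ₁ * t) ≤ 1 := by
      rw [Real.exp_le_one_iff]; nlinarith [B.γ₁_nonneg]
    have h3 := mul_nonneg B.z₁_mem.1.le (sub_nonneg.2 h2)
    simp only [surv₁]; linarith

lemma isSurvival_surv₂ (S : StrategyTwo) : IsSurvival (B.surv₂ S) where
  anti s t hst := by
    have h4 := mul_le_mul_of_nonneg_left (S.F.mono hst) (by linarith [B.z₂_mem.2] : 0 ≤ 1 - B.z₂)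
    simp only [surv₂]; linarith
  pos t := by
    have h1 := mul_le_mul_of_nonneg_left (S.F_le_one t) (by linarith [B.z₂_mem.2] : 0 ≤ 1 - B.z₂)
    have h2 := B.z₂_mem.1
    simp only [surv₂]; linarith
  le_one t _ := by
    have h1 := mul_nonneg (by linarith [B.z₂_mem.2] : 0 ≤ 1 - B.z₂) (S.isSubCDF.nonneg t)
    simp only [surv₂]; linarith

/-- Player 1's gain from waiting. -/
noncomputable def wait₁ (S : StrategyTwo) : ℝ → ℝ := waitGain S.F (B.surv₂ S) B.z₂ B.r₁ B.lam₂

/-- Player 2's gain from waiting, when yielding to all challenges. -/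
noncomputable def wait₂ (S : StrategyOne) : ℝ → ℝ := waitGain S.F (B.surv₁ S) B.z₁ B.r₂ B.lam₁

lemma isWaitGain₁ (S : StrategyTwo) : IsWaitGain S.F (B.wait₁ S) :=
  isWaitGain_waitGain S.isSubCDF (B.isSurvival_surv₂ S) B.z₂_mem.2 B.r₁_pos.le B.lam₂_pos

lemma isWaitGain₂ (S : StrategyOne) : IsWaitGain S.F (B.wait₂ S) :=
  isWaitGain_waitGain S.isSubCDF_F (B.isSurvival_surv₁ S) B.z₁_mem.2 B.r₂_pos.le B.lam₁_pos

/-- The cost of delay is the interest `r₁ * (1 - a₂) = D * lam₂` forgone on the concession payoff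
while player 2 has not conceded; a concession of player 2 adds `D`, and a tie adds `D / 2`. -/
lemma U₁_eq (S : StrategyTwo) {t : ℝ} (ht : 0 ≤ t) :
    B.U₁ S t = 1 - B.a₂ + B.D * B.wait₁ S t := by
  have h1 := S.isSubCDF.setIntegral_exp_Ico B.r₁ ht
  have h2 := mul_integral_exp B.r₁ t
  have h3 : ∫ s in 0..t, Real.exp (-B.r₁ * s) * B.surv₂ S s
      = (∫ s in 0..t, Real.exp (-B.r₁ * s))
        - (1 - B.z₂) * ∫ s in 0..t, Real.exp (-B.r₁ * s) * S.F s := by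
    rw [← intervalIntegral.integral_const_mul, ← intervalIntegral.integral_sub
      (Continuous.intervalIntegrable (by fun_prop) _ _)
      ((IsSubCDF.intervalIntegrable _ _ _ _).const_mul _)]
    simp only [surv₂]
    congr 1; ext s; ring
  rw [U₁, wait₁, waitGain, discHalf, integral_const_mul, h3]
  have h4 := B.D_mul_lam₂
  have hD : B.D = B.a₁ + B.a₂ - 1 := rfl
  generalize (∫ s in 0..t, Real.exp (-B.r₁ * s)) = X at *
  generalize (∫ s in 0..t, Real.exp (-B.r₁ * s) * S.F s) = Y at *
  generalize (∫ s in Ico 0 t, Real.exp (-B.r₁ * s) ∂S.F.measure) = I at *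
  generalize Real.exp (-B.r₁ * t) = e at *
  linear_combination (X - (1 - B.z₂) * Y) * h4 + (1 - B.a₂) * h2 + (1 - B.a₂) * (1 - B.z₂) * h1
    - ((1 - B.z₂) * (I + (S.F t - leftLim S.F t) * e / 2)) * hD

/-- Net gain, per unit of disagreement, from challenging at time `t` rather than conceding just
after `t`. -/
noncomputable def chalGain (S : StrategyTwo) (t : ℝ) : ℝ :=
  (1 - B.z₂) * (1 - S.F t) * ((1 - S.q t) * B.w₁ + S.q t) - B.c₁ * B.surv₂ S t

/-- A concession of player 2 at `t` precedes the challenge, so the challenger receives the whole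
atom at `t`, of which `wait₁` counts half. -/
lemma V₁_eq (S : StrategyTwo) {t : ℝ} (ht : 0 ≤ t) :
    B.V₁ S t = 1 - B.a₂ + B.D * (B.wait₁ S t
      + (1 - B.z₂) * ((S.F t - leftLim S.F t) * Real.exp (-B.r₁ * t)) / 2)
      + Real.exp (-B.r₁ * t) * B.D * B.chalGain S t := by
  have h := B.U₁_eq S ht
  have h2 := S.isSubCDF.setIntegral_exp_Icc B.r₁ ht
  rw [U₁, integral_const_mul] at h
  rw [V₁, integral_const_mul, h2, chalGain, surv₂]
  have hD : B.D = B.a₁ + B.a₂ - 1 := rfl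
  linear_combination h - (1 - B.z₂) * ((S.F t - leftLim S.F t) * Real.exp (-B.r₁ * t)) / 2 * hD

/-- Discounted `ψ`-weighted challenges of an unjustified player 1 before time `t`. -/
noncomputable def seeG (S : StrategyOne) (ψ : ℝ → ℝ) (t : ℝ) : ℝ :=
  ∫ s in Ico 0 t, ψ s * Real.exp (-B.r₂ * s) ∂S.G.measure

/-- Discounted `ψ`-weighted challenges of a justified player 1 before time `t`. -/
noncomputable def seeL (ψ : ℝ → ℝ) (t : ℝ) : ℝ :=
  ∫ s in Ico 0 t, ψ s * (Real.exp (-B.r₂ * s) * (B.γ₁ * Real.exp (-B.γ₁ * s)))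

lemma integrableOn_bdd_mul {μ : Measure ℝ} [IsLocallyFiniteMeasure μ] {ψ f : ℝ → ℝ} {C : ℝ}
    (hψ : Measurable ψ) (hb : ∀ s, |ψ s| ≤ C) (hf : Continuous f) (t : ℝ) :
    IntegrableOn (fun s => ψ s * f s) (Ico 0 t) μ := by
  refine IntegrableOn.mono_set (t := Icc 0 t) ?_ Ico_subset_Icc_self
  exact Integrable.bdd_mul (c := C) hf.integrableOn_Icc hψ.aestronglyMeasurable
    (Eventually.of_forall fun s => by simpa using hb s)

/-- Yielding is worth `1 - a₁`, exactly as conceding at that moment. Relative to always yielding,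
only the challenges that are seen, weighted by `1 - q`, change the payoff. -/
lemma U₂_eq (S : StrategyOne) {q : ℝ → ℝ} (hq : Measurable q) (hq1 : ∀ t, 0 ≤ q t ∧ q t ≤ 1)
    {t : ℝ} (ht : 0 ≤ t) :
    B.U₂ S q t = 1 - B.a₁ + B.D * B.wait₂ S t
      + B.D * ((1 - B.z₁) * (1 - B.w₁ - B.k₂) * B.seeG S (fun s => 1 - q s) t
        - B.z₁ * B.k₂ * B.seeL (fun s => 1 - q s) t) := by
  have hψm : Measurable (fun s => 1 - q s) := by fun_prop
  have hψb : ∀ s, |1 - q s| ≤ 1 := fun s => abs_le.2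
    ⟨by linarith [(hq1 s).2], by linarith [(hq1 s).1]⟩
  have hL : ∫ s in Ico 0 t, (1 - B.a₁ - (1 - q s) * B.k₂ * B.D)
        * Real.exp (-B.r₂ * s) * (B.γ₁ * Real.exp (-B.γ₁ * s))
      = (1 - B.a₁) * (∫ s in 0..t, Real.exp (-B.r₂ * s) * (B.γ₁ * Real.exp (-B.γ₁ * s)))
        - B.k₂ * B.D * B.seeL (fun s => 1 - q s) t := by
    rw [intervalIntegral.integral_of_le ht, ← integral_Icc_eq_integral_Ioc,
      integral_Icc_eq_integral_Ico, seeL, ← integral_const_mul, ← integral_const_mul,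
      ← integral_sub]
    · congr 1; ext s; ring
    · exact (Continuous.integrableOn_Icc (by fun_prop)).mono_set Ico_subset_Icc_self
    · exact Integrable.const_mul (integrableOn_bdd_mul hψm hψb (by fun_prop) t) _
  have hG : ∫ s in Ico 0 t, (1 - B.a₁ + (1 - q s) * (1 - B.w₁ - B.k₂) * B.D)
        * Real.exp (-B.r₂ * s) ∂S.G.measure
      = (1 - B.a₁) * (∫ s in Ico 0 t, Real.exp (-B.r₂ * s) ∂S.G.measure)
        + (1 - B.w₁ - B.k₂) * B.D * B.seeG S (fun s => 1 - q s) t := by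
    rw [seeG, ← integral_const_mul, ← integral_const_mul, ← integral_add]
    · congr 1; ext s; ring
    · exact Integrable.const_mul
        (IsSubCDF.integrableOn_exp S.G B.r₂ 0 t _ Ico_subset_Icc_self) _
    · exact Integrable.const_mul (integrableOn_bdd_mul hψm hψb (by fun_prop) t) _
  have h1 := S.isSubCDF_F.setIntegral_exp_Ico B.r₂ ht
  have h1G := S.isSubCDF_G.setIntegral_exp_Ico B.r₂ ht
  have h2 := mul_integral_exp B.r₂ t
  have h2' := integral_exp_mul_exp B.r₂ B.γ₁ t
  have h3 : ∫ s in 0..t, Real.exp (-B.r₂ * s) * B.surv₁ S s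
      = (1 - B.z₁) * (∫ s in 0..t, Real.exp (-B.r₂ * s))
        - (1 - B.z₁) * (∫ s in 0..t, Real.exp (-B.r₂ * s) * S.F s)
        - (1 - B.z₁) * (∫ s in 0..t, Real.exp (-B.r₂ * s) * S.G s)
        + B.z₁ * ∫ s in 0..t, Real.exp (-B.r₂ * s) * Real.exp (-B.γ₁ * s) := by
    have i0 : IntervalIntegrable (fun s => (1 - B.z₁) * Real.exp (-B.r₂ * s)) volume 0 t :=
      Continuous.intervalIntegrable (by fun_prop) _ _
    have i1 := (IsSubCDF.intervalIntegrable S.F B.r₂ 0 t).const_mul (1 - B.z₁)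
    have i2 := (IsSubCDF.intervalIntegrable S.G B.r₂ 0 t).const_mul (1 - B.z₁)
    have i3 : IntervalIntegrable (fun s => B.z₁ * (Real.exp (-B.r₂ * s) * Real.exp (-B.γ₁ * s)))
      volume 0 t := Continuous.intervalIntegrable (by fun_prop) _ _
    simp only [← intervalIntegral.integral_const_mul]
    rw [← intervalIntegral.integral_sub i0 i1, ← intervalIntegral.integral_sub (i0.sub i1) i2,
      ← intervalIntegral.integral_add ((i0.sub i1).sub i2) i3]
    simp only [surv₁]
    congr 1; ext s; ring
  rw [U₂, hL, hG, wait₂, waitGain, discHalf, integral_const_mul, h3]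
  have h4 := B.D_mul_lam₁
  have hD : B.D = B.a₁ + B.a₂ - 1 := rfl
  generalize B.seeG S (fun s => 1 - q s) t = sG at *
  generalize B.seeL (fun s => 1 - q s) t = sL at *
  generalize (∫ s in 0..t, Real.exp (-B.r₂ * s) * (B.γ₁ * Real.exp (-B.γ₁ * s))) = L at *
  generalize (∫ s in 0..t, Real.exp (-B.r₂ * s) * Real.exp (-B.γ₁ * s)) = M at *
  generalize (∫ s in 0..t, Real.exp (-B.r₂ * s)) = X at *
  generalize (∫ s in 0..t, Real.exp (-B.r₂ * s) * S.F s) = Y at *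
  generalize (∫ s in 0..t, Real.exp (-B.r₂ * s) * S.G s) = Y' at *
  generalize (∫ s in Ico 0 t, Real.exp (-B.r₂ * s) ∂S.F.measure) = I at *
  generalize (∫ s in Ico 0 t, Real.exp (-B.r₂ * s) ∂S.G.measure) = I' at *
  generalize Real.exp (-B.r₂ * t) = e at *
  generalize Real.exp (-B.γ₁ * t) = e' at *
  linear_combination ((1 - B.z₁) * (X - Y - Y') + B.z₁ * M) * h4
    + (1 - B.a₁) * (1 - B.z₁) * h2 + B.z₁ * (1 - B.a₁) * h2' + (1 - B.a₁) * (1 - B.z₁) * h1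
    + (1 - B.a₁) * (1 - B.z₁) * h1G
    - ((1 - B.z₁) * (I + (S.F t - leftLim S.F t) * e / 2)) * hD

end BargainingGame

/-! ### Pure deviations and optimality on the support -/

/-- The point mass at `t`, as a Stieltjes function. -/
noncomputable def pointCDF (t : ℝ) : StieltjesFunction ℝ := ProbabilityTheory.cdf (Measure.dirac t)

lemma pointCDF_measure (t : ℝ) : (pointCDF t).measure = Measure.dirac t :=
  ProbabilityTheory.measure_cdf _

lemma isSubCDF_pointCDF {t : ℝ} (ht : 0 ≤ t) : IsSubCDF (pointCDF t) where
  neg x hx := by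
    rw [pointCDF, ProbabilityTheory.cdf_eq_real, measureReal_def, Measure.dirac_apply' _ measurableSet_Iic]
    simp [hx.trans_le ht]
  le_one x := ProbabilityTheory.cdf_le_one _ x

/-- The strategy of player 1 that concedes at time `t`. -/
noncomputable def StrategyOne.concedeAt (t : ℝ) (ht : 0 ≤ t) : StrategyOne where
  F := pointCDF t
  G := 0
  F_neg := (isSubCDF_pointCDF ht).neg
  G_neg _ _ := rfl
  add_le_one x := by simpa using (isSubCDF_pointCDF ht).le_one x

/-- The strategy of player 1 that challenges at time `t`. -/
noncomputable def StrategyOne.challengeAt (t : ℝ) (ht : 0 ≤ t) : StrategyOne where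
  F := 0
  G := pointCDF t
  F_neg _ _ := rfl
  G_neg := (isSubCDF_pointCDF ht).neg
  add_le_one x := by simpa using (isSubCDF_pointCDF ht).le_one x

/-- The strategy of player 2 that concedes at time `t` and yields according to `q`. -/
noncomputable def StrategyTwo.concedeAt (t : ℝ) (ht : 0 ≤ t) (q : ℝ → ℝ) (hq : Measurable q)
    (hq1 : ∀ t, 0 ≤ q t ∧ q t ≤ 1) : StrategyTwo where
  F := pointCDF t
  F_neg := (isSubCDF_pointCDF ht).neg
  F_le_one := (isSubCDF_pointCDF ht).le_one
  q := q
  q_measurable := hq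
  q_mem := hq1

/-- The sign of `u` handles a non-integrable `f`, whose integral is 0 by convention. -/
lemma integral_le_mul_mass {μ : Measure ℝ} [IsFiniteMeasure μ] {f : ℝ → ℝ} {u : ℝ} (hu : 0 ≤ u)
    (hf : ∀ᵐ t ∂μ, f t ≤ u) : ∫ t, f t ∂μ ≤ u * μ.real univ := by
  by_cases hi : Integrable f μ
  · calc ∫ t, f t ∂μ ≤ ∫ _, u ∂μ := integral_mono_ae hi (integrable_const _) hf
      _ = u * μ.real univ := by rw [integral_const, smul_eq_mul, mul_comm]
  · rw [integral_undef hi]; positivity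

/-- If `f` is not integrable its integral is 0, and `0 < u` then leaves no mass at all. -/
lemma ae_eq_of_mul_mass_le {μ : Measure ℝ} [IsFiniteMeasure μ] {f : ℝ → ℝ} {u : ℝ} (hu : 0 < u)
    (hf : ∀ᵐ t ∂μ, f t ≤ u) (h : u * μ.real univ ≤ ∫ t, f t ∂μ) : ∀ᵐ t ∂μ, f t = u := by
  by_cases hi : Integrable f μ
  · have h0 : ∫ t, (u - f t) ∂μ = 0 := by
      rw [integral_sub (integrable_const _) hi, integral_const, smul_eq_mul]
      linarith [integral_le_mul_mass hu.le hf]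
    have hnn : 0 ≤ᵐ[μ] fun t => u - f t := by filter_upwards [hf] with t ht; simpa using ht
    have hii : Integrable (fun t => u - f t) μ := (integrable_const _).sub hi
    rw [integral_eq_zero_iff_of_nonneg_ae hnn hii] at h0
    filter_upwards [h0] with t ht
    simp only [Pi.zero_apply] at ht
    linarith
  · rw [integral_undef hi] at h
    have hm : μ.real univ = 0 := le_antisymm (by
      by_contra hlt
      push Not at hlt
      linarith [mul_pos hu hlt]) measureReal_nonneg
    have : μ = 0 := by
      rw [measureReal_def, ENNReal.toReal_eq_zero_iff] at hm
      rcases hm with hm | hm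
      · exact Measure.measure_univ_eq_zero.1 hm
      · exact absurd hm (measure_ne_top _ _)
    simp [this]

namespace BargainingGame

variable (B : BargainingGame)

lemma payoff₁_eq (S₁ : StrategyOne) (S₂ : StrategyTwo) :
    B.payoff₁ S₁ S₂ = (∫ s, B.U₁ S₂ s ∂S₁.F.measure) + ∫ s, B.V₁ S₂ s ∂S₁.G.measure := by
  rw [payoff₁, S₁.isSubCDF_F.restrict_Ici, S₁.isSubCDF_G.restrict_Ici]

lemma payoff₂_eq (S₁ : StrategyOne) (S₂ : StrategyTwo) :
    B.payoff₂ S₁ S₂ = ∫ s, B.U₂ S₁ S₂.q s ∂S₂.F.measure := by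
  rw [payoff₂, S₂.isSubCDF.restrict_Ici]

lemma payoff₁_concedeAt (S₂ : StrategyTwo) {t : ℝ} (ht : 0 ≤ t) :
    B.payoff₁ (StrategyOne.concedeAt t ht) S₂ = B.U₁ S₂ t := by
  simp [payoff₁_eq, StrategyOne.concedeAt, pointCDF_measure, StieltjesFunction.measure_zero]

lemma payoff₁_challengeAt (S₂ : StrategyTwo) {t : ℝ} (ht : 0 ≤ t) :
    B.payoff₁ (StrategyOne.challengeAt t ht) S₂ = B.V₁ S₂ t := by
  simp [payoff₁_eq, StrategyOne.challengeAt, pointCDF_measure, StieltjesFunction.measure_zero]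

lemma payoff₂_concedeAt (S₁ : StrategyOne) {t : ℝ} (ht : 0 ≤ t) {q : ℝ → ℝ} (hq : Measurable q)
    (hq1 : ∀ t, 0 ≤ q t ∧ q t ≤ 1) :
    B.payoff₂ S₁ (StrategyTwo.concedeAt t ht q hq hq1) = B.U₂ S₁ q t := by
  simp [payoff₂_eq, StrategyTwo.concedeAt, pointCDF_measure]

lemma mass_add_le (S₁ : StrategyOne) : S₁.F.measure.real univ + S₁.G.measure.real univ ≤ 1 :=
  le_of_tendsto' (S₁.isSubCDF_F.tendsto_atTop.add S₁.isSubCDF_G.tendsto_atTop) S₁.add_le_one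

/-- Relative weight of challenges by an unjustified player 1 in player 2's gain from seeing. -/
noncomputable def alpha : ℝ := (1 - B.z₁) * (1 - B.w₁ - B.k₂)

lemma alpha_pos : 0 < B.alpha :=
  mul_pos (by linarith [B.z₁_mem.2]) (by linarith [B.k₂_mem.2])

/-- Least probability of yielding at which a challenge can be worthwhile. -/
noncomputable def theta : ℝ := (B.c₁ - B.w₁) / (1 - B.w₁)

lemma one_sub_w₁_pos : 0 < 1 - B.w₁ := by linarith [B.k₂_mem.1, B.k₂_mem.2]

lemma theta_pos : 0 < B.theta := div_pos (by linarith [B.c₁_mem.1]) B.one_sub_w₁_pos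

lemma theta_lt_one : B.theta < 1 := by
  rw [theta, div_lt_one B.one_sub_w₁_pos]; linarith [B.c₁_mem.2]

/-- Against a justified player 2 a challenge loses its cost. To break even, an unjustified player 2
must still be present and yield often enough that the expected win exceeds `c₁`; `theta` solves `(1
- q) * w₁ + q = c₁`. -/
lemma of_chalGain_nonneg (S : StrategyTwo) {t : ℝ} (h : 0 ≤ B.chalGain S t) :
    B.theta ≤ S.q t ∧ S.F t < 1 := by
  have hz := B.z₂_mem
  have hc := B.c₁_mem
  have hw := B.w₁_nonneg
  have hq := S.q_mem t
  have hF := S.F_le_one t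
  have hc0 : 0 < B.c₁ := by linarith
  rw [chalGain, surv₂] at h
  have h1 : 0 ≤ (1 - B.z₂) * (1 - S.F t) := mul_nonneg (by linarith) (by linarith)
  have h2 : B.c₁ * B.z₂ ≤ (1 - B.z₂) * (1 - S.F t) * ((1 - S.q t) * B.w₁ + S.q t - B.c₁) := by
    linarith
  have h3 : 0 < B.c₁ * B.z₂ := mul_pos hc0 hz.1
  have h4 := h3.trans_le h2
  have h5 : 0 < (1 - S.q t) * B.w₁ + S.q t - B.c₁ := pos_of_mul_pos_right h4 h1
  refine ⟨?_, ?_⟩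
  · rw [theta, div_le_iff₀ B.one_sub_w₁_pos]; linarith
  · refine lt_of_le_of_ne hF fun h6 => ?_
    rw [h6] at h4; simp at h4

/-- Waiting past `t` by an arbitrarily short time collects the whole atom at `t` at an arbitrarily
small cost; the length `ε / lam₂` makes that cost at most `ε`. -/
lemma wait₁_add_jump_le (S : StrategyTwo) {m : ℝ} (h : ∀ t, 0 ≤ t → B.wait₁ S t ≤ m) {t : ℝ}
    (ht : 0 ≤ t) :
    B.wait₁ S t + (1 - B.z₂) * ((S.F t - leftLim S.F t) * Real.exp (-B.r₁ * t)) / 2 ≤ m := by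
  refine le_of_forall_pos_le_add fun ε hε => ?_
  have hl := B.lam₂_pos
  have hv : t < t + ε / B.lam₂ := by linarith [div_pos hε hl]
  have h1 := h _ (ht.trans hv.le)
  have h2 := IsSubCDF.Icc_le_discHalf S.F B.r₁ hv
  rw [S.isSubCDF.setIntegral_exp_Icc B.r₁ ht] at h2
  have hP := B.isSurvival_surv₂ S
  have h3 := mul_le_mul_of_nonneg_left (hP.integral_le B.r₁_pos.le ht hv.le) hl.le
  have h4 := hP.integral_split B.r₁ 0 t (t + ε / B.lam₂)
  have h5 : B.lam₂ * (t + ε / B.lam₂ - t) = ε := by field_simp; ring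
  have h6 := mul_le_mul_of_nonneg_left h2 (by linarith [B.z₂_mem.2] : 0 ≤ 1 - B.z₂)
  rw [wait₁, waitGain] at h1 ⊢
  rw [← h4] at h1
  have h7 : discHalf S.F B.r₁ t = _ := discHalf.eq_def _ _ _
  rw [h7]
  linarith

/-! ### Necessary conditions: optimal times and responses to challenges -/

variable {B} {S₁ : StrategyOne} {S₂ : StrategyTwo}

namespace IsEquilibrium

lemma U₁_le (hE : B.IsEquilibrium S₁ S₂) {t : ℝ} (ht : 0 ≤ t) : B.U₁ S₂ t ≤ B.payoff₁ S₁ S₂ := by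
  rw [← B.payoff₁_concedeAt S₂ ht]; exact hE.1 _

lemma V₁_le (hE : B.IsEquilibrium S₁ S₂) {t : ℝ} (ht : 0 ≤ t) : B.V₁ S₂ t ≤ B.payoff₁ S₁ S₂ := by
  rw [← B.payoff₁_challengeAt S₂ ht]; exact hE.1 _

lemma U₂_le (hE : B.IsEquilibrium S₁ S₂) {t : ℝ} (ht : 0 ≤ t) {q : ℝ → ℝ} (hq : Measurable q)
    (hq1 : ∀ t, 0 ≤ q t ∧ q t ≤ 1) : B.U₂ S₁ q t ≤ B.payoff₂ S₁ S₂ := by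
  rw [← B.payoff₂_concedeAt S₁ ht hq hq1]; exact hE.2 _

lemma payoff₁_pos (hE : B.IsEquilibrium S₁ S₂) : 0 < B.payoff₁ S₁ S₂ := by
  have h := hE.U₁_le le_rfl
  rw [B.U₁_eq S₂ le_rfl, wait₁, S₂.isSubCDF.waitGain_zero] at h
  have h1 : 0 ≤ B.D * ((1 - B.z₂) * S₂.F 0 / 2) := mul_nonneg B.D_pos.le
    (div_nonneg (mul_nonneg (by linarith [B.z₂_mem.2]) (S₂.isSubCDF.nonneg 0)) zero_le_two)
  linarith [B.a₂_mem.2]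

/-- Each unit of mass earns at most the equilibrium payoff. As that payoff is positive, no mass may
be withheld and almost every action used must attain it. -/
lemma optimal₁ (hE : B.IsEquilibrium S₁ S₂) :
    S₁.F.measure.real univ + S₁.G.measure.real univ = 1 ∧
    (∀ᵐ t ∂S₁.F.measure, B.U₁ S₂ t = B.payoff₁ S₁ S₂) ∧
    ∀ᵐ t ∂S₁.G.measure, B.V₁ S₂ t = B.payoff₁ S₁ S₂ := by
  have := S₁.isSubCDF_F.isFiniteMeasure
  have := S₁.isSubCDF_G.isFiniteMeasure
  have hp := hE.payoff₁_pos
  have hU : ∀ᵐ t ∂S₁.F.measure, B.U₁ S₂ t ≤ B.payoff₁ S₁ S₂ := by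
    filter_upwards [S₁.isSubCDF_F.ae_nonneg] with t ht using hE.U₁_le ht
  have hV : ∀ᵐ t ∂S₁.G.measure, B.V₁ S₂ t ≤ B.payoff₁ S₁ S₂ := by
    filter_upwards [S₁.isSubCDF_G.ae_nonneg] with t ht using hE.V₁_le ht
  have h1 := integral_le_mul_mass hp.le hU
  have h2 := integral_le_mul_mass hp.le hV
  have h3 := mass_add_le S₁
  have h4 := B.payoff₁_eq S₁ S₂
  have h5 : S₁.F.measure.real univ + S₁.G.measure.real univ = 1 := by
    refine le_antisymm h3 ?_
    by_contra hlt
    push Not at hlt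
    have := mul_lt_mul_of_pos_left hlt hp
    linarith
  have h6 : B.payoff₁ S₁ S₂ * S₁.F.measure.real univ + B.payoff₁ S₁ S₂ * S₁.G.measure.real univ
      = B.payoff₁ S₁ S₂ := by rw [← mul_add, h5, mul_one]
  exact ⟨h5, ae_eq_of_mul_mass_le hp hU (by linarith), ae_eq_of_mul_mass_le hp hV (by linarith)⟩

lemma wait₂_le (hE : B.IsEquilibrium S₁ S₂) {t : ℝ} (ht : 0 ≤ t) :
    1 - B.a₁ + B.D * B.wait₂ S₁ t ≤ B.payoff₂ S₁ S₂ := by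
  have h := hE.U₂_le ht (q := fun _ => 1) measurable_const (by simp)
  rw [B.U₂_eq S₁ measurable_const (by simp) ht] at h
  simpa [seeG, seeL] using h

lemma payoff₂_pos (hE : B.IsEquilibrium S₁ S₂) : 0 < B.payoff₂ S₁ S₂ := by
  have h := hE.wait₂_le le_rfl
  rw [wait₂, S₁.isSubCDF_F.waitGain_zero] at h
  have h2 := mul_nonneg (by linarith [B.z₁_mem.2] : 0 ≤ 1 - B.z₁) (S₁.isSubCDF_F.nonneg 0)
  have h1 : 0 ≤ B.D * ((1 - B.z₁) * S₁.F 0 / 2) := mul_nonneg B.D_pos.le (by linarith)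
  linarith [B.a₁_mem.2]

lemma optimal₂ (hE : B.IsEquilibrium S₁ S₂) :
    S₂.F.measure.real univ = 1 ∧
    ∀ᵐ t ∂S₂.F.measure, B.U₂ S₁ S₂.q t = B.payoff₂ S₁ S₂ := by
  have := S₂.isSubCDF.isFiniteMeasure
  have hp := hE.payoff₂_pos
  have hU : ∀ᵐ t ∂S₂.F.measure, B.U₂ S₁ S₂.q t ≤ B.payoff₂ S₁ S₂ := by
    filter_upwards [S₂.isSubCDF.ae_nonneg] with t ht using hE.U₂_le ht S₂.q_measurable S₂.q_mem
  have h1 := integral_le_mul_mass hp.le hU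
  have h3 := S₂.isSubCDF.real_univ_le
  have h4 := B.payoff₂_eq S₁ S₂
  have h5 : S₂.F.measure.real univ = 1 := by
    refine le_antisymm h3 ?_
    by_contra hlt
    push Not at hlt
    have := mul_lt_mul_of_pos_left hlt hp
    linarith
  exact ⟨h5, ae_eq_of_mul_mass_le hp hU (by rw [h5, mul_one]; exact h4.le)⟩

lemma optimal_wait₁ (hE : B.IsEquilibrium S₁ S₂) :
    IsOptimalFor S₁.F (B.wait₁ S₂) ((B.payoff₁ S₁ S₂ - (1 - B.a₂)) / B.D) where
  le t ht := by
    have h := hE.U₁_le ht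
    rw [B.U₁_eq S₂ ht] at h
    rw [le_div_iff₀ B.D_pos]; linarith
  ae := by
    filter_upwards [S₁.isSubCDF_F.ae_nonneg, hE.optimal₁.2.1] with t ht h
    rw [B.U₁_eq S₂ ht] at h
    rw [eq_div_iff B.D_pos.ne']; linarith

/-- Conceding shortly after `t` collects the same concessions of player 2 as challenging at `t`, so
an optimal challenge needs a nonnegative net gain. -/
lemma challenge_ae (hE : B.IsEquilibrium S₁ S₂) :
    ∀ᵐ t ∂S₁.G.measure, 0 ≤ B.chalGain S₂ t := by
  filter_upwards [S₁.isSubCDF_G.ae_nonneg, hE.optimal₁.2.2] with t ht h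
  rw [B.V₁_eq S₂ ht] at h
  have h1 := B.wait₁_add_jump_le S₂ (fun t ht => hE.optimal_wait₁.le t ht) ht
  rw [le_div_iff₀ B.D_pos] at h1
  have h2 : 0 ≤ (Real.exp (-B.r₁ * t) * B.D) * B.chalGain S₂ t := by linarith
  exact nonneg_of_mul_nonneg_right h2 (mul_pos (Real.exp_pos _) B.D_pos)

/-- Deviations from the response to challenges are unprofitable for player 2. -/
lemma seeL_le_seeG (hE : B.IsEquilibrium S₁ S₂) {τ : ℝ} (hτ : 0 ≤ τ)
    (h : B.U₂ S₁ S₂.q τ = B.payoff₂ S₁ S₂) {ψ : ℝ → ℝ} (hψ : Measurable ψ)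
    (hψ1 : ∀ t, 0 ≤ S₂.q t + ψ t ∧ S₂.q t + ψ t ≤ 1) :
    B.z₁ * B.k₂ * B.seeL ψ τ ≤ B.alpha * B.seeG S₁ ψ τ := by
  have hqψ : Measurable (fun s => S₂.q s + ψ s) := S₂.q_measurable.add hψ
  have hdev := hE.U₂_le hτ hqψ hψ1
  rw [← h, B.U₂_eq S₁ hqψ hψ1 hτ, B.U₂_eq S₁ S₂.q_measurable S₂.q_mem hτ] at hdev
  have hψb : ∀ s, |ψ s| ≤ 1 := fun s => abs_le.2
    ⟨by linarith [(S₂.q_mem s).2, (hψ1 s).1], by linarith [(S₂.q_mem s).1, (hψ1 s).2]⟩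
  have hqm : Measurable (fun s => 1 - S₂.q s) := S₂.q_measurable.const_sub 1
  have hqb : ∀ s, |1 - S₂.q s| ≤ 1 := fun s => abs_le.2
    ⟨by linarith [(S₂.q_mem s).2], by linarith [(S₂.q_mem s).1]⟩
  have hG : B.seeG S₁ (fun s => 1 - (S₂.q s + ψ s)) τ
      = B.seeG S₁ (fun s => 1 - S₂.q s) τ - B.seeG S₁ ψ τ := by
    rw [seeG, seeG, seeG, ← integral_sub (integrableOn_bdd_mul hqm hqb (by fun_prop) τ)
      (integrableOn_bdd_mul hψ hψb (by fun_prop) τ)]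
    congr 1; ext s; ring
  have hL : B.seeL (fun s => 1 - (S₂.q s + ψ s)) τ
      = B.seeL (fun s => 1 - S₂.q s) τ - B.seeL ψ τ := by
    rw [seeL, seeL, seeL, ← integral_sub (integrableOn_bdd_mul hqm hqb (by fun_prop) τ)
      (integrableOn_bdd_mul hψ hψb (by fun_prop) τ)]
    congr 1; ext s; ring
  rw [hG, hL] at hdev
  have h2 : B.D * (B.z₁ * B.k₂ * B.seeL ψ τ) ≤ B.D * (B.alpha * B.seeG S₁ ψ τ) := by
    rw [alpha]; linarith
  exact le_of_mul_le_mul_left h2 B.D_pos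

/-- Responses to challenges matter only before player 2's own concession. Deviations of `q` before
`s` are therefore tested at an optimal concession time beyond `s`. -/
lemma exists_optimal_gt (hE : B.IsEquilibrium S₁ S₂) {s : ℝ} (hs0 : 0 ≤ s) (hs : S₂.F s < 1) :
    ∃ τ > s, 0 ≤ τ ∧ B.U₂ S₁ S₂.q τ = B.payoff₂ S₁ S₂ := by
  have := S₂.isSubCDF.isFiniteMeasure
  by_contra hne
  push Not at hne
  have h0 : S₂.F.measure (Ioi s) = 0 := by
    refine measure_mono_null (fun τ hτ => ?_) (ae_iff.1 hE.optimal₂.2)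
    exact hne τ hτ (hs0.trans (le_of_lt hτ))
  have h1 : S₂.F.measure.real (Iic s) = S₂.F.measure.real univ := by
    rw [measureReal_def, measureReal_def, ← measure_add_measure_compl (measurableSet_Iic (a := s)),
      compl_Iic, h0, add_zero]
  rw [S₂.isSubCDF.real_Iic, hE.optimal₂.1] at h1
  exact hs.ne h1

/-- At an atom of challenges player 2 yields with probability at least `theta`. Yielding less at
that single instant would gain against the atom at no cost, since justified challenges have a
density. -/
lemma G_continuousAt (hE : B.IsEquilibrium S₁ S₂) (t : ℝ) : ContinuousAt S₁.G t := by
  rw [IsSubCDF.continuousAt_iff]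
  rcases lt_or_ge t 0 with ht | ht
  · rw [S₁.isSubCDF_G.leftLim_of_nonpos ht.le, S₁.G_neg t ht]
  by_contra hne
  have hlt : leftLim S₁.G t < S₁.G t := lt_of_le_of_ne (IsSubCDF.leftLim_le_self _ _) hne
  have hpos : S₁.G.measure {t} ≠ 0 := by
    rw [S₁.G.measure_singleton, Ne, ENNReal.ofReal_eq_zero]; linarith
  have hch : 0 ≤ B.chalGain S₂ t := by
    by_contra hneg
    exact hpos (measure_mono_null (by simpa using hneg) (ae_iff.1 hE.challenge_ae))
  obtain ⟨hq, hF⟩ := B.of_chalGain_nonneg S₂ hch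
  obtain ⟨τ, hτ, hτ0, hopt⟩ := hE.exists_optimal_gt ht hF
  have hθ := B.theta_pos
  have hdev := hE.seeL_le_seeG hτ0 hopt (ψ := ({t} : Set ℝ).indicator fun _ => -B.theta)
    (measurable_const.indicator (measurableSet_singleton t)) fun s => by
      have := S₂.q_mem s
      by_cases hst : s = t
      · subst hst; simp; constructor <;> linarith
      · simpa [hst] using this
  have hL : B.seeL (({t} : Set ℝ).indicator fun _ => -B.theta) τ = 0 := by
    rw [seeL, integral_eq_zero_of_ae]
    have h0 : ∀ᵐ u ∂(volume.restrict (Ico 0 τ)), u ≠ t :=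
      ae_restrict_of_ae (by simp [ae_iff])
    filter_upwards [h0] with u hu
    simp [hu]
  have hG : B.seeG S₁ (({t} : Set ℝ).indicator fun _ => -B.theta) τ
      = -B.theta * Real.exp (-B.r₂ * t) * S₁.G.measure.real {t} := by
    have h1 : ∀ s, ({t} : Set ℝ).indicator (fun _ => -B.theta) s * Real.exp (-B.r₂ * s)
        = ({t} : Set ℝ).indicator (fun s => -B.theta * Real.exp (-B.r₂ * s)) s := fun s => by
      by_cases hst : s = t <;> simp [hst]
    rw [seeG]
    simp_rw [h1]
    rw [setIntegral_indicator (measurableSet_singleton t),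
      inter_eq_right.2 (singleton_subset_iff.2 (mem_Ico.2 ⟨ht, hτ⟩)), integral_singleton, smul_eq_mul, mul_comm]
  rw [hL, hG, mul_zero] at hdev
  have hreal : 0 < S₁.G.measure.real {t} := by
    rw [measureReal_def, S₁.G.measure_singleton, ENNReal.toReal_ofReal (by linarith)]
    linarith
  have := mul_pos B.alpha_pos (mul_pos (mul_pos hθ (Real.exp_pos (-B.r₂ * t))) hreal)
  linarith

/-- Yielding less by `theta * ψ` wherever `q` permits it catches every unjustified challenge with
that weight, because those occur only where `theta ≤ q`, and catches at most the same weight of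
justified ones. Such a deviation cannot be profitable. -/
lemma seeG_le_seeL (hE : B.IsEquilibrium S₁ S₂) {τ : ℝ} (hτ : 0 ≤ τ)
    (h : B.U₂ S₁ S₂.q τ = B.payoff₂ S₁ S₂) {ψ : ℝ → ℝ} (hψ : Measurable ψ)
    (hψ1 : ∀ t, 0 ≤ ψ t ∧ ψ t ≤ 1) :
    B.alpha * B.seeG S₁ ψ τ ≤ B.z₁ * B.k₂ * B.seeL ψ τ := by
  have hθ := B.theta_pos
  have hA : MeasurableSet {s | B.theta ≤ S₂.q s} := measurableSet_le measurable_const S₂.q_measurable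
  set A : Set ℝ := {s | B.theta ≤ S₂.q s} with hAdef
  have hmem : ∀ s, s ∈ A ↔ B.theta ≤ S₂.q s := fun s => by simp [hAdef]
  -- The cut is restricted to `A` to keep the yielding probability nonnegative. It equals `-theta *
  -- ψ` almost everywhere for `G`, while off `A` it is larger, which is the favourable direction for
  -- `seeL`.
  set φ : ℝ → ℝ := A.indicator fun s => -B.theta * ψ s with hφ
  have hψb : ∀ s, |ψ s| ≤ 1 := fun s => abs_le.2 ⟨by linarith [(hψ1 s).1], (hψ1 s).2⟩
  have hdev := hE.seeL_le_seeG hτ h (ψ := φ) ((hψ.const_mul _).indicator hA) fun s => by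
    have h1 := S₂.q_mem s
    have h2 := hψ1 s
    by_cases hs : B.theta ≤ S₂.q s
    · have h3 : φ s = -B.theta * ψ s := indicator_of_mem ((hmem s).2 hs) _
      rw [h3]
      constructor <;> nlinarith
    · have h3 : φ s = 0 := indicator_of_notMem (fun h => hs ((hmem s).1 h)) _
      simpa [h3] using h1
  have hG : B.seeG S₁ φ τ = -B.theta * B.seeG S₁ ψ τ := by
    rw [seeG, seeG, ← integral_const_mul]
    refine integral_congr_ae (ae_restrict_of_ae ?_)
    filter_upwards [hE.challenge_ae] with s hs
    have h3 : φ s = -B.theta * ψ s := indicator_of_mem ((hmem s).2 (B.of_chalGain_nonneg S₂ hs).1) _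
    simp only [h3, mul_assoc]
  have hφm : Measurable φ := (hψ.const_mul _).indicator hA
  have hφ1 : ∀ s, -B.theta * ψ s ≤ φ s ∧ φ s ≤ 0 := fun s => by
    have h2 := hψ1 s
    by_cases hs : B.theta ≤ S₂.q s
    · have h3 : φ s = -B.theta * ψ s := indicator_of_mem ((hmem s).2 hs) _
      rw [h3]; constructor <;> nlinarith
    · have h3 : φ s = 0 := indicator_of_notMem (fun h => hs ((hmem s).1 h)) _
      rw [h3]; constructor <;> nlinarith
  have hL : -B.theta * B.seeL ψ τ ≤ B.seeL φ τ := by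
    rw [seeL, seeL, ← integral_const_mul]
    refine integral_mono ((integrableOn_bdd_mul hψ hψb (by fun_prop) τ).const_mul _)
      (integrableOn_bdd_mul (C := 1) hφm (fun s => abs_le.2 ⟨?_, ?_⟩) (by fun_prop) τ) fun s => ?_
    · nlinarith [hφ1 s, hψ1 s, B.theta_lt_one]
    · linarith [hφ1 s]
    · have h4 : 0 ≤ Real.exp (-B.r₂ * s) * (B.γ₁ * Real.exp (-B.γ₁ * s)) :=
        mul_nonneg (Real.exp_pos _).le (mul_nonneg B.γ₁_nonneg (Real.exp_pos _).le)
      simp only [← mul_assoc (-B.theta)]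
      exact mul_le_mul_of_nonneg_right (hφ1 s).1 h4
  have hzk : 0 ≤ B.z₁ * B.k₂ := mul_nonneg B.z₁_mem.1.le B.k₂_mem.1.le
  have h5 := mul_le_mul_of_nonneg_left hL hzk
  rw [hG] at hdev
  have h6 : B.theta * (B.alpha * B.seeG S₁ ψ τ) ≤ B.theta * (B.z₁ * B.k₂ * B.seeL ψ τ) := by linarith
  exact le_of_mul_le_mul_left h6 hθ

/-- With `ψ = 1 - q` in `seeG_le_seeL`, seeing contributes nothing positive to the payoff; always
yielding is available and bounds `wait₂` from the other side. The war of attrition thus involves no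
responses to challenges. -/
lemma optimal_wait₂ (hE : B.IsEquilibrium S₁ S₂) :
    IsOptimalFor S₂.F (B.wait₂ S₁) ((B.payoff₂ S₁ S₂ - (1 - B.a₁)) / B.D) where
  le t ht := by
    have h := hE.wait₂_le ht
    rw [le_div_iff₀ B.D_pos]; linarith
  ae := by
    filter_upwards [S₂.isSubCDF.ae_nonneg, hE.optimal₂.2] with t ht h
    have h1 := hE.seeG_le_seeL ht h (ψ := fun s => 1 - S₂.q s) (S₂.q_measurable.const_sub 1)
      fun s => ⟨by linarith [(S₂.q_mem s).2], by linarith [(S₂.q_mem s).1]⟩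
    have h2 := hE.wait₂_le ht
    rw [B.U₂_eq S₁ S₂.q_measurable S₂.q_mem ht] at h
    have h3 := mul_nonneg B.D_pos.le (sub_nonneg.2 h1)
    rw [alpha] at h3
    rw [eq_div_iff B.D_pos.ne']; linarith

end IsEquilibrium

end BargainingGame

/-! ### Reputation paths and the coevolution curve -/

/-- The primitive of `exp (A * ·)` vanishing at `0`. -/
noncomputable def expInt (A s : ℝ) : ℝ := ∫ u in 0..s, Real.exp (A * u)

lemma hasDerivAt_expInt (A s : ℝ) : HasDerivAt (expInt A) (Real.exp (A * s)) s := by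
  have hc : Continuous fun u => Real.exp (A * u) := by fun_prop
  exact intervalIntegral.integral_hasDerivAt_right (hc.intervalIntegrable _ _)
    (hc.stronglyMeasurableAtFilter _ _) hc.continuousAt

lemma continuous_expInt (A : ℝ) : Continuous (expInt A) :=
  continuous_iff_continuousAt.2 fun s => (hasDerivAt_expInt A s).continuousAt

lemma strictMono_expInt (A : ℝ) : StrictMono (expInt A) :=
  strictMono_of_hasDerivAt_pos (hasDerivAt_expInt A) fun _ => Real.exp_pos _

@[simp] lemma expInt_zero (A : ℝ) : expInt A 0 = 0 := by simp [expInt]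

lemma mul_expInt (A s : ℝ) : A * expInt A s = Real.exp (A * s) - 1 := by
  have := mul_integral_exp (-A) s
  simp only [neg_neg] at this
  rw [expInt]; linarith

lemma expInt_zero_left (s : ℝ) : expInt 0 s = s := by simp [expInt]

namespace BargainingGame

variable (B : BargainingGame)

/-- Unjustified challenges per justified challenge that make player 2 indifferent. -/
noncomputable def kap : ℝ := B.k₂ / (1 - B.w₁ - B.k₂)

lemma kap_pos : 0 < B.kap := div_pos B.k₂_mem.1 (by linarith [B.k₂_mem.2])

lemma nuStar_eq : B.nuStar = 1 / (1 + B.kap) := by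
  have h1 := B.one_sub_w₁_pos.ne'
  have h2 : 1 - B.w₁ - B.k₂ ≠ 0 := by linarith [B.k₂_mem.2]
  have h3 : 1 - B.w₁ - B.k₂ + B.k₂ ≠ 0 := by simpa using h1
  rw [nuStar, kap]
  field_simp
  ring

lemma div_nuStar (x : ℝ) : x / B.nuStar = x * (1 + B.kap) := by
  rw [nuStar_eq, one_div, div_inv_eq_mul]

lemma one_sub_nuStar_div : (1 - B.nuStar) / B.nuStar = B.kap := by
  rw [div_nuStar, nuStar_eq]
  have : 1 + B.kap ≠ 0 := by linarith [B.kap_pos]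
  field_simp
  ring

lemma muStar_pos : 0 < B.muStar := by rw [muStar]; linarith [B.c₁_mem.2]

lemma muStar_lt_one : B.muStar < 1 := by rw [muStar]; linarith [B.c₁_mem.1, B.w₁_nonneg]

lemma tN_pos : 0 < B.tN :=
  div_pos (neg_pos.2 (Real.log_neg B.muStar_pos B.muStar_lt_one)) B.lam₂_pos

lemma log_muStar : Real.log B.muStar = -B.lam₂ * B.tN := by
  have := B.lam₂_pos.ne'
  rw [tN]; field_simp

lemma muStar_eq : B.muStar = Real.exp (-B.lam₂ * B.tN) := by
  rw [← log_muStar, Real.exp_log B.muStar_pos]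

/-- Reciprocal of player 1's reputation, `t` units of time before the end. -/
noncomputable def invRep (t : ℝ) : ℝ :=
  1 + B.lam₁ * expInt (B.lam₁ - B.γ₁) t
    + B.γ₁ * B.kap * expInt (B.lam₁ - B.γ₁) (max (t - B.tN) 0)

lemma continuous_invRep : Continuous B.invRep := by
  have := continuous_expInt (B.lam₁ - B.γ₁)
  unfold invRep
  fun_prop

lemma strictMono_invRep : StrictMono B.invRep := fun s t hst => by
  have h1 := mul_lt_mul_of_pos_left (strictMono_expInt (B.lam₁ - B.γ₁) hst) B.lam₁_pos
  have h2 : max (s - B.tN) 0 ≤ max (t - B.tN) 0 := max_le_max_right 0 (by linarith)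
  have h3 := mul_le_mul_of_nonneg_left ((strictMono_expInt (B.lam₁ - B.γ₁)).monotone h2)
    (mul_nonneg B.γ₁_nonneg B.kap_pos.le)
  simp only [invRep]; linarith

lemma invRep_of_le {t : ℝ} (ht : t ≤ B.tN) :
    B.invRep t = 1 + B.lam₁ * expInt (B.lam₁ - B.γ₁) t := by
  rw [invRep, max_eq_right (by linarith)]; simp

lemma invRep_zero : B.invRep 0 = 1 := by rw [B.invRep_of_le B.tN_pos.le]; simp

lemma one_lt_invRep {t : ℝ} (ht : 0 < t) : 1 < B.invRep t := by
  rw [← B.invRep_zero]; exact B.strictMono_invRep ht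

lemma one_le_invRep {t : ℝ} (ht : 0 ≤ t) : 1 ≤ B.invRep t := by
  rw [← B.invRep_zero]; exact B.strictMono_invRep.monotone ht

lemma rpow_curve (t : ℝ) :
    Real.exp (-B.lam₂ * t) ^ ((B.γ₁ - B.lam₁) / B.lam₂) = Real.exp ((B.lam₁ - B.γ₁) * t) := by
  have := B.lam₂_pos.ne'
  rw [← Real.exp_mul]; congr 1; field_simp; ring

lemma muN_eq : B.muN = 1 / B.invRep B.tN := by
  have hl := B.lam₂_pos.ne'
  rw [muN, B.invRep_of_le le_rfl]
  split_ifs with h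
  · rw [log_muStar, h, sub_self, expInt_zero_left]
    congr 1; field_simp; ring
  · have hA : B.lam₁ - B.γ₁ ≠ 0 := fun h' => h (by linarith)
    have h1 := mul_expInt (B.lam₁ - B.γ₁) B.tN
    rw [muStar_eq, rpow_curve]
    have h2 : B.lam₁ * Real.exp ((B.lam₁ - B.γ₁) * B.tN) - B.γ₁
        = (B.lam₁ - B.γ₁) * (1 + B.lam₁ * expInt (B.lam₁ - B.γ₁) B.tN) := by
      linear_combination (-B.lam₁) * h1
    rw [h2, ← div_div, div_self hA]

/-- In backward time the reciprocal of a solution of the Bernoulli equation satisfies `y' = A * y +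
C`, with `A = lam₁ - γ₁` and `C` equal to `γ₁` before `tN` and `γ₁ / nuStar` after it. Using
`expInt` makes one formula cover both phases and also `A = 0`. -/
lemma muCheck₁_neg (t : ℝ) : B.muCheck₁ (-t) = 1 / B.invRep t := by
  rw [muCheck₁]
  split_ifs with ht
  · rw [B.invRep_of_le (by linarith), bernoulliSol]
    split_ifs with hA
    · have : B.γ₁ = B.lam₁ := by linarith
      rw [hA, expInt_zero_left, this]; congr 1; ring
    · have h1 := mul_expInt (B.lam₁ - B.γ₁) t
      congr 1
      field_simp
      ring_nf at h1 ⊢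
      linear_combination (-B.lam₁) * h1
  · rw [bernoulliSol, muN_eq, one_div_one_div, B.invRep_of_le le_rfl, div_nuStar, invRep,
      max_eq_left (by linarith)]
    split_ifs with hA
    · rw [hA]
      simp only [expInt_zero_left]
      have : B.γ₁ = B.lam₁ := by linarith
      rw [this]; congr 1; ring
    · have h1 := mul_expInt (B.lam₁ - B.γ₁) t
      have h2 := mul_expInt (B.lam₁ - B.γ₁) (t - B.tN)
      have h3 := mul_expInt (B.lam₁ - B.γ₁) B.tN
      have h4 : Real.exp (-(B.lam₁ - B.γ₁) * (B.tN + -t))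
        = Real.exp ((B.lam₁ - B.γ₁) * (t - B.tN)) := by congr 1; ring
      have h5 : Real.exp ((B.lam₁ - B.γ₁) * t) = Real.exp ((B.lam₁ - B.γ₁) * B.tN)
        * Real.exp ((B.lam₁ - B.γ₁) * (t - B.tN)) := by rw [← Real.exp_add]; congr 1; ring
      rw [h4]
      have hγ : B.γ₁ = B.lam₁ - (B.lam₁ - B.γ₁) := by ring
      generalize B.lam₁ - B.γ₁ = A at *
      congr 1
      apply mul_left_cancel₀ hA
      have e1 : A * (B.γ₁ * (1 + B.kap) / A) = B.γ₁ * (1 + B.kap) := by field_simp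
      generalize B.γ₁ * (1 + B.kap) / A = X at *
      generalize Real.exp (A * (t - B.tN)) = E at *
      generalize Real.exp (A * t) = E' at *
      generalize Real.exp (A * B.tN) = E'' at *
      linear_combination (E - 1) * e1 + B.lam₁ * E * h3 - B.lam₁ * h1 - B.γ₁ * B.kap * h2
        - B.lam₁ * h5 + (E-1) * hγ

lemma muCheck₂_neg (t : ℝ) : B.muCheck₂ (-t) = Real.exp (-B.lam₂ * t) := by
  rw [muCheck₂, bernoulliSol, if_neg B.lam₂_pos.ne']
  simp [Real.exp_neg]

/-- The curve is the elimination of time: player 2's backward path is the exponential, and `curve₁`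
returns player 1's reputation at the same time before the end. -/
lemma curve₁_exp (t : ℝ) : B.curve₁ (Real.exp (-B.lam₂ * t)) = 1 / B.invRep t := by
  have hl := B.lam₂_pos
  have hl' := hl.ne'
  have hiff : B.muStar < Real.exp (-B.lam₂ * t) ↔ t < B.tN := by
    rw [muStar_eq, Real.exp_lt_exp]
    constructor <;> intro h <;> nlinarith
  have hdiv : Real.exp (-B.lam₂ * t) / B.muStar = Real.exp (-B.lam₂ * (t - B.tN)) := by
    rw [muStar_eq, ← Real.exp_sub]; congr 1; ring
  rw [← B.muCheck₁_neg, muCheck₁, curve₁, hdiv, rpow_curve, rpow_curve, Real.log_exp, Real.log_exp,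
    log_muStar]
  simp only [hiff, bernoulliSol, neg_lt_neg_iff]
  by_cases hγ : B.γ₁ = B.lam₁
  · rw [if_pos hγ]
    have h0 : B.lam₁ - B.γ₁ = 0 := by linarith
    rw [if_pos h0, if_pos h0]
    congr 1
    · congr 1; field_simp
    · rw [muN, if_pos hγ, one_div_one_div, log_muStar]
      congr 1; field_simp; ring
  · have hA : B.lam₁ - B.γ₁ ≠ 0 := fun h' => hγ (by linarith)
    rw [if_neg hγ, if_neg hA, if_neg hA, muN, if_neg hγ, muStar_eq, rpow_curve, one_div_div]
    have h4 : Real.exp (-(B.lam₁ - B.γ₁) * (B.tN + -t))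
        = Real.exp ((B.lam₁ - B.γ₁) * (t - B.tN)) := by congr 1; ring
    have h4' : Real.exp (-(B.lam₁ - B.γ₁) * -t)
        = Real.exp ((B.lam₁ - B.γ₁) * t) := by congr 1; ring
    have h5 : Real.exp ((B.lam₁ - B.γ₁) * t) = Real.exp ((B.lam₁ - B.γ₁) * B.tN)
        * Real.exp ((B.lam₁ - B.γ₁) * (t - B.tN)) := by rw [← Real.exp_add]; congr 1; ring
    rw [h4, h4']
    congr 1
    · rw [← one_div_div]; congr 1; field_simp; ring
    · rw [h5, ← one_div_div]; congr 1; field_simp; ring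

/-- The hypothesis says that `1 / y` lies below the supremum of `invRep`. This is no restriction if
`γ₁ ≤ lam₁`, where `invRep` is unbounded; otherwise the limit is `γ₁ * (1 + kap) / (γ₁ - lam₁)`. -/
lemma exists_invRep_eq {y : ℝ} (hy0 : 0 < y) (hy1 : y < 1)
    (h : (B.γ₁ - B.lam₁) * B.nuStar < B.γ₁ * y) : ∃ t, 0 < t ∧ B.invRep t = 1 / y := by
  have hk := B.kap_pos
  have hl := B.lam₁_pos
  have hg := B.γ₁_nonneg
  have h1 : (1 : ℝ) < 1 / y := by rw [lt_div_iff₀ hy0]; linarith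
  suffices hlarge : ∃ b, 0 ≤ b ∧ 1 / y ≤ B.invRep b by
    obtain ⟨b, hb0, hb⟩ := hlarge
    obtain ⟨t, ht, hty⟩ := intermediate_value_Icc hb0 B.continuous_invRep.continuousOn
      ⟨by rw [invRep_zero]; exact h1.le, hb⟩
    refine ⟨t, lt_of_le_of_ne ht.1 fun h0 => ?_, hty⟩
    rw [← h0, invRep_zero] at hty; linarith
  rcases le_or_gt B.γ₁ B.lam₁ with hle | hgt
  -- Here the integrand of `expInt` is at least one, so `lam₁ * expInt` at this time is already at
  -- least `1 / y`.
  · refine ⟨1 / y / B.lam₁, by positivity, ?_⟩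
    have hs : (0 : ℝ) ≤ 1 / y / B.lam₁ := by positivity
    have h2 : 1 / y / B.lam₁ ≤ expInt (B.lam₁ - B.γ₁) (1 / y / B.lam₁) := by
      have : ∫ u in 0..(1 / y / B.lam₁), (1 : ℝ) = 1 / y / B.lam₁ := by simp
      rw [expInt]
      nth_rewrite 1 [← this]
      refine intervalIntegral.integral_mono_on hs (by simp)
        (Continuous.intervalIntegrable (by fun_prop) _ _) fun x hx => ?_
      exact Real.one_le_exp (mul_nonneg (by linarith) hx.1)
    have h3 : 0 ≤ expInt (B.lam₁ - B.γ₁) (max (1 / y / B.lam₁ - B.tN) 0) := by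
      have := (strictMono_expInt (B.lam₁ - B.γ₁)).monotone
        (le_max_right (1 / y / B.lam₁ - B.tN) 0)
      rwa [expInt_zero] at this
    have h4 := mul_le_mul_of_nonneg_left h2 hl.le
    have h5 := mul_nonneg (mul_nonneg hg hk.le) h3
    have h6 : B.lam₁ * (1 / y / B.lam₁) = 1 / y := by field_simp
    rw [invRep]; linarith
  · have hA : B.lam₁ - B.γ₁ < 0 := by linarith
    have hE : Tendsto (fun t => Real.exp ((B.lam₁ - B.γ₁) * t)) atTop (𝓝 0) :=
      Real.tendsto_exp_atBot.comp (tendsto_id.const_mul_atTop_of_neg hA)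
    have hEI : Tendsto (expInt (B.lam₁ - B.γ₁)) atTop (𝓝 (1 / (B.γ₁ - B.lam₁))) := by
      have h2 : Tendsto (fun t => (1 - Real.exp ((B.lam₁ - B.γ₁) * t)) / (B.γ₁ - B.lam₁)) atTop
          (𝓝 ((1 - 0) / (B.γ₁ - B.lam₁))) := (hE.const_sub 1).div_const _
      rw [sub_zero] at h2
      refine h2.congr fun t => ?_
      rw [div_eq_iff (by linarith)]
      linarith [mul_expInt (B.lam₁ - B.γ₁) t]
    have hmax : Tendsto (fun t => max (t - B.tN) 0) atTop atTop :=
      tendsto_atTop_mono (fun t => le_max_left _ _) (tendsto_atTop_add_const_right _ _ tendsto_id)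
    have hlim : Tendsto B.invRep atTop (𝓝 (1 + B.lam₁ * (1 / (B.γ₁ - B.lam₁))
        + B.γ₁ * B.kap * (1 / (B.γ₁ - B.lam₁)))) :=
      ((hEI.const_mul _).const_add 1).add ((hEI.comp hmax).const_mul _)
    have hval : 1 / y < 1 + B.lam₁ * (1 / (B.γ₁ - B.lam₁))
        + B.γ₁ * B.kap * (1 / (B.γ₁ - B.lam₁)) := by
      have hd : 0 < B.γ₁ - B.lam₁ := by linarith
      have e : 1 + B.lam₁ * (1 / (B.γ₁ - B.lam₁)) + B.γ₁ * B.kap * (1 / (B.γ₁ - B.lam₁))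
          = B.γ₁ * (1 + B.kap) / (B.γ₁ - B.lam₁) := by field_simp; ring
      rw [e, div_lt_div_iff₀ hy0 hd, one_mul]
      rw [nuStar_eq, mul_one_div, div_lt_iff₀ (by linarith)] at h
      linarith
    obtain ⟨b, hb, hb0⟩ := ((hlim.eventually (lt_mem_nhds hval)).and (eventually_ge_atTop 0)).exists
    exact ⟨b, hb0, hb.le⟩

/-- When `lam₁ < γ₁`, the positive exponentials in `(γ₁ - lam₁) * invRep t` keep `invRep` strictly
below its limit. So a reputation on the path never falls under the branch where `curve₂` is set to
0. -/
lemma lt_of_invRep_eq {y t : ℝ} (hy0 : 0 < y) (h : B.invRep t = 1 / y) :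
    (B.γ₁ - B.lam₁) * B.nuStar < B.γ₁ * y := by
  have hk := B.kap_pos
  have hl := B.lam₁_pos
  have hg := B.γ₁_nonneg
  have h0 := mul_expInt (B.lam₁ - B.γ₁) t
  have h0' := mul_expInt (B.lam₁ - B.γ₁) (max (t - B.tN) 0)
  have h1 := Real.exp_pos ((B.lam₁ - B.γ₁) * t)
  have h2 := Real.exp_pos ((B.lam₁ - B.γ₁) * (max (t - B.tN) 0))
  have h3 : (B.γ₁ - B.lam₁) * B.invRep t < B.γ₁ * (1 + B.kap) := by
    have h4 := mul_pos hl h1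
    have h5 := mul_nonneg (mul_nonneg hg hk.le) h2.le
    have h6 : (B.γ₁ - B.lam₁) * B.invRep t = B.γ₁ * (1 + B.kap)
        - B.lam₁ * Real.exp ((B.lam₁ - B.γ₁) * t)
        - B.γ₁ * B.kap * Real.exp ((B.lam₁ - B.γ₁) * (max (t - B.tN) 0)) := by
      rw [invRep]; linear_combination (-B.lam₁) * h0 - B.γ₁ * B.kap * h0'
    linarith
  rw [h, mul_one_div, div_lt_iff₀ hy0] at h3
  rw [nuStar_eq, mul_one_div, div_lt_iff₀ (by linarith)]
  linarith

lemma curve₂_eq_zero {y : ℝ} (h : B.γ₁ * y ≤ (B.γ₁ - B.lam₁) * B.nuStar) : B.curve₂ y = 0 := by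
  rw [curve₂, if_pos h]

lemma curve₂_of_invRep {y t : ℝ} (hy0 : 0 < y) (ht : 0 < t) (h : B.invRep t = 1 / y) :
    B.curve₂ y = Real.exp (-B.lam₂ * t) := by
  have hl := B.lam₁_pos
  have hl2 := B.lam₂_pos
  have hl2' := hl2.ne'
  have hk := B.kap_pos
  have hiff : B.muN < y ↔ t < B.tN := by
    have hp : 0 < B.invRep B.tN := by linarith [B.one_le_invRep B.tN_pos.le]
    rw [muN_eq, div_lt_comm₀ hp hy0, ← h, B.strictMono_invRep.lt_iff_lt]
  rw [curve₂, if_neg (not_le.2 (B.lt_of_invRep_eq hy0 h))]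
  simp only [hiff]
  by_cases hγ : B.γ₁ = B.lam₁
  · have hA : B.lam₁ - B.γ₁ = 0 := by linarith
    have hg : B.γ₁ ≠ 0 := by rw [hγ]; exact hl.ne'
    rw [if_pos hγ]
    rcases lt_or_ge t B.tN with htN | htN
    · rw [if_pos htN, ← h, B.invRep_of_le htN.le, hA, expInt_zero_left]
      congr 1
      rw [← hγ]
      field_simp
      ring
    · rw [if_neg (not_lt.2 htN), ← h, invRep, max_eq_left (by linarith), hA, expInt_zero_left,
        expInt_zero_left, log_muStar, muStar_eq, ← Real.exp_add, div_nuStar]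
      congr 1
      have hk' : 1 + B.kap ≠ 0 := by linarith
      rw [← hγ]
      field_simp
      ring
  · have hA : B.lam₁ - B.γ₁ ≠ 0 := fun h' => hγ (by linarith)
    have hA' : B.γ₁ - B.lam₁ ≠ 0 := fun h' => hγ (by linarith)
    have hpow : Real.exp ((B.lam₁ - B.γ₁) * t) ^ (B.lam₂ / (B.γ₁ - B.lam₁))
        = Real.exp (-B.lam₂ * t) := by
      rw [← Real.exp_mul]; congr 1; field_simp; ring
    rw [if_neg hγ]
    have h1 := mul_expInt (B.lam₁ - B.γ₁) t
    rcases lt_or_ge t B.tN with htN | htN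
    · rw [if_pos htN, ← h, B.invRep_of_le htN.le, ← hpow]
      congr 1
      field_simp
      linear_combination B.lam₁ * h1
    · rw [if_neg (not_lt.2 htN), ← h, invRep, max_eq_left (by linarith), ← hpow,
        one_sub_nuStar_div, div_nuStar]
      congr 1
      have h2 := mul_expInt (B.lam₁ - B.γ₁) (t - B.tN)
      have hmu : B.muStar ^ ((B.lam₁ - B.γ₁) / B.lam₂) = Real.exp (-(B.lam₁ - B.γ₁) * B.tN) := by
        rw [muStar_eq, ← Real.exp_mul]; congr 1; field_simp
      have h5 : Real.exp ((B.lam₁ - B.γ₁) * (t - B.tN)) = Real.exp ((B.lam₁ - B.γ₁) * t)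
        * Real.exp (-(B.lam₁ - B.γ₁) * B.tN) := by rw [← Real.exp_add]; congr 1; ring
      rw [h5] at h2
      rw [hmu]
      have hden : 0 < 1 + B.kap * (B.γ₁ / B.lam₁) * Real.exp (-(B.lam₁ - B.γ₁) * B.tN) := by
        have := B.γ₁_nonneg
        positivity
      rw [div_eq_iff hden.ne']
      field_simp
      ring_nf at h1 h2 ⊢
      linear_combination B.lam₁ * h1 + B.γ₁ * B.kap * h2

/-! ### The terminal time -/

/-- `T` is the first backward time at which one of the two reputations reaches its prior. -/
structure IsTerminal (T : ℝ) : Prop where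
  pos : 0 < T
  le₁ : B.invRep T ≤ 1 / B.z₁
  le₂ : B.z₂ ≤ Real.exp (-B.lam₂ * T)
  or : B.invRep T = 1 / B.z₁ ∨ Real.exp (-B.lam₂ * T) = B.z₂

lemma exists_isTerminal : ∃ T, B.IsTerminal T := by
  have hl2 := B.lam₂_pos
  have hz1 : 1 < 1 / B.z₁ := by rw [lt_div_iff₀ B.z₁_mem.1]; linarith [B.z₁_mem.2]
  -- Player 2's path always reaches its prior, at `t₂`. Player 1's path may never do so, hence the
  -- comparison at `t₂`.
  set t₂ := -Real.log B.z₂ / B.lam₂ with ht₂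
  have ht₂0 : 0 < t₂ := div_pos (neg_pos.2 (Real.log_neg B.z₂_mem.1 B.z₂_mem.2)) hl2
  have hexp : Real.exp (-B.lam₂ * t₂) = B.z₂ := by
    have : -B.lam₂ * t₂ = Real.log B.z₂ := by rw [ht₂]; field_simp
    rw [this, Real.exp_log B.z₂_mem.1]
  rcases le_or_gt (B.invRep t₂) (1 / B.z₁) with h | h
  · exact ⟨t₂, ht₂0, h, hexp.ge, Or.inr hexp⟩
  · obtain ⟨T, hT, hTz⟩ := intermediate_value_Icc ht₂0.le B.continuous_invRep.continuousOn
      (show 1 / B.z₁ ∈ Icc (B.invRep 0) (B.invRep t₂) from ⟨by rw [invRep_zero]; exact hz1.le, h.le⟩)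
    refine ⟨T, lt_of_le_of_ne hT.1 fun h0 => ?_, hTz.le, ?_, Or.inl hTz⟩
    · rw [← h0, invRep_zero] at hTz; linarith
    · rw [← hexp, Real.exp_le_exp]; nlinarith [hT.2]

variable {B}

lemma IsTerminal.le_of_eq {T t : ℝ} (hT : B.IsTerminal T)
    (h : B.invRep t = 1 / B.z₁ ∨ Real.exp (-B.lam₂ * t) = B.z₂) : T ≤ t := by
  have hl2 := B.lam₂_pos
  rcases h with h | h
  · rw [← B.strictMono_invRep.le_iff_le, h]; exact hT.le₁
  · have := hT.le₂
    rw [← h, Real.exp_le_exp] at this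
    nlinarith

lemma IsTerminal.unique {T T' : ℝ} (hT : B.IsTerminal T) (hT' : B.IsTerminal T') : T = T' :=
  le_antisymm (hT.le_of_eq hT'.or) (hT'.le_of_eq hT.or)

lemma IsTerminal.isLeast {T : ℝ} (hT : B.IsTerminal T) :
    IsLeast {t : ℝ | 0 ≤ t ∧ (B.muCheck₁ (-t) = B.z₁ ∨ B.muCheck₂ (-t) = B.z₂)} T := by
  have hiff : ∀ t, B.muCheck₁ (-t) = B.z₁ ↔ B.invRep t = 1 / B.z₁ := fun t => by
    rw [muCheck₁_neg, one_div, one_div, inv_eq_iff_eq_inv]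
  constructor
  · refine ⟨hT.pos.le, ?_⟩
    rw [hiff, muCheck₂_neg]; exact hT.or
  · rintro t ⟨_, h⟩
    rw [hiff, muCheck₂_neg] at h
    exact hT.le_of_eq h

/-- If player 1's path reaches its prior strictly first, the point of the curve over `z₂` lies
further back in time, where player 1's reputation is below `z₁`. -/
lemma IsTerminal.curve₁_z₂ {T : ℝ} (hT : B.IsTerminal T) :
    if Real.exp (-B.lam₂ * T) = B.z₂ then B.curve₁ B.z₂ = 1 / B.invRep T else
      B.curve₁ B.z₂ < B.z₁ := by
  have hl2 := B.lam₂_pos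
  split_ifs with h
  · rw [← h, curve₁_exp]
  · have h1 := hT.or.resolve_right h
    set t₂ := -Real.log B.z₂ / B.lam₂ with ht₂
    have hexp : Real.exp (-B.lam₂ * t₂) = B.z₂ := by
      have : -B.lam₂ * t₂ = Real.log B.z₂ := by rw [ht₂]; field_simp
      rw [this, Real.exp_log B.z₂_mem.1]
    have hlt : T < t₂ := lt_of_le_of_ne (hT.le_of_eq (Or.inr hexp)) fun h' => h (h' ▸ hexp)
    rw [← hexp, curve₁_exp, one_div_lt _ B.z₁_mem.1, ← h1]
    · exact B.strictMono_invRep hlt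
    · linarith [B.one_lt_invRep (hT.pos.trans hlt)]

/-- If player 2's path reaches its prior strictly first, player 1's path reaches `z₁` further back
or never; in the latter case `curve₂` is 0, still below `z₂`. -/
lemma IsTerminal.curve₂_z₁ {T : ℝ} (hT : B.IsTerminal T) :
    if B.invRep T = 1 / B.z₁ then B.curve₂ B.z₁ = Real.exp (-B.lam₂ * T) else
      B.curve₂ B.z₁ < B.z₂ := by
  have hl2 := B.lam₂_pos
  split_ifs with h
  · exact B.curve₂_of_invRep B.z₁_mem.1 hT.pos h
  · have h1 := hT.or.resolve_left h
    rcases le_or_gt (B.γ₁ * B.z₁) ((B.γ₁ - B.lam₁) * B.nuStar) with h2 | h2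
    · rw [B.curve₂_eq_zero h2]; exact B.z₂_mem.1
    · obtain ⟨t, ht, hty⟩ := B.exists_invRep_eq B.z₁_mem.1 B.z₁_mem.2 h2
      have hlt : T < t := lt_of_le_of_ne (hT.le_of_eq (Or.inl hty)) fun h' => h (h' ▸ hty)
      rw [B.curve₂_of_invRep B.z₁_mem.1 ht hty, ← h1, Real.exp_lt_exp]
      nlinarith

end BargainingGame

/-! ### The closed form and the break-even yielding probability -/

namespace BargainingGame

variable (B : BargainingGame)

/-- The time at which challenges stop, for terminal time `T`. -/
noncomputable def stopTime (T : ℝ) : ℝ := max (T - B.tN) 0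

lemma stopTime_nonneg (T : ℝ) : 0 ≤ B.stopTime T := le_max_right _ _

lemma stopTime_lt {T : ℝ} (hT : 0 < T) : B.stopTime T < T := max_lt (by linarith [B.tN_pos]) hT

/-- Player 1's survival probability at time `t`, for terminal time `T`. -/
noncomputable def survSol₁ (T t : ℝ) : ℝ := B.z₁ * Real.exp (-B.γ₁ * t) * B.invRep (T - t)

/-- Probability of a challenge by time `t` by an unjustified player 1, for terminal time `T`. -/
noncomputable def chalSol (T t : ℝ) : ℝ :=
  B.z₁ / (1 - B.z₁) * B.kap * (1 - Real.exp (-B.γ₁ * min t (B.stopTime T)))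

/-- The closed form that all equilibria share. -/
structure IsSolution (T : ℝ) (S₁ : StrategyOne) (S₂ : StrategyTwo) : Prop where
  terminal : B.IsTerminal T
  surv₁_eq : ∀ t, 0 ≤ t → t ≤ T → B.surv₁ S₁ t = B.survSol₁ T t
  surv₂_eq : ∀ t, 0 ≤ t → t ≤ T → B.surv₂ S₂ t = B.z₂ * Real.exp (B.lam₂ * (T - t))
  G_eq : ∀ t, 0 ≤ t → S₁.G t = B.chalSol T t
  F₁_const : ∀ t, T ≤ t → S₁.F t = S₁.F T
  F₂_const : ∀ t, T ≤ t → S₂.F t = 1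

/-- The yielding probability that makes player 1 indifferent between challenging and conceding. -/
noncomputable def yieldSol (T t : ℝ) : ℝ :=
  1 / (1 - B.w₁) * (B.c₁ / (1 - Real.exp (-B.lam₂ * (T - t))) - B.w₁)

/-- The kink of the challenging probability cancels against that of the reputation. -/
lemma hasDerivAt_kink (c t : ℝ) :
    HasDerivAt (fun t => B.γ₁ * Real.exp (-B.γ₁ * t) * expInt (B.lam₁ - B.γ₁) (max (c - t) 0)
      + (1 - Real.exp (-B.γ₁ * min t c)))
      (-B.lam₁ * (B.γ₁ * Real.exp (-B.γ₁ * t) * expInt (B.lam₁ - B.γ₁) (max (c - t) 0))) t := by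
  have hE := continuous_expInt (B.lam₁ - B.γ₁)
  have hne : ∀ y, y ≠ c → HasDerivAt (fun t => B.γ₁ * Real.exp (-B.γ₁ * t)
      * expInt (B.lam₁ - B.γ₁) (max (c - t) 0) + (1 - Real.exp (-B.γ₁ * min t c)))
      (-B.lam₁ * (B.γ₁ * Real.exp (-B.γ₁ * y) * expInt (B.lam₁ - B.γ₁) (max (c - y) 0))) y := by
    intro y hy
    rcases hy.lt_or_gt with h | h
    · have h1 := ((hasDerivAt_exp_const_mul (-B.γ₁) y).const_mul B.γ₁).mul
        ((hasDerivAt_expInt (B.lam₁ - B.γ₁) (c - y)).comp y ((hasDerivAt_id y).const_sub c))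
      have h2 := h1.add ((hasDerivAt_exp_const_mul (-B.γ₁) y).const_sub 1)
      refine (h2.congr_of_eventuallyEq ?_).congr_deriv ?_
      · filter_upwards [gt_mem_nhds h] with x hx
        simp [max_eq_left (sub_nonneg.2 hx.le), min_eq_left hx.le]
      · rw [max_eq_left (by linarith)]
        have := mul_expInt (B.lam₁ - B.γ₁) (c - y)
        simp only [comp]
        linear_combination B.γ₁ * Real.exp (-B.γ₁ * y) * this
    · refine ((hasDerivAt_const y (1 - Real.exp (-B.γ₁ * c))).congr_of_eventuallyEq ?_).congr_deriv ?_
      · filter_upwards [lt_mem_nhds h] with x hx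
        simp [max_eq_right (sub_nonpos.2 hx.le), min_eq_right hx.le]
      · rw [max_eq_right (by linarith)]; simp
  by_cases ht : t = c
  · subst ht
    -- The derivative found on both sides extends continuously through `c`, since `expInt` vanishes
    -- at 0; with continuity of the function this gives differentiability at `c`.
    exact hasDerivAt_of_hasDerivAt_of_ne hne (by fun_prop) (by fun_prop)
  · exact hne t ht

/-- Player 1's survival probability plus the probabilities of challenges. -/
noncomputable def nonConcSol (T t : ℝ) : ℝ :=
  B.survSol₁ T t + (1 - B.z₁) * B.chalSol T t + B.z₁ * (1 - Real.exp (-B.γ₁ * t))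

/-- Adding back both types' challenges leaves only concessions, which flow at `lam₁` times the
survival probability. This is player 2's indifference condition. -/
lemma hasDerivAt_nonConcSol (T : ℝ) {t : ℝ} (ht : 0 < t) :
    HasDerivAt (B.nonConcSol T) (-B.lam₁ * B.survSol₁ T t) t := by
  have hz : 1 - B.z₁ ≠ 0 := by linarith [B.z₁_mem.2]
  have h1 : HasDerivAt (fun t => B.z₁ * Real.exp (-B.γ₁ * t)
      * (1 + B.lam₁ * expInt (B.lam₁ - B.γ₁) (T - t)) + B.z₁ * (1 - Real.exp (-B.γ₁ * t)))
      (-B.lam₁ * (B.z₁ * Real.exp (-B.γ₁ * t)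
        * (1 + B.lam₁ * expInt (B.lam₁ - B.γ₁) (T - t)))) t := by
    have e := hasDerivAt_exp_const_mul (-B.γ₁) t
    have h := ((e.const_mul B.z₁).mul ((((hasDerivAt_expInt (B.lam₁ - B.γ₁) (T - t)).comp t
      ((hasDerivAt_id t).const_sub T)).const_mul B.lam₁).const_add 1)).add
      ((e.const_sub 1).const_mul B.z₁)
    refine h.congr_deriv ?_
    have := mul_expInt (B.lam₁ - B.γ₁) (T - t)
    simp only [comp]
    linear_combination (B.z₁ * B.lam₁ * Real.exp (-B.γ₁ * t)) * this
  have h2 : HasDerivAt (fun t => B.γ₁ * Real.exp (-B.γ₁ * t)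
      * expInt (B.lam₁ - B.γ₁) (max (T - B.tN - t) 0)
      + (1 - Real.exp (-B.γ₁ * min t (B.stopTime T))))
      (-B.lam₁ * (B.γ₁ * Real.exp (-B.γ₁ * t)
        * expInt (B.lam₁ - B.γ₁) (max (T - B.tN - t) 0))) t := by
    -- If `T ≤ tN`, there is no challenge phase, `stopTime` is 0, and the expression vanishes for
    -- positive times.
    rcases le_or_gt (T - B.tN) 0 with hc | hc
    · refine ((hasDerivAt_const t (0 : ℝ)).congr_of_eventuallyEq ?_).congr_deriv ?_
      · filter_upwards [lt_mem_nhds ht] with x hx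
        simp [stopTime, max_eq_right hc, max_eq_right (by linarith : T - B.tN - x ≤ 0),
          min_eq_right hx.le]
      · simp [max_eq_right (by linarith : T - B.tN - t ≤ 0)]
    · rw [stopTime, max_eq_left hc.le]
      exact B.hasDerivAt_kink _ _
  have h3 := h1.add (h2.const_mul (B.z₁ * B.kap))
  refine (h3.congr_of_eventuallyEq (Eventually.of_forall fun x => ?_)).congr_deriv ?_
  · simp only [nonConcSol, survSol₁, chalSol, invRep, Pi.add_apply, sub_right_comm]
    field_simp
    ring
  · rw [survSol₁, invRep, sub_right_comm]; ring

lemma continuous_nonConcSol (T : ℝ) : Continuous (B.nonConcSol T) := by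
  have := B.continuous_invRep
  unfold nonConcSol survSol₁ chalSol
  fun_prop

lemma chalGain_eq {S : StrategyTwo} {T t : ℝ}
    (h : B.surv₂ S t = B.z₂ * Real.exp (B.lam₂ * (T - t))) :
    B.chalGain S t = B.surv₂ S t * ((1 - Real.exp (-B.lam₂ * (T - t)))
      * ((1 - S.q t) * B.w₁ + S.q t) - B.c₁) := by
  have h1 : Real.exp (B.lam₂ * (T - t)) * Real.exp (-B.lam₂ * (T - t)) = 1 := by
    rw [← Real.exp_add]; simp
  have h2 : B.surv₂ S t * Real.exp (-B.lam₂ * (T - t)) = B.z₂ := by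
    rw [h]; linear_combination B.z₂ * h1
  have h3 : (1 - B.z₂) * (1 - S.F t) = B.surv₂ S t - B.z₂ := by rw [surv₂]; ring
  rw [chalGain, h3]
  linear_combination ((1 - S.q t) * B.w₁ + S.q t) * h2

/-- The gain is affine and increasing in the yielding probability, with root `yieldSol`. Dividing by
one minus player 2's reputation needs `t < T`. -/
lemma chalGain_nonpos_iff {S : StrategyTwo} {T t : ℝ} (htT : t < T)
    (h : B.surv₂ S t = B.z₂ * Real.exp (B.lam₂ * (T - t))) :
    B.chalGain S t ≤ 0 ↔ S.q t ≤ B.yieldSol T t := by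
  have hP := (B.isSurvival_surv₂ S).pos t
  have hw := B.one_sub_w₁_pos
  have he : 0 < 1 - Real.exp (-B.lam₂ * (T - t)) := by
    rw [sub_pos, Real.exp_lt_one_iff]; nlinarith [B.lam₂_pos]
  rw [B.chalGain_eq h, yieldSol, one_div_mul_eq_div, le_div_iff₀ hw, le_sub_iff_add_le,
    le_div_iff₀ he, mul_nonpos_iff_pos_imp_nonpos]
  constructor
  · intro h; nlinarith [h.1 hP]
  · intro h; refine ⟨fun _ => by nlinarith, fun h' => by nlinarith⟩

lemma chalGain_nonneg_iff {S : StrategyTwo} {T t : ℝ} (htT : t < T)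
    (h : B.surv₂ S t = B.z₂ * Real.exp (B.lam₂ * (T - t))) :
    0 ≤ B.chalGain S t ↔ B.yieldSol T t ≤ S.q t := by
  have hP := (B.isSurvival_surv₂ S).pos t
  have hw := B.one_sub_w₁_pos
  have he : 0 < 1 - Real.exp (-B.lam₂ * (T - t)) := by
    rw [sub_pos, Real.exp_lt_one_iff]; nlinarith [B.lam₂_pos]
  rw [B.chalGain_eq h, yieldSol, one_div_mul_eq_div, div_le_iff₀ hw, sub_le_iff_le_add,
    div_le_iff₀ he, mul_nonneg_iff_of_pos_left hP]
  constructor <;> intro h <;> nlinarith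

lemma strictMono_yieldSol {T s t : ℝ} (hst : s < t) (htT : t < T) :
    B.yieldSol T s < B.yieldSol T t := by
  have hl := B.lam₂_pos
  have hc : 0 < B.c₁ := by linarith [B.c₁_mem.1, B.w₁_nonneg]
  have h1 : Real.exp (-B.lam₂ * (T - s)) < Real.exp (-B.lam₂ * (T - t)) := by
    rw [Real.exp_lt_exp]; nlinarith
  have h2 : Real.exp (-B.lam₂ * (T - t)) < 1 := by rw [Real.exp_lt_one_iff]; nlinarith
  rw [yieldSol, yieldSol]
  have h3 : B.c₁ / (1 - Real.exp (-B.lam₂ * (T - s))) < B.c₁ / (1 - Real.exp (-B.lam₂ * (T - t))) :=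
    div_lt_div_of_pos_left hc (by linarith) (by linarith)
  exact mul_lt_mul_of_pos_left (by linarith) (one_div_pos.2 B.one_sub_w₁_pos)

/-- At this time player 2's reputation is `1 - c₁`, so only certain yielding repays the cost of a
challenge. -/
lemma yieldSol_sub_tN (T : ℝ) : B.yieldSol T (T - B.tN) = 1 := by
  have hw := B.one_sub_w₁_pos.ne'
  have hc : B.c₁ ≠ 0 := by linarith [B.c₁_mem.1, B.w₁_nonneg]
  rw [yieldSol, sub_sub_cancel, ← muStar_eq, muStar, sub_sub_cancel, div_self hc]
  field_simp

lemma measurable_yieldSol (T : ℝ) : Measurable (B.yieldSol T) := by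
  unfold yieldSol; fun_prop

/-! ### Equilibria: player 2's concessions and the end of challenges -/

variable {B} {S₁ : StrategyOne} {S₂ : StrategyTwo}

namespace IsEquilibrium

lemma F₂_tendsto (hE : B.IsEquilibrium S₁ S₂) : Tendsto S₂.F atTop (𝓝 1) := by
  rw [← hE.optimal₂.1]; exact S₂.isSubCDF.tendsto_atTop

/-- If player 2 conceded at once for sure, player 1 would gain by acting after 0 but as soon as
possible. No time of concession is then optimal, and challenges cannot pay, so no mass of player 1's
strategy could be placed. -/
lemma F₂_zero_lt_one (hE : B.IsEquilibrium S₁ S₂) : S₂.F 0 < 1 := by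
  have := S₁.isSubCDF_F.isFiniteMeasure
  have := S₁.isSubCDF_G.isFiniteMeasure
  refine lt_of_le_of_ne (S₂.F_le_one 0) fun h0 => ?_
  have hF : ∀ t, 0 ≤ t → S₂.F t = 1 := fun t ht =>
    le_antisymm (S₂.F_le_one t) (h0 ▸ S₂.F.mono ht)
  have hG0 : ∀ᵐ t ∂S₁.G.measure, False := by
    filter_upwards [hE.challenge_ae, S₁.isSubCDF_G.ae_nonneg] with t h1 h2
    exact (B.of_chalGain_nonneg S₂ h1).2.ne (hF t h2)
  have hF0 : ∀ᵐ t ∂S₁.F.measure, False := by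
    filter_upwards [hE.optimal_wait₁.ae, S₁.isSubCDF_F.ae_nonneg] with t h1 h2
    rcases h2.eq_or_lt with rfl | h3
    · obtain ⟨ε, hε, v, hv, h⟩ := (B.isWaitGain₁ S₂).lt_of_atom 0 le_rfl (by
        rw [S₂.isSubCDF.leftLim_of_nonpos le_rfl, h0]; exact one_pos)
      have h4 := h 0 le_rfl (by linarith) le_rfl
      have h5 := hE.optimal_wait₁.le v hv.le
      linarith
    · have h4 := (B.isWaitGain₁ S₂).lt_of_const 0 (t / 2) t le_rfl (by linarith) (by linarith)
        (by rw [hF t h2, h0])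
      have h5 := hE.optimal_wait₁.le (t / 2) (by linarith)
      linarith
  rw [eventually_false_iff_eq_bot, ae_eq_bot] at hG0 hF0
  have := hE.optimal₁.1
  rw [hG0, hF0] at this
  simp at this

lemma indifferent (hE : B.IsEquilibrium S₁ S₂) {t : ℝ} (ht : 0 < t) (h : S₂.F t < 1) :
    B.wait₁ S₂ t = (B.payoff₁ S₁ S₂ - (1 - B.a₂)) / B.D ∧
    B.wait₂ S₁ t = (B.payoff₂ S₁ S₂ - (1 - B.a₁)) / B.D := by
  obtain ⟨v, hv, htv⟩ := ((hE.F₂_tendsto.eventually (lt_mem_nhds h)).and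
    (eventually_ge_atTop t)).exists
  exact war_indifferent (B.isWaitGain₁ S₂) (B.isWaitGain₂ S₁) hE.optimal_wait₁ hE.optimal_wait₂
    ht htv hv

lemma F₁_continuousAt (hE : B.IsEquilibrium S₁ S₂) {t : ℝ} (ht : 0 < t) : ContinuousAt S₁.F t :=
  war_continuousAt (B.isWaitGain₂ S₁) (B.isWaitGain₁ S₂) hE.optimal_wait₂ hE.optimal_wait₁ ht

lemma F₂_continuousAt (hE : B.IsEquilibrium S₁ S₂) {t : ℝ} (ht : 0 < t) : ContinuousAt S₂.F t :=
  war_continuousAt (B.isWaitGain₁ S₂) (B.isWaitGain₂ S₁) hE.optimal_wait₁ hE.optimal_wait₂ ht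

lemma surv₁_continuousAt (hE : B.IsEquilibrium S₁ S₂) {t : ℝ} (ht : 0 < t) :
    ContinuousAt (B.surv₁ S₁) t :=
  (continuousAt_const.sub (continuousAt_const.mul ((hE.F₁_continuousAt ht).add
    (hE.G_continuousAt t)))).sub (by fun_prop)

lemma surv₂_continuousAt (hE : B.IsEquilibrium S₁ S₂) {t : ℝ} (ht : 0 < t) :
    ContinuousAt (B.surv₂ S₂) t :=
  continuousAt_const.sub (continuousAt_const.mul (hE.F₂_continuousAt ht))

lemma F₂_hasDerivAt (hE : B.IsEquilibrium S₁ S₂) {b : ℝ} (hb : ∀ t, t < b → S₂.F t < 1) :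
    ∀ t ∈ Ioo 0 b, HasDerivAt S₂.F (B.lam₂ / (1 - B.z₂) * B.surv₂ S₂ t) t :=
  S₂.isSubCDF.hasDerivAt_of_waitGain (B.isSurvival_surv₂ S₂) B.z₂_mem.2
    (fun _ ht => hE.F₂_continuousAt ht.1) (fun _ ht => hE.surv₂_continuousAt ht.1)
    (fun t ht => (hE.indifferent ht.1 (hb t ht.2)).1)

lemma F₁_hasDerivAt (hE : B.IsEquilibrium S₁ S₂) {b : ℝ} (hb : ∀ t, t < b → S₂.F t < 1) :
    ∀ t ∈ Ioo 0 b, HasDerivAt S₁.F (B.lam₁ / (1 - B.z₁) * B.surv₁ S₁ t) t :=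
  S₁.isSubCDF_F.hasDerivAt_of_waitGain (B.isSurvival_surv₁ S₁) B.z₁_mem.2
    (fun _ ht => hE.F₁_continuousAt ht.1) (fun _ ht => hE.surv₁_continuousAt ht.1)
    (fun t ht => (hE.indifferent ht.1 (hb t ht.2)).2)

lemma surv₂_mul_exp (hE : B.IsEquilibrium S₁ S₂) {s b : ℝ} (hs : 0 ≤ s) (hsb : s ≤ b)
    (hb : ∀ t, t < b → S₂.F t < 1) :
    B.surv₂ S₂ b * Real.exp (B.lam₂ * b) = B.surv₂ S₂ s * Real.exp (B.lam₂ * s) := by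
  have hz : 1 - B.z₂ ≠ 0 := by linarith [B.z₂_mem.2]
  refine eq_of_hasDerivAt_zero (f := fun t => B.surv₂ S₂ t * Real.exp (B.lam₂ * t)) hsb ?_ ?_
  · refine ContinuousOn.mul (fun x hx => ?_) (by fun_prop)
    rcases (hs.trans hx.1).eq_or_lt with rfl | h0
    · have : ContinuousWithinAt S₂.F (Icc s b) 0 :=
        (S₂.F.right_continuous 0).mono fun y hy => hs.trans hy.1
      exact continuousWithinAt_const.sub (continuousWithinAt_const.mul this)
    · exact (hE.surv₂_continuousAt h0).continuousWithinAt
  · intro x hx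
    have h1 := hE.F₂_hasDerivAt hb x ⟨hs.trans_lt hx.1, hx.2⟩
    have h2 := ((h1.const_mul (1 - B.z₂)).const_sub 1).mul (hasDerivAt_exp_const_mul B.lam₂ x)
    refine h2.congr_deriv ?_
    rw [surv₂]
    field_simp
    ring

/-- Perpetual indifference would make player 2's survival probability decay exponentially to 0, but
it never falls below `z₂`. -/
lemma exists_terminal (hE : B.IsEquilibrium S₁ S₂) :
    ∃ T, 0 < T ∧ S₂.F T = 1 ∧ ∀ t, t < T → S₂.F t < 1 := by
  have hne : {t | S₂.F t = 1}.Nonempty := by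
    by_contra hempty
    rw [Set.not_nonempty_iff_eq_empty] at hempty
    have hlt : ∀ t, S₂.F t < 1 := fun t => lt_of_le_of_ne (S₂.F_le_one t) fun h => by
      have : t ∈ {t | S₂.F t = 1} := h
      rw [hempty] at this
      exact this
    have hlim : Tendsto (fun t => Real.exp (B.lam₂ * t)) atTop atTop :=
      Real.tendsto_exp_atTop.comp (tendsto_id.const_mul_atTop B.lam₂_pos)
    obtain ⟨b, hb, hb0⟩ := ((hlim.eventually_gt_atTop (1 / B.z₂)).and
      (eventually_ge_atTop 0)).exists
    have h1 := hE.surv₂_mul_exp le_rfl hb0 fun t _ => hlt t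
    have h2 := (B.isSurvival_surv₂ S₂).le_one 0 le_rfl
    have h3 : B.z₂ ≤ B.surv₂ S₂ b := by
      have := mul_le_mul_of_nonneg_left (S₂.F_le_one b) (by linarith [B.z₂_mem.2] : 0 ≤ 1 - B.z₂)
      rw [surv₂]; linarith
    rw [div_lt_iff₀ B.z₂_mem.1] at hb
    have h4 := mul_le_mul_of_nonneg_right h3 (Real.exp_pos (B.lam₂ * b)).le
    simp at h1
    linarith
  have hpos : ∀ t ∈ {t | S₂.F t = 1}, 0 ≤ t := fun t ht => by
    by_contra hneg
    push Not at hneg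
    have ht' : S₂.F t = 1 := ht
    rw [S₂.F_neg t hneg] at ht'
    exact zero_ne_one ht'
  have hbdd : BddBelow {t | S₂.F t = 1} := ⟨0, hpos⟩
  set T := sInf {t | S₂.F t = 1} with hT
  have hgt : ∀ t, T < t → S₂.F t = 1 := fun t ht => by
    obtain ⟨u, hu, hut⟩ := exists_lt_of_csInf_lt hne ht
    have hu' : S₂.F u = 1 := hu
    exact le_antisymm (S₂.F_le_one t) (hu' ▸ S₂.F.mono hut.le)
  have hFT : S₂.F T = 1 := by
    have h1 : Tendsto S₂.F (𝓝[>] T) (𝓝 (S₂.F T)) :=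
      (S₂.F.right_continuous T).tendsto.mono_left (nhdsWithin_mono _ Ioi_subset_Ici_self)
    refine tendsto_nhds_unique h1 (tendsto_const_nhds.congr' ?_)
    filter_upwards [self_mem_nhdsWithin] with t ht using (hgt t ht).symm
  refine ⟨T, lt_of_le_of_ne (hpos T hFT) fun h => ?_, hFT, fun t ht => ?_⟩
  · rw [← h] at hFT
    exact hE.F₂_zero_lt_one.ne hFT
  · exact lt_of_le_of_ne (S₂.F_le_one t) fun h => not_lt.2 (csInf_le hbdd h) ht

lemma surv₂_eq (hE : B.IsEquilibrium S₁ S₂) {T : ℝ} (hFT : S₂.F T = 1)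
    (hT : ∀ t, t < T → S₂.F t < 1) {t : ℝ} (ht : 0 ≤ t) (htT : t ≤ T) :
    B.surv₂ S₂ t = B.z₂ * Real.exp (B.lam₂ * (T - t)) := by
  have h1 := hE.surv₂_mul_exp ht htT hT
  have h2 : B.surv₂ S₂ T = B.z₂ := by rw [surv₂, hFT]; ring
  have h3 : Real.exp (B.lam₂ * T) = Real.exp (B.lam₂ * (T - t)) * Real.exp (B.lam₂ * t) := by
    rw [← Real.exp_add]; congr 1; ring
  rw [h2, h3, ← mul_assoc] at h1
  exact (mul_right_cancel₀ (Real.exp_pos _).ne' h1).symm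

lemma F₂_eq_one {T : ℝ} (hFT : S₂.F T = 1) {t : ℝ} (ht : T ≤ t) : S₂.F t = 1 :=
  le_antisymm (S₂.F_le_one t) (hFT ▸ S₂.F.mono ht)

lemma F₁_const (hE : B.IsEquilibrium S₁ S₂) {T : ℝ} (hT0 : 0 < T) (hFT : S₂.F T = 1) {t : ℝ}
    (ht : T ≤ t) : S₁.F t = S₁.F T :=
  hE.optimal_wait₁.eq_of_lt ht fun u hu => by
    obtain ⟨v, h1, h2⟩ := exists_between hu.1
    exact ((B.isWaitGain₁ S₂).lt_of_const T v u hT0.le h1 h2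
      (by rw [hFT, F₂_eq_one hFT hu.1.le])).trans_le (hE.optimal_wait₁.le v (hT0.le.trans h1.le))

lemma chalGain_nonpos (hE : B.IsEquilibrium S₁ S₂) {t : ℝ} (ht : 0 < t) (h : S₂.F t < 1) :
    B.chalGain S₂ t ≤ 0 := by
  have h1 := hE.V₁_le ht.le
  rw [B.V₁_eq S₂ ht.le, (hE.indifferent ht h).1, (IsSubCDF.continuousAt_iff _ _).1
    (hE.F₂_continuousAt ht), sub_self, zero_mul, mul_zero, zero_div, add_zero,
    mul_div_cancel₀ _ B.D_pos.ne'] at h1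
  have h2 : (Real.exp (-B.r₁ * t) * B.D) * B.chalGain S₂ t ≤ 0 := by linarith
  by_contra hpos
  push Not at hpos
  linarith [mul_pos (mul_pos (Real.exp_pos (-B.r₁ * t)) B.D_pos) hpos]

/-- Past `stopTime` the break-even yielding probability exceeds one; past `T` only a justified
player 2 is left. -/
lemma chalGain_neg (hE : B.IsEquilibrium S₁ S₂) {T : ℝ} (hFT : S₂.F T = 1)
    (hT : ∀ t, t < T → S₂.F t < 1) {t : ℝ} (ht : B.stopTime T < t) : B.chalGain S₂ t < 0 := by
  have ht0 : 0 < t := (B.stopTime_nonneg T).trans_lt ht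
  rcases lt_or_ge t T with htT | htT
  · have h1 := hE.surv₂_eq hFT hT ht0.le htT.le
    by_contra hneg
    push Not at hneg
    rw [B.chalGain_nonneg_iff htT h1] at hneg
    have h2 := B.strictMono_yieldSol ((le_max_left _ _).trans_lt ht) htT
    rw [B.yieldSol_sub_tN] at h2
    linarith [(S₂.q_mem t).2]
  · by_contra hneg
    push Not at hneg
    exact (B.of_chalGain_nonneg S₂ hneg).2.ne (F₂_eq_one hFT htT)

lemma ae_G_le (hE : B.IsEquilibrium S₁ S₂) {T : ℝ} (hFT : S₂.F T = 1)
    (hT : ∀ t, t < T → S₂.F t < 1) : ∀ᵐ t ∂S₁.G.measure, t ≤ B.stopTime T := by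
  filter_upwards [hE.challenge_ae] with t h1
  by_contra hlt
  push Not at hlt
  linarith [hE.chalGain_neg hFT hT hlt]

lemma G_const (hE : B.IsEquilibrium S₁ S₂) {T : ℝ} (hFT : S₂.F T = 1)
    (hT : ∀ t, t < T → S₂.F t < 1) {t : ℝ} (ht : B.stopTime T ≤ t) :
    S₁.G t = S₁.G (B.stopTime T) := by
  have h0 : S₁.G.measure (Ioc (B.stopTime T) t) = 0 :=
    measure_mono_null (fun u hu => not_le.2 hu.1) (ae_iff.1 (hE.ae_G_le hFT hT))
  rw [S₁.G.measure_Ioc, ENNReal.ofReal_eq_zero] at h0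
  linarith [S₁.G.mono ht]

lemma F_add_G_terminal (hE : B.IsEquilibrium S₁ S₂) {T : ℝ} (hT0 : 0 < T) (hFT : S₂.F T = 1)
    (hT : ∀ t, t < T → S₂.F t < 1) : S₁.F T + S₁.G T = 1 := by
  have h1 := S₁.isSubCDF_F.tendsto_atTop.add S₁.isSubCDF_G.tendsto_atTop
  rw [hE.optimal₁.1] at h1
  refine tendsto_nhds_unique (tendsto_const_nhds.congr' ?_) h1
  filter_upwards [eventually_ge_atTop T] with t ht
  rw [hE.F₁_const hT0 hFT ht, hE.G_const hFT hT ((B.stopTime_lt hT0).le.trans ht),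
    hE.G_const hFT hT (B.stopTime_lt hT0).le]

lemma q_le_yieldSol (hE : B.IsEquilibrium S₁ S₂) {T : ℝ} (hFT : S₂.F T = 1)
    (hT : ∀ t, t < T → S₂.F t < 1) {t : ℝ} (ht : 0 < t) (htT : t < T) :
    S₂.q t ≤ B.yieldSol T t :=
  (B.chalGain_nonpos_iff htT (hE.surv₂_eq hFT hT ht.le htT.le)).1 (hE.chalGain_nonpos ht (hT t htT))

end IsEquilibrium

end BargainingGame

/-! ### Equilibria: player 1's challenges, concessions, and the responses -/

namespace BargainingGame

variable {B : BargainingGame} {S₁ : StrategyOne} {S₂ : StrategyTwo}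

lemma seeL_indicator {t τ : ℝ} (ht : t ≤ τ) (ht0 : 0 ≤ t) (c : ℝ) :
    B.seeL ((Ioo 0 t).indicator fun _ => c) τ
      = c * ∫ s in 0..t, Real.exp (-B.r₂ * s) * (B.γ₁ * Real.exp (-B.γ₁ * s)) := by
  have h1 : ∀ s, (Ioo 0 t).indicator (fun _ => c) s
      * (Real.exp (-B.r₂ * s) * (B.γ₁ * Real.exp (-B.γ₁ * s)))
      = (Ioo 0 t).indicator
        (fun s => c * (Real.exp (-B.r₂ * s) * (B.γ₁ * Real.exp (-B.γ₁ * s)))) s := fun s => by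
    by_cases h : s ∈ Ioo 0 t <;> simp [h]
  have hsub : Ioo 0 t ⊆ Ico 0 τ := fun s hs => ⟨hs.1.le, hs.2.trans_le ht⟩
  rw [seeL]
  simp_rw [h1]
  rw [setIntegral_indicator measurableSet_Ioo, inter_eq_right.2 hsub, integral_const_mul,
    intervalIntegral.integral_of_le ht0, integral_Ioc_eq_integral_Ioo]

lemma seeG_indicator {t τ : ℝ} (ht : t ≤ τ) (hG : ∀ t, ContinuousAt S₁.G t) (c : ℝ) :
    B.seeG S₁ ((Ioo 0 t).indicator fun _ => c) τ = c * discHalf S₁.G B.r₂ t := by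
  have h1 : ∀ s, (Ioo 0 t).indicator (fun _ => c) s * Real.exp (-B.r₂ * s)
      = (Ioo 0 t).indicator (fun s => c * Real.exp (-B.r₂ * s)) s := fun s => by
    by_cases h : s ∈ Ioo 0 t <;> simp [h]
  have hnull : S₁.G.measure {0} = 0 := by
    rw [S₁.G.measure_singleton, (IsSubCDF.continuousAt_iff _ _).1 (hG 0)]; simp
  have hae : Ioo 0 t =ᵐ[S₁.G.measure] Ico 0 t := by
    have : ∀ᵐ s ∂S₁.G.measure, s ≠ 0 := by rw [ae_iff]; simpa using hnull
    filter_upwards [this] with s hs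
    refine propext ⟨fun h => ⟨h.1.le, h.2⟩, fun h => ⟨lt_of_le_of_ne h.1 hs.symm, h.2⟩⟩
  have hsub : Ioo 0 t ⊆ Ico 0 τ := fun s hs => ⟨hs.1.le, hs.2.trans_le ht⟩
  rw [seeG]
  simp_rw [h1]
  rw [setIntegral_indicator measurableSet_Ioo, inter_eq_right.2 hsub, integral_const_mul, setIntegral_congr_set hae,
    discHalf, (IsSubCDF.continuousAt_iff _ _).1 (hG t)]
  ring

lemma yieldSol_nonneg {T t : ℝ} (ht : t < T) : 0 ≤ B.yieldSol T t := by
  have hw := B.one_sub_w₁_pos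
  have h0 := B.w₁_nonneg
  have h1 : Real.exp (-B.lam₂ * (T - t)) < 1 := by
    rw [Real.exp_lt_one_iff]; nlinarith [B.lam₂_pos]
  have h2 := Real.exp_pos (-B.lam₂ * (T - t))
  refine mul_nonneg (one_div_pos.2 hw).le (sub_nonneg.2 ?_)
  rw [le_div_iff₀ (by linarith)]
  nlinarith [B.c₁_mem.1]

lemma yieldSol_lt_one {T t : ℝ} (ht : t < T - B.tN) : B.yieldSol T t < 1 := by
  rw [← B.yieldSol_sub_tN T]
  exact B.strictMono_yieldSol ht (by linarith [B.tN_pos])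

lemma z₁_mul_k₂ : B.z₁ * B.k₂ = B.alpha * (B.z₁ / (1 - B.z₁) * B.kap) := by
  have h1 : 1 - B.z₁ ≠ 0 := by linarith [B.z₁_mem.2]
  have h2 : 1 - B.w₁ - B.k₂ ≠ 0 := by linarith [B.k₂_mem.2]
  rw [alpha, kap]; field_simp

lemma lt_of_lt_stopTime {T t : ℝ} (ht0 : 0 ≤ t) (ht : t < B.stopTime T) : t < T - B.tN := by
  rcases le_max_iff.1 (show B.stopTime T ≤ max (T - B.tN) 0 from le_rfl) with h | h
  · exact ht.trans_le h
  · linarith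

namespace IsEquilibrium

/-- Yielding less bounds the discounted challenges of an unjustified player 1 from above, yielding
more bounds them from below. The second deviation is available because `q ≤ yieldSol < 1` on this
range. -/
lemma discHalf_G (hE : B.IsEquilibrium S₁ S₂) {T : ℝ} (hT0 : 0 < T) (hFT : S₂.F T = 1)
    (hT : ∀ t, t < T → S₂.F t < 1) {t : ℝ} (ht : t ∈ Ioo 0 (B.stopTime T)) :
    discHalf S₁.G B.r₂ t = (B.z₁ / (1 - B.z₁) * B.kap)
      * ∫ s in 0..t, Real.exp (-B.r₂ * s) * (B.γ₁ * Real.exp (-B.γ₁ * s)) := by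
  have htT : t < T := ht.2.trans (B.stopTime_lt hT0)
  obtain ⟨τ, hτ, hτ0, hopt⟩ := hE.exists_optimal_gt ht.1.le (hT t htT)
  have h1 := hE.seeG_le_seeL hτ0 hopt (ψ := (Ioo 0 t).indicator fun _ => 1)
    (measurable_const.indicator measurableSet_Ioo) fun s => by
      by_cases h : s ∈ Ioo 0 t <;> simp [h]
  have hy := B.yieldSol_lt_one (lt_of_lt_stopTime ht.1.le ht.2)
  have hy0 := B.yieldSol_nonneg htT
  -- A constant increase is admissible on all of `(0, t)`: there `q s ≤ yieldSol T s < yieldSol T t`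
  -- by monotonicity.
  have h2 := hE.seeL_le_seeG hτ0 hopt (ψ := (Ioo 0 t).indicator fun _ => 1 - B.yieldSol T t)
    (measurable_const.indicator measurableSet_Ioo) fun s => by
      have hq := S₂.q_mem s
      by_cases h : s ∈ Ioo 0 t
      · have h3 := hE.q_le_yieldSol hFT hT h.1 (h.2.trans htT)
        have h4 := B.strictMono_yieldSol h.2 htT
        simp only [h, indicator_of_mem]
        constructor <;> linarith
      · simpa [h] using hq
  rw [seeL_indicator hτ.le ht.1.le, seeG_indicator hτ.le hE.G_continuousAt, z₁_mul_k₂]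
    at h1 h2
  have hα := B.alpha_pos
  refine le_antisymm ?_ ?_
  · refine le_of_mul_le_mul_left ?_ hα
    linarith
  · refine le_of_mul_le_mul_left (a := B.alpha * (1 - B.yieldSol T t)) ?_
      (mul_pos hα (by linarith))
    linarith

lemma G_eq (hE : B.IsEquilibrium S₁ S₂) {T : ℝ} (hT0 : 0 < T) (hFT : S₂.F T = 1)
    (hT : ∀ t, t < T → S₂.F t < 1) {t : ℝ} (ht : 0 ≤ t) : S₁.G t = B.chalSol T t := by
  have hG0 : S₁.G 0 = 0 := by
    rw [← (IsSubCDF.continuousAt_iff _ _).1 (hE.G_continuousAt 0),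
      S₁.isSubCDF_G.leftLim_of_nonpos le_rfl]
  have hle : ∀ t, 0 ≤ t → t ≤ B.stopTime T → S₁.G t = B.chalSol T t := by
    intro t ht htp
    have hd := S₁.isSubCDF_G.hasDerivAt_of_discHalf (r := B.r₂) (b := B.stopTime T) (C := 0)
      (p := fun s => (B.z₁ / (1 - B.z₁) * B.kap) * (B.γ₁ * Real.exp (-B.γ₁ * s)))
      (by fun_prop) (fun s _ => hE.G_continuousAt s) (fun s _ => by fun_prop)
      (fun s => Continuous.intervalIntegrable (by fun_prop) _ _) fun s hs => by
        rw [hE.discHalf_G hT0 hFT hT hs, zero_add, ← intervalIntegral.integral_const_mul]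
        congr 1; ext u; ring
    have h := eq_of_hasDerivAt_zero (f := fun s => S₁.G s
      - (B.z₁ / (1 - B.z₁) * B.kap) * (1 - Real.exp (-B.γ₁ * s))) ht
      (ContinuousOn.sub (fun s _ => (hE.G_continuousAt s).continuousWithinAt) (by fun_prop))
      fun s hs => by
        have h1 := (hd s ⟨hs.1, hs.2.trans_le htp⟩).sub
          (((hasDerivAt_exp_const_mul (-B.γ₁) s).const_sub 1).const_mul
            (B.z₁ / (1 - B.z₁) * B.kap))
        exact h1.congr_deriv (by ring)
    simp [hG0] at h
    rw [chalSol, min_eq_left htp, neg_mul]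
    linarith
  rcases le_total t (B.stopTime T) with h | h
  · exact hle t ht h
  · rw [hE.G_const hFT hT h, hle _ (B.stopTime_nonneg T) le_rfl, chalSol, chalSol, min_self,
      min_eq_right h]

/-- The difference between the actual and the closed-form survival probability solves `d' = -lam₁ *
d`, because challenges agree by `G_eq`. It vanishes at `T`, where unjustified player 1 has acted
with certainty, hence everywhere on `[0, T]`. -/
lemma surv₁_eq (hE : B.IsEquilibrium S₁ S₂) {T : ℝ} (hT0 : 0 < T) (hFT : S₂.F T = 1)
    (hT : ∀ t, t < T → S₂.F t < 1) {t : ℝ} (ht : 0 ≤ t) (htT : t ≤ T) :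
    B.surv₁ S₁ t = B.survSol₁ T t := by
  have hz : 1 - B.z₁ ≠ 0 := by linarith [B.z₁_mem.2]
  have hdiff : ∀ t, 0 ≤ t → B.surv₁ S₁ t - B.survSol₁ T t
      = 1 - (1 - B.z₁) * S₁.F t - B.nonConcSol T t := fun t ht => by
    rw [surv₁, hE.G_eq hT0 hFT hT ht, nonConcSol]; ring
  have hend : 1 - (1 - B.z₁) * S₁.F T - B.nonConcSol T T = 0 := by
    have h := hE.F_add_G_terminal hT0 hFT hT
    rw [← hdiff T hT0.le, surv₁, h, survSol₁, sub_self, invRep_zero]; ring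
  have h := eq_of_hasDerivAt_zero (f := fun t => (1 - (1 - B.z₁) * S₁.F t - B.nonConcSol T t)
    * Real.exp (B.lam₁ * t)) htT ?_ ?_
  · rw [hend, zero_mul, eq_comm, mul_eq_zero, or_iff_left (Real.exp_pos _).ne', ← hdiff t ht] at h
    linarith
  · refine ContinuousOn.mul (ContinuousOn.sub (fun x hx => ?_)
      (B.continuous_nonConcSol T).continuousOn) (by fun_prop)
    rcases (ht.trans hx.1).eq_or_lt with rfl | h0
    · have : ContinuousWithinAt S₁.F (Icc t T) 0 :=
        (S₁.F.right_continuous 0).mono fun y hy => ht.trans hy.1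
      exact continuousWithinAt_const.sub (continuousWithinAt_const.mul this)
    · exact (continuousAt_const.sub
        (continuousAt_const.mul (hE.F₁_continuousAt h0))).continuousWithinAt
  · intro x hx
    have hx0 := ht.trans_lt hx.1
    have h1 := hE.F₁_hasDerivAt hT x ⟨hx0, hx.2⟩
    have h2 := (((h1.const_mul (1 - B.z₁)).const_sub 1).sub (B.hasDerivAt_nonConcSol T hx0)).mul
      (hasDerivAt_exp_const_mul B.lam₁ x)
    refine h2.congr_deriv ?_
    have h3 := hdiff x hx0.le
    simp only [Pi.sub_apply]
    field_simp
    linear_combination (-B.lam₁ * Real.exp (B.lam₁ * x)) * h3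

/-- Every equilibrium has the closed form. -/
theorem exists_isSolution (hE : B.IsEquilibrium S₁ S₂) : ∃ T, B.IsSolution T S₁ S₂ := by
  obtain ⟨T, hT0, hFT, hT⟩ := hE.exists_terminal
  have h1 : B.surv₁ S₁ 0 = B.z₁ * B.invRep T := by
    rw [hE.surv₁_eq hT0 hFT hT le_rfl hT0.le, survSol₁]; simp
  have h2 := hE.surv₂_eq hFT hT le_rfl hT0.le
  have hG0 : S₁.G 0 = 0 := by
    rw [hE.G_eq hT0 hFT hT le_rfl, chalSol, min_eq_left (B.stopTime_nonneg T)]; simp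
  have h1' : B.surv₁ S₁ 0 = 1 - (1 - B.z₁) * S₁.F 0 := by rw [surv₁, hG0]; simp
  have hexp : Real.exp (B.lam₂ * (T - 0)) * Real.exp (-B.lam₂ * T) = 1 := by
    rw [← Real.exp_add]; simp
  have hz1 := B.z₁_mem.1
  refine ⟨T, ⟨hT0, ?_, ?_, ?_⟩, fun t ht htT => hE.surv₁_eq hT0 hFT hT ht htT,
    fun t ht htT => hE.surv₂_eq hFT hT ht htT, fun t ht => hE.G_eq hT0 hFT hT ht,
    fun t ht => hE.F₁_const hT0 hFT ht, fun t ht => F₂_eq_one hFT ht⟩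
  · have h3 := (B.isSurvival_surv₁ S₁).le_one 0 le_rfl
    rw [h1] at h3
    rw [le_div_iff₀ hz1]; linarith
  · have h3 := (B.isSurvival_surv₂ S₂).le_one 0 le_rfl
    rw [h2] at h3
    have := mul_le_mul_of_nonneg_right h3 (Real.exp_pos (-B.lam₂ * T)).le
    rw [mul_assoc, hexp] at this
    linarith
  -- A player without an atom at 0 has a path that starts exactly at the prior, and by
  -- `war_atom_zero` at least one player has none.
  · rcases (S₂.isSubCDF.nonneg 0).eq_or_lt with h0 | h0
    · right
      rw [surv₂, ← h0, mul_zero, sub_zero] at h2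
      linear_combination Real.exp (-B.lam₂ * T) * h2 + B.z₂ * hexp
    · left
      have h3 := war_atom_zero (B.isWaitGain₁ S₂) hE.optimal_wait₁ S₁.isSubCDF_F S₂.isSubCDF h0
      rw [eq_div_iff hz1.ne', mul_comm, ← h1, h1', h3]; ring

/-- Where `q` is below `yieldSol` a challenge does not pay, so all challenges there are justified.
Player 2 would gain by yielding more on that set unless it is null, justified challenges having a
positive density. -/
lemma ae_q_of_lt_stopTime (hE : B.IsEquilibrium S₁ S₂) (hγ : 0 < B.γ₁) {T : ℝ} (hT0 : 0 < T)
    (hFT : S₂.F T = 1) (hT : ∀ t, t < T → S₂.F t < 1) :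
    ∀ᵐ t : ℝ, t ∈ Ioo 0 (B.stopTime T) → S₂.q t = B.yieldSol T t := by
  obtain ⟨τ, hτ, hτ0, hopt⟩ := hE.exists_optimal_gt (B.stopTime_nonneg T)
    (hT _ (B.stopTime_lt hT0))
  have hym := B.measurable_yieldSol T
  set A : Set ℝ := {s | S₂.q s < B.yieldSol T s} ∩ Ioo 0 (B.stopTime T) with hA
  have hAm : MeasurableSet A := (measurableSet_lt S₂.q_measurable hym).inter measurableSet_Ioo
  have hmem : ∀ s, s ∈ A ↔ S₂.q s < B.yieldSol T s ∧ s ∈ Ioo 0 (B.stopTime T) := fun s => by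
    simp [hA]
  set ψ : ℝ → ℝ := A.indicator fun s => 1 - B.yieldSol T s with hψ
  have hψm : Measurable ψ := (measurable_const.sub hym).indicator hAm
  have hy : ∀ s ∈ Ioo 0 (B.stopTime T), 0 ≤ B.yieldSol T s ∧ B.yieldSol T s < 1 := fun s hs =>
    ⟨B.yieldSol_nonneg (hs.2.trans (B.stopTime_lt hT0)),
      B.yieldSol_lt_one (lt_of_lt_stopTime hs.1.le hs.2)⟩
  have h1 := hE.seeL_le_seeG hτ0 hopt hψm fun s => by
    have hq := S₂.q_mem s
    by_cases h : s ∈ A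
    · have h3 : ψ s = 1 - B.yieldSol T s := indicator_of_mem h _
      have h4 := hy s ((hmem s).1 h).2
      have h5 := ((hmem s).1 h).1
      rw [h3]; constructor <;> linarith
    · have h3 : ψ s = 0 := indicator_of_notMem h _
      simpa [h3] using hq
  have hG : B.seeG S₁ ψ τ = 0 := by
    rw [seeG, integral_eq_zero_of_ae]
    refine ae_restrict_of_ae ?_
    filter_upwards [hE.challenge_ae] with s hs
    have h3 : ψ s = 0 := by
      refine indicator_of_notMem (fun h => ?_) _
      obtain ⟨h4, h5⟩ := (hmem s).1 h
      have hsT := h5.2.trans (B.stopTime_lt hT0)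
      rw [B.chalGain_nonneg_iff hsT (hE.surv₂_eq hFT hT h5.1.le hsT.le)] at hs
      linarith
    simp [h3]
  have hψ0 : ∀ s, 0 ≤ ψ s ∧ ψ s ≤ 1 := fun s => by
    by_cases h : s ∈ A
    · have h3 : ψ s = 1 - B.yieldSol T s := indicator_of_mem h _
      have h4 := hy s ((hmem s).1 h).2
      rw [h3]; constructor <;> linarith
    · have h3 : ψ s = 0 := indicator_of_notMem h _
      simp [h3]
  have hw : ∀ s, 0 < Real.exp (-B.r₂ * s) * (B.γ₁ * Real.exp (-B.γ₁ * s)) := fun s => by positivity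
  have hLn : 0 ≤ B.seeL ψ τ := integral_nonneg fun s => mul_nonneg (hψ0 s).1 (hw s).le
  have hL : B.seeL ψ τ = 0 := by
    rw [hG, mul_zero] at h1
    have h2 := mul_pos B.z₁_mem.1 B.k₂_mem.1
    exact le_antisymm (by by_contra hlt; push Not at hlt; linarith [mul_pos h2 hlt]) hLn
  rw [seeL, integral_eq_zero_iff_of_nonneg (fun s => mul_nonneg (hψ0 s).1 (hw s).le)
    (integrableOn_bdd_mul (C := 1) hψm (fun s => abs_le.2 ⟨by linarith [hψ0 s], (hψ0 s).2⟩)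
      (by fun_prop) τ)] at hL
  have hL' := (ae_restrict_iff' measurableSet_Ico).1 hL
  filter_upwards [hL'] with s hs hs'
  have hsT := hs'.2.trans (B.stopTime_lt hT0)
  refine le_antisymm (hE.q_le_yieldSol hFT hT hs'.1 hsT) ?_
  by_contra hlt
  push Not at hlt
  have h3 : ψ s = 1 - B.yieldSol T s := indicator_of_mem ((hmem s).2 ⟨hlt, hs'⟩) _
  have h4 := hs ⟨hs'.1.le, hs'.2.trans hτ⟩
  have h5 := (hy s hs').2
  rw [Pi.zero_apply, h3, mul_eq_zero, or_iff_left (hw s).ne'] at h4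
  linarith

/-- After `stopTime` only justified players challenge, and seeing a justified challenge is a pure
loss. -/
lemma ae_q_of_stopTime_lt (hE : B.IsEquilibrium S₁ S₂) (hγ : 0 < B.γ₁) {T : ℝ} (hT0 : 0 < T)
    (hFT : S₂.F T = 1) (hT : ∀ t, t < T → S₂.F t < 1) :
    ∀ᵐ t : ℝ, t ∈ Ioo (B.stopTime T) T → S₂.q t = 1 := by
  have hstep : ∀ b, 0 ≤ b → b < T → ∀ᵐ t : ℝ, t ∈ Ioo (B.stopTime T) b → S₂.q t = 1 := by
    intro b hb0 hb
    obtain ⟨τ, hτ, hτ0, hopt⟩ := hE.exists_optimal_gt hb0 (hT b hb)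
    set ψ : ℝ → ℝ := (Ioi (B.stopTime T)).indicator fun s => 1 - S₂.q s with hψ
    have hψm : Measurable ψ := (S₂.q_measurable.const_sub 1).indicator measurableSet_Ioi
    have hψ0 : ∀ s, 0 ≤ ψ s ∧ S₂.q s + ψ s ≤ 1 := fun s => by
      have hq := S₂.q_mem s
      by_cases h : s ∈ Ioi (B.stopTime T)
      · have h3 : ψ s = 1 - S₂.q s := indicator_of_mem h _
        rw [h3]; constructor <;> linarith
      · have h3 : ψ s = 0 := indicator_of_notMem h _
        rw [h3]; constructor <;> linarith
    have h1 := hE.seeL_le_seeG hτ0 hopt hψm fun s =>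
      ⟨by linarith [(hψ0 s).1, (S₂.q_mem s).1], (hψ0 s).2⟩
    have hG : B.seeG S₁ ψ τ = 0 := by
      rw [seeG, integral_eq_zero_of_ae]
      refine ae_restrict_of_ae ?_
      filter_upwards [hE.ae_G_le hFT hT] with s hs
      have h3 : ψ s = 0 := indicator_of_notMem (fun h => not_lt.2 hs h) _
      simp [h3]
    have hw : ∀ s, 0 < Real.exp (-B.r₂ * s) * (B.γ₁ * Real.exp (-B.γ₁ * s)) :=
      fun s => by positivity
    have hLn : 0 ≤ B.seeL ψ τ := integral_nonneg fun s => mul_nonneg (hψ0 s).1 (hw s).le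
    have hL : B.seeL ψ τ = 0 := by
      rw [hG, mul_zero] at h1
      have h2 := mul_pos B.z₁_mem.1 B.k₂_mem.1
      exact le_antisymm (by by_contra hlt; push Not at hlt; linarith [mul_pos h2 hlt]) hLn
    rw [seeL, integral_eq_zero_iff_of_nonneg (fun s => mul_nonneg (hψ0 s).1 (hw s).le)
      (integrableOn_bdd_mul (C := 1) hψm (fun s => abs_le.2
        ⟨by linarith [hψ0 s], by linarith [(hψ0 s).2, (S₂.q_mem s).1]⟩) (by fun_prop) τ)] at hL
    have hL' := (ae_restrict_iff' measurableSet_Ico).1 hL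
    filter_upwards [hL'] with s hs hs'
    have h3 : ψ s = 1 - S₂.q s := indicator_of_mem (show s ∈ Ioi _ from hs'.1) _
    have h4 := hs ⟨(B.stopTime_nonneg T).trans hs'.1.le, hs'.2.trans hτ⟩
    rw [Pi.zero_apply, h3, mul_eq_zero, or_iff_left (hw s).ne'] at h4
    linarith
  -- The deviation is tested only before an optimal concession time, which is known to exist beyond
  -- each `b < T`; a countable union then exhausts the interval.
  have hall : ∀ n : ℕ, ∀ᵐ t : ℝ, t ∈ Ioo (B.stopTime T) (max 0 (T - 1 / (n + 1))) → S₂.q t = 1 :=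
    fun n => hstep _ (le_max_left _ _) (max_lt hT0 (by
      have : (0 : ℝ) < 1 / (n + 1) := by positivity
      linarith))
  filter_upwards [ae_all_iff.2 hall] with t ht ht'
  obtain ⟨n, hn⟩ := exists_nat_one_div_lt (sub_pos.2 ht'.2)
  exact ht n ⟨ht'.1, lt_max_of_lt_right (by linarith)⟩

end IsEquilibrium

end BargainingGame

/-! ### Hazard rates, densities, reputations and initial atoms -/

/-- Right derivatives are used because the densities may jump at `T - tN` and at `T`. Nonnegativity
supplies integrability. -/
lemma hasAtomAndDensity_of_hasDerivWithinAt {F f : ℝ → ℝ} (hc : ContinuousOn F (Ici 0))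
    (hd : ∀ x, 0 < x → HasDerivWithinAt F (f x) (Ioi x) x) (hf : ∀ x, 0 < x → 0 ≤ f x) :
    HasAtomAndDensity F f := by
  intro t ht
  have hc' : ContinuousOn F (Icc 0 t) := hc.mono Icc_subset_Ici_self
  have hi : IntervalIntegrable f volume 0 t := by
    rw [intervalIntegrable_iff_integrableOn_Ioc_of_le ht]
    exact intervalIntegral.integrableOn_deriv_right_of_nonneg hc' (fun x hx => hd x hx.1)
      fun x hx => hf x hx.1
  refine ⟨hi, ?_⟩
  rw [intervalIntegral.integral_eq_sub_of_hasDeriv_right_of_le ht hc' (fun x hx => hd x hx.1) hi]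
  ring

/-- The hazard rate is the right derivative of `-log S`, and its nonnegativity makes it integrable.
This recovers the survival function from hazard rates with jumps. -/
lemma mul_exp_neg_integral {S k : ℝ → ℝ} {t : ℝ} (ht : 0 ≤ t) (hc : ContinuousOn S (Icc 0 t))
    (hpos : ∀ x ∈ Icc 0 t, 0 < S x) (hk : ∀ x ∈ Ioo 0 t, 0 ≤ k x)
    (hd : ∀ x ∈ Ioo 0 t, HasDerivWithinAt S (-(k x * S x)) (Ioi x) x) :
    S 0 * Real.exp (-∫ x in 0..t, k x) = S t := by
  have hcl : ContinuousOn (fun x => -Real.log (S x)) (Icc 0 t) :=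
    (hc.log fun x hx => (hpos x hx).ne').neg
  have hdl : ∀ x ∈ Ioo 0 t, HasDerivWithinAt (fun x => -Real.log (S x)) (k x) (Ioi x) x := by
    intro x hx
    have h0 := (hpos x (Ioo_subset_Icc_self hx)).ne'
    refine ((hd x hx).log h0).neg.congr_deriv ?_
    field_simp
  have hi : IntervalIntegrable k volume 0 t := by
    rw [intervalIntegrable_iff_integrableOn_Ioc_of_le ht]
    exact intervalIntegral.integrableOn_deriv_right_of_nonneg hcl hdl hk
  rw [intervalIntegral.integral_eq_sub_of_hasDeriv_right_of_le ht hcl hdl hi]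
  have h0 := hpos 0 (left_mem_Icc.2 ht)
  have h1 := hpos t (right_mem_Icc.2 ht)
  have : -(-Real.log (S t) - -Real.log (S 0)) = Real.log (S t) - Real.log (S 0) := by ring
  rw [this, Real.exp_sub, Real.exp_log h0, Real.exp_log h1]
  field_simp

namespace BargainingGame

variable (B : BargainingGame)

/-- Player 1's concession probability, for terminal time `T`. -/
noncomputable def concSol₁ (T t : ℝ) : ℝ := (1 - B.nonConcSol T (min t T)) / (1 - B.z₁)

/-- Player 2's concession probability, for terminal time `T`. -/
noncomputable def concSol₂ (T t : ℝ) : ℝ :=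
  (1 - B.z₂ * Real.exp (B.lam₂ * (T - min t T))) / (1 - B.z₂)

lemma one_sub_z₁_pos : 0 < 1 - B.z₁ := by linarith [B.z₁_mem.2]

lemma one_sub_z₂_pos : 0 < 1 - B.z₂ := by linarith [B.z₂_mem.2]

lemma continuous_concSol₁ (T : ℝ) : Continuous (B.concSol₁ T) := by
  have := B.continuous_nonConcSol T
  unfold concSol₁; fun_prop

lemma continuous_concSol₂ (T : ℝ) : Continuous (B.concSol₂ T) := by
  unfold concSol₂; fun_prop

lemma continuous_chalSol (T : ℝ) : Continuous (B.chalSol T) := by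
  unfold chalSol; fun_prop

lemma chalSol_zero (T : ℝ) : B.chalSol T 0 = 0 := by
  rw [chalSol, min_eq_left (B.stopTime_nonneg T)]; simp

lemma chalSol_terminal {T : ℝ} (hT : 0 < T) {t : ℝ} (ht : T ≤ t) :
    B.chalSol T t = B.chalSol T T := by
  rw [chalSol, chalSol, min_eq_right (B.stopTime_lt hT).le,
    min_eq_right ((B.stopTime_lt hT).le.trans ht)]

lemma survSol₁_nonneg {T t : ℝ} (ht : t ≤ T) : 0 ≤ B.survSol₁ T t :=
  mul_nonneg (mul_pos B.z₁_mem.1 (Real.exp_pos _)).le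
    (zero_le_one.trans (B.one_le_invRep (sub_nonneg.2 ht)))

lemma hasDerivAt_concSol₁ {T t : ℝ} (ht : t ∈ Ioo 0 T) :
    HasDerivAt (B.concSol₁ T) (B.lam₁ / (1 - B.z₁) * B.survSol₁ T t) t := by
  have h := ((B.hasDerivAt_nonConcSol T ht.1).const_sub 1).div_const (1 - B.z₁)
  refine (h.congr_of_eventuallyEq ?_).congr_deriv (by ring)
  filter_upwards [gt_mem_nhds ht.2] with x hx
  rw [concSol₁, min_eq_left hx.le]

lemma hasDerivAt_concSol₂ {T t : ℝ} (ht : t < T) :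
    HasDerivAt (B.concSol₂ T)
      (B.lam₂ / (1 - B.z₂) * (B.z₂ * Real.exp (B.lam₂ * (T - t)))) t := by
  have h := (((((hasDerivAt_id t).const_sub T).const_mul B.lam₂).exp.const_mul
    B.z₂).const_sub 1).div_const (1 - B.z₂)
  refine (h.congr_of_eventuallyEq ?_).congr_deriv (by simp; ring)
  filter_upwards [gt_mem_nhds ht] with x hx
  simp [concSol₂, min_eq_left hx.le]

/-- Density of the challenging probability. -/
noncomputable def chalDensSol (T t : ℝ) : ℝ :=
  if t < T - B.tN then B.z₁ / (1 - B.z₁) * B.kap * (B.γ₁ * Real.exp (-B.γ₁ * t)) else 0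

lemma chalDensSol_nonneg (T t : ℝ) : 0 ≤ B.chalDensSol T t := by
  have h1 := B.one_sub_z₁_pos
  have h2 := B.z₁_mem.1
  have h3 := B.kap_pos
  have h4 := B.γ₁_nonneg
  rw [chalDensSol]
  split_ifs <;> positivity

lemma hasDerivWithinAt_chalSol (T : ℝ) {t : ℝ} (ht : 0 < t) :
    HasDerivWithinAt (B.chalSol T) (B.chalDensSol T t) (Ioi t) t := by
  rw [chalDensSol]
  split_ifs with h
  · have h1 := ((hasDerivAt_exp_const_mul (-B.γ₁) t).const_sub 1).const_mul
      (B.z₁ / (1 - B.z₁) * B.kap)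
    refine ((h1.congr_of_eventuallyEq ?_).congr_deriv (by ring)).hasDerivWithinAt
    filter_upwards [gt_mem_nhds h] with x hx
    have hxs : x ≤ B.stopTime T := hx.le.trans (le_max_left _ _)
    rw [chalSol, min_eq_left hxs]
  · have hst : B.stopTime T ≤ t := max_le (not_lt.1 h) ht.le
    refine (hasDerivWithinAt_const t (Ioi t) (B.chalSol T t)).congr (fun x hx => ?_) rfl
    rw [chalSol, chalSol, min_eq_right hst, min_eq_right (hst.trans (le_of_lt hx))]

namespace IsSolution

variable {B} {S₁ : StrategyOne} {S₂ : StrategyTwo} {T : ℝ}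

lemma F₁_eq (hS : B.IsSolution T S₁ S₂) {t : ℝ} (ht : 0 ≤ t) : S₁.F t = B.concSol₁ T t := by
  have hz := B.one_sub_z₁_pos.ne'
  have hT := hS.terminal.pos
  have hle : ∀ t, 0 ≤ t → t ≤ T → S₁.F t = B.concSol₁ T t := fun t ht htT => by
    have h1 := hS.surv₁_eq t ht htT
    rw [surv₁, hS.G_eq t ht] at h1
    rw [concSol₁, min_eq_left htT, eq_div_iff hz, nonConcSol]
    linarith
  rcases le_total t T with h | h
  · exact hle t ht h
  · rw [hS.F₁_const t h, hle T hT.le le_rfl, concSol₁, concSol₁, min_self, min_eq_right h]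

lemma F₂_eq (hS : B.IsSolution T S₁ S₂) {t : ℝ} (ht : 0 ≤ t) : S₂.F t = B.concSol₂ T t := by
  have hz := B.one_sub_z₂_pos.ne'
  rcases le_total t T with h | h
  · have h1 := hS.surv₂_eq t ht h
    rw [surv₂] at h1
    rw [concSol₂, min_eq_left h, eq_div_iff hz]
    linarith
  · rw [hS.F₂_const t h, concSol₂, min_eq_right h, sub_self, mul_zero, Real.exp_zero, mul_one,
      div_self hz]

lemma F₁_eventuallyEq (hS : B.IsSolution T S₁ S₂) {t : ℝ} (ht : 0 < t) :
    S₁.F =ᶠ[𝓝 t] B.concSol₁ T := by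
  filter_upwards [lt_mem_nhds ht] with x hx using hS.F₁_eq hx.le

lemma F₂_eventuallyEq (hS : B.IsSolution T S₁ S₂) {t : ℝ} (ht : 0 < t) :
    S₂.F =ᶠ[𝓝 t] B.concSol₂ T := by
  filter_upwards [lt_mem_nhds ht] with x hx using hS.F₂_eq hx.le

lemma G_eventuallyEq (hS : B.IsSolution T S₁ S₂) {t : ℝ} (ht : 0 < t) :
    S₁.G =ᶠ[𝓝 t] B.chalSol T := by
  filter_upwards [lt_mem_nhds ht] with x hx using hS.G_eq x hx.le

lemma F₁_continuousAt (hS : B.IsSolution T S₁ S₂) {t : ℝ} (ht : 0 < t) : ContinuousAt S₁.F t :=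
  (B.continuous_concSol₁ T).continuousAt.congr (hS.F₁_eventuallyEq ht).symm

lemma F₂_continuousAt (hS : B.IsSolution T S₁ S₂) {t : ℝ} (ht : 0 < t) : ContinuousAt S₂.F t :=
  (B.continuous_concSol₂ T).continuousAt.congr (hS.F₂_eventuallyEq ht).symm

lemma G_continuousAt (hS : B.IsSolution T S₁ S₂) {t : ℝ} (ht : 0 < t) : ContinuousAt S₁.G t :=
  (B.continuous_chalSol T).continuousAt.congr (hS.G_eventuallyEq ht).symm

lemma F₁_hasDerivAt (hS : B.IsSolution T S₁ S₂) {t : ℝ} (ht : t ∈ Ioo 0 T) :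
    HasDerivAt S₁.F (B.lam₁ / (1 - B.z₁) * B.surv₁ S₁ t) t := by
  rw [hS.surv₁_eq t ht.1.le ht.2.le]
  exact (B.hasDerivAt_concSol₁ ht).congr_of_eventuallyEq (hS.F₁_eventuallyEq ht.1)

lemma F₂_hasDerivAt (hS : B.IsSolution T S₁ S₂) {t : ℝ} (ht : t ∈ Ioo 0 T) :
    HasDerivAt S₂.F (B.lam₂ / (1 - B.z₂) * B.surv₂ S₂ t) t := by
  rw [hS.surv₂_eq t ht.1.le ht.2.le]
  exact (B.hasDerivAt_concSol₂ ht.2).congr_of_eventuallyEq (hS.F₂_eventuallyEq ht.1)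

lemma G_hasDerivWithinAt (hS : B.IsSolution T S₁ S₂) {t : ℝ} (ht : 0 < t) :
    HasDerivWithinAt S₁.G (B.chalDensSol T t) (Ioi t) t :=
  (B.hasDerivWithinAt_chalSol T ht).congr (fun x hx => hS.G_eq x (ht.le.trans (le_of_lt hx)))
    (hS.G_eq t ht.le)

/-- Reputations are defined through left limits, which at 0 miss the initial atom; hence `0 < t`. -/
lemma rep₁_eq (hS : B.IsSolution T S₁ S₂) {t : ℝ} (ht : 0 < t) (htT : t ≤ T) :
    B.rep₁ S₁ t = 1 / B.invRep (T - t) := by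
  have h1 : ∫ s in 0..t, B.γ₁ * Real.exp (-B.γ₁ * s) = 1 - Real.exp (-B.γ₁ * t) := by
    rw [intervalIntegral.integral_const_mul, mul_integral_exp]
  have h2 := hS.surv₁_eq t ht.le htT
  have h3 : B.z₁ * (1 - (1 - Real.exp (-B.γ₁ * t))) + (1 - B.z₁) * (1 - S₁.F t - S₁.G t)
      = B.surv₁ S₁ t := by rw [surv₁]; ring
  rw [rep₁, h1, (IsSubCDF.continuousAt_iff _ _).1 (hS.F₁_continuousAt ht),
    (IsSubCDF.continuousAt_iff _ _).1 (hS.G_continuousAt ht), h3, h2, survSol₁, sub_sub_cancel]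
  have h4 := B.z₁_mem.1.ne'
  have h5 : B.invRep (T - t) ≠ 0 := by linarith [B.one_le_invRep (sub_nonneg.2 htT)]
  field_simp

lemma rep₂_eq (hS : B.IsSolution T S₁ S₂) {t : ℝ} (ht : 0 < t) (htT : t ≤ T) :
    B.rep₂ S₂ t = Real.exp (-B.lam₂ * (T - t)) := by
  have h2 := hS.surv₂_eq t ht.le htT
  have h3 : B.z₂ + (1 - B.z₂) * (1 - S₂.F t) = B.surv₂ S₂ t := by rw [surv₂]; ring
  rw [rep₂, (IsSubCDF.continuousAt_iff _ _).1 (hS.F₂_continuousAt ht), h3, h2, neg_mul,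
    Real.exp_neg]
  have := B.z₂_mem.1.ne'
  field_simp

lemma one_sub_F₂ (hS : B.IsSolution T S₁ S₂) {t : ℝ} (ht : 0 ≤ t) (htT : t ≤ T) :
    (1 - B.z₂) * (1 - S₂.F t) = B.z₂ * (Real.exp (B.lam₂ * (T - t)) - 1) := by
  have h := hS.surv₂_eq t ht htT
  rw [surv₂] at h; linarith

lemma one_sub_F₁_sub_G (hS : B.IsSolution T S₁ S₂) {t : ℝ} (ht : 0 ≤ t) (htT : t ≤ T) :
    (1 - B.z₁) * (1 - S₁.F t - S₁.G t)
      = B.z₁ * Real.exp (-B.γ₁ * t) * (B.invRep (T - t) - 1) := by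
  have h := hS.surv₁_eq t ht htT
  rw [surv₁, survSol₁] at h; linarith

lemma kappa₂_mul (hS : B.IsSolution T S₁ S₂) {t : ℝ} (ht : 0 < t) (htT : t < T) :
    B.kappa₂ T S₂ t * (1 - S₂.F t) = B.lam₂ / (1 - B.z₂) * B.surv₂ S₂ t := by
  have hz := B.one_sub_z₂_pos.ne'
  have h1 : 1 - S₂.F t = B.z₂ * (Real.exp (B.lam₂ * (T - t)) - 1) / (1 - B.z₂) := by
    rw [eq_div_iff hz, mul_comm, hS.one_sub_F₂ ht.le htT.le]
  have h2 : 1 < Real.exp (B.lam₂ * (T - t)) :=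
    Real.one_lt_exp_iff.2 (mul_pos B.lam₂_pos (sub_pos.2 htT))
  rw [kappa₂, if_pos htT, hS.rep₂_eq ht htT.le, h1, hS.surv₂_eq t ht.le htT.le, neg_mul,
    Real.exp_neg]
  have h3 : Real.exp (B.lam₂ * (T - t)) - 1 ≠ 0 := by linarith
  have h4 := (Real.exp_pos (B.lam₂ * (T - t))).ne'
  field_simp

lemma kappa₁_mul (hS : B.IsSolution T S₁ S₂) {t : ℝ} (ht : 0 < t) (htT : t < T) :
    B.kappa₁ T S₁ t * (1 - S₁.F t - S₁.G t) = B.lam₁ / (1 - B.z₁) * B.surv₁ S₁ t := by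
  have hz := B.one_sub_z₁_pos.ne'
  have h1 : 1 - S₁.F t - S₁.G t
      = B.z₁ * Real.exp (-B.γ₁ * t) * (B.invRep (T - t) - 1) / (1 - B.z₁) := by
    rw [eq_div_iff hz, mul_comm, hS.one_sub_F₁_sub_G ht.le htT.le]
  have h2 := B.one_lt_invRep (sub_pos.2 htT)
  rw [kappa₁, if_pos htT, hS.rep₁_eq ht htT.le, h1, hS.surv₁_eq t ht.le htT.le, survSol₁]
  have h3 : B.invRep (T - t) - 1 ≠ 0 := by linarith
  have h4 : B.invRep (T - t) ≠ 0 := by linarith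
  field_simp

lemma chi₁_mul (hS : B.IsSolution T S₁ S₂) {t : ℝ} (ht : 0 < t) (htT : t < T) :
    B.chi₁ T S₁ t * (1 - S₁.F t - S₁.G t) = B.chalDensSol T t := by
  have hz := B.one_sub_z₁_pos.ne'
  have h1 : 1 - S₁.F t - S₁.G t
      = B.z₁ * Real.exp (-B.γ₁ * t) * (B.invRep (T - t) - 1) / (1 - B.z₁) := by
    rw [eq_div_iff hz, mul_comm, hS.one_sub_F₁_sub_G ht.le htT.le]
  have h2 := B.one_lt_invRep (sub_pos.2 htT)
  rw [chi₁, chalDensSol]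
  split_ifs with h
  · rw [hS.rep₁_eq ht htT.le, h1, one_sub_nuStar_div]
    have h3 : B.invRep (T - t) - 1 ≠ 0 := by linarith
    have h4 : B.invRep (T - t) ≠ 0 := by linarith
    field_simp
  · simp

lemma kappa₁_nonneg (hS : B.IsSolution T S₁ S₂) {t : ℝ} (ht : 0 < t) : 0 ≤ B.kappa₁ T S₁ t := by
  rw [kappa₁]
  split_ifs with htT
  · have h2 := B.one_lt_invRep (sub_pos.2 htT)
    rw [hS.rep₁_eq ht htT.le]
    exact div_nonneg B.lam₁_pos.le
      (sub_nonneg.2 ((div_le_one (by linarith)).2 h2.le))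
  · exact le_rfl

lemma chi₁_nonneg (hS : B.IsSolution T S₁ S₂) {t : ℝ} (ht : 0 < t) : 0 ≤ B.chi₁ T S₁ t := by
  rw [chi₁]
  split_ifs with h
  · have htT : t < T := by linarith [B.tN_pos]
    have h2 := B.one_lt_invRep (sub_pos.2 htT)
    have h3 : 1 / B.invRep (T - t) ≤ 1 := (div_le_one (by linarith)).2 h2.le
    rw [hS.rep₁_eq ht htT.le, one_sub_nuStar_div]
    exact mul_nonneg (mul_nonneg B.kap_pos.le
      (div_nonneg (one_div_nonneg.2 (by linarith)) (by linarith))) B.γ₁_nonneg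
  · exact le_rfl

lemma kappa₂_nonneg (hS : B.IsSolution T S₁ S₂) {t : ℝ} (ht : 0 < t) : 0 ≤ B.kappa₂ T S₂ t := by
  rw [kappa₂]
  split_ifs with htT
  · rw [hS.rep₂_eq ht htT.le]
    refine div_nonneg B.lam₂_pos.le (sub_nonneg.2 (Real.exp_le_one_iff.2 ?_))
    nlinarith [B.lam₂_pos]
  · exact le_rfl

lemma G_zero (hS : B.IsSolution T S₁ S₂) : S₁.G 0 = 0 := by
  rw [hS.G_eq 0 le_rfl, chalSol_zero]

lemma survival₁_eq (hS : B.IsSolution T S₁ S₂) {t : ℝ} (ht : 0 < t) (htT : t < T) :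
    (1 - S₁.F 0) * Real.exp (-∫ s in 0..t, (B.kappa₁ T S₁ s + B.chi₁ T S₁ s))
      = 1 - S₁.F t - S₁.G t := by
  have h := mul_exp_neg_integral (S := fun t => 1 - S₁.F t - S₁.G t)
    (k := fun s => B.kappa₁ T S₁ s + B.chi₁ T S₁ s) ht.le ?_ ?_ ?_ ?_
  · simpa [hS.G_zero] using h
  · have h1 : ContinuousOn S₁.F (Icc 0 t) := (B.continuous_concSol₁ T).continuousOn.congr
      fun x hx => hS.F₁_eq hx.1
    have h2 : ContinuousOn S₁.G (Icc 0 t) := (B.continuous_chalSol T).continuousOn.congr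
      fun x hx => hS.G_eq x hx.1
    exact (continuousOn_const.sub h1).sub h2
  · intro x hx
    have h1 := hS.one_sub_F₁_sub_G hx.1 (hx.2.trans htT.le)
    have h2 := B.one_lt_invRep (sub_pos.2 (hx.2.trans_lt htT))
    have h3 := mul_pos (mul_pos B.z₁_mem.1 (Real.exp_pos (-B.γ₁ * x))) (sub_pos.2 h2)
    rw [← h1] at h3
    exact pos_of_mul_pos_right h3 B.one_sub_z₁_pos.le
  · exact fun x hx => add_nonneg (hS.kappa₁_nonneg hx.1) (hS.chi₁_nonneg hx.1)
  · intro x hx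
    have hxT := hx.2.trans htT
    have h1 := ((hS.F₁_hasDerivAt ⟨hx.1, hxT⟩).hasDerivWithinAt (s := Ioi x)).const_sub 1
    refine (h1.sub (hS.G_hasDerivWithinAt hx.1)).congr_deriv ?_
    rw [add_mul, hS.kappa₁_mul hx.1 hxT, hS.chi₁_mul hx.1 hxT]
    ring

lemma survival₂_eq (hS : B.IsSolution T S₁ S₂) {t : ℝ} (ht : 0 < t) (htT : t < T) :
    (1 - S₂.F 0) * Real.exp (-∫ s in 0..t, B.kappa₂ T S₂ s) = 1 - S₂.F t := by
  refine mul_exp_neg_integral (S := fun t => 1 - S₂.F t) ht.le ?_ ?_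
    (fun x hx => hS.kappa₂_nonneg hx.1) ?_
  · exact continuousOn_const.sub ((B.continuous_concSol₂ T).continuousOn.congr
      fun x hx => hS.F₂_eq hx.1)
  · intro x hx
    have h1 := hS.one_sub_F₂ hx.1 (hx.2.trans htT.le)
    have h2 : 1 < Real.exp (B.lam₂ * (T - x)) :=
      Real.one_lt_exp_iff.2 (mul_pos B.lam₂_pos (sub_pos.2 (hx.2.trans_lt htT)))
    have h3 := mul_pos B.z₂_mem.1 (sub_pos.2 h2)
    rw [← h1] at h3
    exact pos_of_mul_pos_right h3 B.one_sub_z₂_pos.le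
  · intro x hx
    have hxT := hx.2.trans htT
    have h1 := ((hS.F₂_hasDerivAt ⟨hx.1, hxT⟩).hasDerivWithinAt (s := Ioi x)).const_sub 1
    exact h1.congr_deriv (by rw [hS.kappa₂_mul hx.1 hxT])

lemma f₁_eq (hS : B.IsSolution T S₁ S₂) {t : ℝ} (ht : 0 < t) :
    B.f₁ T S₁ t = if t < T then B.lam₁ / (1 - B.z₁) * B.surv₁ S₁ t else 0 := by
  rw [f₁]
  split_ifs with htT
  · rw [hS.survival₁_eq ht htT, mul_comm, hS.kappa₁_mul ht htT]
  · rw [kappa₁, if_neg htT, mul_zero]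

lemma g₁_eq (hS : B.IsSolution T S₁ S₂) {t : ℝ} (ht : 0 < t) :
    B.g₁ T S₁ t = B.chalDensSol T t := by
  rw [g₁]
  by_cases htT : t < T
  · rw [hS.survival₁_eq ht htT, mul_comm, hS.chi₁_mul ht htT]
  · have : ¬ t < T - B.tN := by linarith [B.tN_pos]
    rw [chi₁, if_neg this, chalDensSol, if_neg this, mul_zero]

lemma f₂_eq (hS : B.IsSolution T S₁ S₂) {t : ℝ} (ht : 0 < t) :
    B.f₂ T S₂ t = if t < T then B.lam₂ / (1 - B.z₂) * B.surv₂ S₂ t else 0 := by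
  rw [f₂]
  split_ifs with htT
  · rw [hS.survival₂_eq ht htT, mul_comm, hS.kappa₂_mul ht htT]
  · rw [kappa₂, if_neg htT, mul_zero]

lemma hasAtomAndDensity_F₁ (hS : B.IsSolution T S₁ S₂) :
    HasAtomAndDensity S₁.F (B.f₁ T S₁) := by
  refine hasAtomAndDensity_of_hasDerivWithinAt ((B.continuous_concSol₁ T).continuousOn.congr
    fun x hx => hS.F₁_eq hx) (fun x hx => ?_) fun x hx => ?_
  · rw [hS.f₁_eq hx]
    split_ifs with h
    · exact (hS.F₁_hasDerivAt ⟨hx, h⟩).hasDerivWithinAt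
    · refine (hasDerivWithinAt_const x _ (S₁.F T)).congr (fun y hy => ?_) ?_
      · exact hS.F₁_const y ((not_lt.1 h).trans (le_of_lt hy))
      · exact hS.F₁_const x (not_lt.1 h)
  · rw [hS.f₁_eq hx]
    split_ifs with h
    · exact mul_nonneg (div_pos B.lam₁_pos B.one_sub_z₁_pos).le
        ((B.isSurvival_surv₁ S₁).pos x).le
    · exact le_rfl

lemma hasAtomAndDensity_F₂ (hS : B.IsSolution T S₁ S₂) :
    HasAtomAndDensity S₂.F (B.f₂ T S₂) := by
  refine hasAtomAndDensity_of_hasDerivWithinAt ((B.continuous_concSol₂ T).continuousOn.congr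
    fun x hx => hS.F₂_eq hx) (fun x hx => ?_) fun x hx => ?_
  · rw [hS.f₂_eq hx]
    split_ifs with h
    · exact (hS.F₂_hasDerivAt ⟨hx, h⟩).hasDerivWithinAt
    · refine (hasDerivWithinAt_const x _ (1 : ℝ)).congr (fun y hy => ?_) ?_
      · exact hS.F₂_const y ((not_lt.1 h).trans (le_of_lt hy))
      · exact hS.F₂_const x (not_lt.1 h)
  · rw [hS.f₂_eq hx]
    split_ifs with h
    · exact mul_nonneg (div_pos B.lam₂_pos B.one_sub_z₂_pos).le
        ((B.isSurvival_surv₂ S₂).pos x).le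
    · exact le_rfl

lemma hasAtomAndDensity_G (hS : B.IsSolution T S₁ S₂) :
    HasAtomAndDensity S₁.G (B.g₁ T S₁) := by
  refine hasAtomAndDensity_of_hasDerivWithinAt ((B.continuous_chalSol T).continuousOn.congr
    fun x hx => hS.G_eq x hx) (fun x hx => ?_) fun x hx => ?_
  · rw [hS.g₁_eq hx]; exact hS.G_hasDerivWithinAt hx
  · rw [hS.g₁_eq hx]; exact B.chalDensSol_nonneg T x

lemma F₁_zero (hS : B.IsSolution T S₁ S₂) : S₁.F 0 = (1 - B.z₁ * B.invRep T) / (1 - B.z₁) := by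
  rw [hS.F₁_eq le_rfl, concSol₁, min_eq_left hS.terminal.pos.le, nonConcSol, chalSol_zero, survSol₁]
  simp

lemma F₂_zero (hS : B.IsSolution T S₁ S₂) :
    S₂.F 0 = (1 - B.z₂ / Real.exp (-B.lam₂ * T)) / (1 - B.z₂) := by
  rw [hS.F₂_eq le_rfl, concSol₂, min_eq_left hS.terminal.pos.le, neg_mul, Real.exp_neg, div_inv_eq_mul,
    sub_zero]

/-- The atom at 0 raises player 1's reputation from `z₁` to `1 / invRep T`. If player 2's path
reached its prior, this is `curve₁ z₂`; otherwise player 1's path starts at `z₁` and there is no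
atom. -/
lemma F₁_zero_eq_ite (hS : B.IsSolution T S₁ S₂) :
    S₁.F 0 = if B.z₁ < B.curve₁ B.z₂ then
      1 - B.z₁ / (1 - B.z₁) / (B.curve₁ B.z₂ / (1 - B.curve₁ B.z₂)) else 0 := by
  have hT := hS.terminal
  have hc := hT.curve₁_z₂
  have hz1 := B.z₁_mem.1
  have hz := B.one_sub_z₁_pos.ne'
  have h1 := B.one_lt_invRep hT.pos
  rw [hS.F₁_zero]
  by_cases h : Real.exp (-B.lam₂ * T) = B.z₂
  · rw [if_pos h] at hc
    rw [hc]
    split_ifs with h2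
    · have h3 : B.invRep T - 1 ≠ 0 := by linarith
      have h4 : B.invRep T ≠ 0 := by linarith
      field_simp
      ring
    · have h3 : B.invRep T = 1 / B.z₁ := by
        refine le_antisymm hT.le₁ ?_
        rw [div_le_comm₀ hz1 (by linarith)]
        exact not_lt.1 h2
      rw [h3, mul_one_div, div_self hz1.ne', sub_self, zero_div]
  · rw [if_neg h] at hc
    rw [if_neg (not_lt.2 hc.le), hT.or.resolve_right h, mul_one_div, div_self hz1.ne', sub_self,
      zero_div]

lemma F₂_zero_eq_ite (hS : B.IsSolution T S₁ S₂) :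
    S₂.F 0 = if B.z₂ < B.curve₂ B.z₁ then
      1 - B.z₂ / (1 - B.z₂) / (B.curve₂ B.z₁ / (1 - B.curve₂ B.z₁)) else 0 := by
  have hT := hS.terminal
  have hc := hT.curve₂_z₁
  have hz2 := B.z₂_mem.1
  have hz := B.one_sub_z₂_pos.ne'
  have hx0 := Real.exp_pos (-B.lam₂ * T)
  have hx1 : Real.exp (-B.lam₂ * T) < 1 := by
    rw [Real.exp_lt_one_iff]; nlinarith [B.lam₂_pos, hT.pos]
  rw [hS.F₂_zero]
  by_cases h : B.invRep T = 1 / B.z₁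
  · rw [if_pos h] at hc
    rw [hc]
    split_ifs with h2
    · have h3 : 1 - Real.exp (-B.lam₂ * T) ≠ 0 := by linarith
      field_simp
      ring
    · have h3 : Real.exp (-B.lam₂ * T) = B.z₂ := le_antisymm (not_lt.1 h2) hT.le₂
      rw [h3, div_self hz2.ne', sub_self, zero_div]
  · rw [if_neg h] at hc
    rw [if_neg (not_lt.2 hc.le), hT.or.resolve_left h, div_self hz2.ne', sub_self, zero_div]

lemma rep₂_hasDerivAt (hS : B.IsSolution T S₁ S₂) {t : ℝ} (ht : 0 < t) (htT : t < T) :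
    HasDerivAt (B.rep₂ S₂) (B.lam₂ * B.rep₂ S₂ t) t := by
  have h := (((hasDerivAt_id t).const_sub T).const_mul (-B.lam₂)).exp
  rw [hS.rep₂_eq ht htT.le]
  refine (h.congr_of_eventuallyEq ?_).congr_deriv (by simp; ring)
  filter_upwards [Ioo_mem_nhds ht htT] with x hx using hS.rep₂_eq hx.1 hx.2.le

lemma rep₁_hasDerivAt (hS : B.IsSolution T S₁ S₂) {t C : ℝ} (ht : 0 < t) (htT : t < T)
    (h : HasDerivAt B.invRep ((B.lam₁ - B.γ₁) * B.invRep (T - t) + C) (T - t)) :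
    HasDerivAt (B.rep₁ S₁) ((B.lam₁ - B.γ₁) * B.rep₁ S₁ t + C * B.rep₁ S₁ t ^ 2) t := by
  have h0 : B.invRep (T - t) ≠ 0 := by linarith [B.one_lt_invRep (sub_pos.2 htT)]
  have h1 := (h.comp t ((hasDerivAt_id t).const_sub T)).inv h0
  rw [hS.rep₁_eq ht htT.le]
  refine (h1.congr_of_eventuallyEq ?_).congr_deriv ?_
  · filter_upwards [Ioo_mem_nhds ht htT] with x hx
    rw [hS.rep₁_eq hx.1 hx.2.le]; simp
  · simp only [comp]
    field_simp

end IsSolution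

lemma hasDerivAt_invRep_of_lt {s : ℝ} (hs : s < B.tN) :
    HasDerivAt B.invRep ((B.lam₁ - B.γ₁) * B.invRep s + B.γ₁) s := by
  have h := ((hasDerivAt_expInt (B.lam₁ - B.γ₁) s).const_mul B.lam₁).const_add 1
  refine (h.congr_of_eventuallyEq ?_).congr_deriv ?_
  · filter_upwards [gt_mem_nhds hs] with x hx using B.invRep_of_le hx.le
  · rw [B.invRep_of_le hs.le]
    linear_combination (-B.lam₁) * mul_expInt (B.lam₁ - B.γ₁) s

lemma hasDerivAt_invRep_of_gt {s : ℝ} (hs : B.tN < s) :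
    HasDerivAt B.invRep ((B.lam₁ - B.γ₁) * B.invRep s + B.γ₁ / B.nuStar) s := by
  have h := (((hasDerivAt_expInt (B.lam₁ - B.γ₁) s).const_mul B.lam₁).const_add 1).add
    (((hasDerivAt_expInt (B.lam₁ - B.γ₁) (s - B.tN)).comp s
      ((hasDerivAt_id s).sub_const B.tN)).const_mul (B.γ₁ * B.kap))
  refine (h.congr_of_eventuallyEq ?_).congr_deriv ?_
  · filter_upwards [lt_mem_nhds hs] with x hx
    rw [invRep, max_eq_left (by linarith)]; rfl
  · rw [invRep, max_eq_left (by linarith), div_nuStar]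
    linear_combination (-B.lam₁) * mul_expInt (B.lam₁ - B.γ₁) s
      - B.γ₁ * B.kap * mul_expInt (B.lam₁ - B.γ₁) (s - B.tN)

/-! ### Equilibrium payoffs -/

namespace IsSolution

variable {B} {S₁ : StrategyOne} {S₂ : StrategyTwo} {T : ℝ}

lemma surv₁_continuousAt (hS : B.IsSolution T S₁ S₂) {t : ℝ} (ht : 0 < t) :
    ContinuousAt (B.surv₁ S₁) t :=
  (continuousAt_const.sub (continuousAt_const.mul ((hS.F₁_continuousAt ht).add
    (hS.G_continuousAt ht)))).sub (by fun_prop)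

lemma surv₂_continuousAt (hS : B.IsSolution T S₁ S₂) {t : ℝ} (ht : 0 < t) :
    ContinuousAt (B.surv₂ S₂) t :=
  continuousAt_const.sub (continuousAt_const.mul (hS.F₂_continuousAt ht))

lemma wait₁_eq (hS : B.IsSolution T S₁ S₂) {t : ℝ} (ht : 0 < t) (htT : t ≤ T) :
    B.wait₁ S₂ t = (1 - B.z₂) * S₂.F 0 :=
  S₂.isSubCDF.waitGain_of_hasDerivAt (B.isSurvival_surv₂ S₂) B.z₂_mem.2
    (fun _ h => hS.F₂_continuousAt h) (fun _ h => hS.surv₂_continuousAt h.1)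
    (fun _ h => hS.F₂_hasDerivAt h) ht htT

lemma wait₂_eq (hS : B.IsSolution T S₁ S₂) {t : ℝ} (ht : 0 < t) (htT : t ≤ T) :
    B.wait₂ S₁ t = (1 - B.z₁) * S₁.F 0 :=
  S₁.isSubCDF_F.waitGain_of_hasDerivAt (B.isSurvival_surv₁ S₁) B.z₁_mem.2
    (fun _ h => hS.F₁_continuousAt h) (fun _ h => hS.surv₁_continuousAt h.1)
    (fun _ h => hS.F₁_hasDerivAt h) ht htT

lemma F₂_lt_one (hS : B.IsSolution T S₁ S₂) {t : ℝ} (ht : t < T) : S₂.F t < 1 := by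
  rcases lt_or_ge t 0 with h0 | h0
  · rw [S₂.F_neg t h0]; exact one_pos
  have h1 := hS.one_sub_F₂ h0 ht.le
  have h2 : 1 < Real.exp (B.lam₂ * (T - t)) :=
    Real.one_lt_exp_iff.2 (mul_pos B.lam₂_pos (sub_pos.2 ht))
  have h3 := mul_pos B.z₂_mem.1 (sub_pos.2 h2)
  rw [← h1] at h3
  linarith [pos_of_mul_pos_right h3 B.one_sub_z₂_pos.le]

lemma payoff₁_eq (hS : B.IsSolution T S₁ S₂) (hE : B.IsEquilibrium S₁ S₂) :
    B.payoff₁ S₁ S₂ = 1 - B.a₂ + (1 - B.z₂) * S₂.F 0 * B.D := by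
  have hT := hS.terminal.pos
  -- Any interior time serves: there the player is indifferent, and the gain from waiting is the
  -- opponent's full initial atom.
  have h1 := (hE.indifferent (half_pos hT) (hS.F₂_lt_one (by linarith))).1
  rw [hS.wait₁_eq (half_pos hT) (by linarith), eq_div_iff B.D_pos.ne'] at h1
  linarith

lemma payoff₂_eq (hS : B.IsSolution T S₁ S₂) (hE : B.IsEquilibrium S₁ S₂) :
    B.payoff₂ S₁ S₂ = 1 - B.a₁ + (1 - B.z₁) * S₁.F 0 * B.D := by
  have hT := hS.terminal.pos
  have h1 := (hE.indifferent (half_pos hT) (hS.F₂_lt_one (by linarith))).2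
  rw [hS.wait₂_eq (half_pos hT) (by linarith), eq_div_iff B.D_pos.ne'] at h1
  linarith

lemma payoff₁_eq_ite (hS : B.IsSolution T S₁ S₂) (hE : B.IsEquilibrium S₁ S₂) :
    B.payoff₁ S₁ S₂ = 1 - B.a₂ + (if B.curve₁ B.z₂ ≤ B.z₁ then
      (1 - B.z₂) * (1 - B.z₂ / (1 - B.z₂) / (B.curve₂ B.z₁ / (1 - B.curve₂ B.z₁))) * B.D
      else 0) := by
  have hT := hS.terminal
  have hc₁ := hT.curve₁_z₂
  have hc₂ := hT.curve₂_z₁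
  have hz1 := B.z₁_mem.1
  have hz := B.one_sub_z₂_pos.ne'
  have hx0 := Real.exp_pos (-B.lam₂ * T)
  have hx1 : Real.exp (-B.lam₂ * T) < 1 := by
    rw [Real.exp_lt_one_iff]; nlinarith [B.lam₂_pos, hT.pos]
  have h1 := B.one_lt_invRep hT.pos
  rw [hS.payoff₁_eq hE, hS.F₂_zero]
  congr 1
  by_cases h : B.invRep T = 1 / B.z₁
  · rw [if_pos h] at hc₂
    have hle : B.curve₁ B.z₂ ≤ B.z₁ := by
      by_cases h' : Real.exp (-B.lam₂ * T) = B.z₂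
      · rw [if_pos h'] at hc₁
        rw [hc₁, h, one_div_one_div]
      · rw [if_neg h'] at hc₁
        exact hc₁.le
    rw [if_pos hle, hc₂]
    have h3 : 1 - Real.exp (-B.lam₂ * T) ≠ 0 := by linarith
    field_simp
    ring
  · have h' := hT.or.resolve_left h
    rw [if_pos h'] at hc₁
    have hlt : ¬ B.curve₁ B.z₂ ≤ B.z₁ := by
      rw [hc₁, not_le, lt_div_comm₀ hz1 (by linarith)]
      exact lt_of_le_of_ne hT.le₁ h
    rw [if_neg hlt, h', div_self B.z₂_mem.1.ne']
    simp

lemma payoff₂_eq_ite (hS : B.IsSolution T S₁ S₂) (hE : B.IsEquilibrium S₁ S₂) :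
    B.payoff₂ S₁ S₂ = 1 - B.a₁ + (if B.curve₂ B.z₁ ≤ B.z₂ then
      (1 - B.z₁) * (1 - B.z₁ / (1 - B.z₁) / (B.curve₁ B.z₂ / (1 - B.curve₁ B.z₂))) * B.D
      else 0) := by
  have hT := hS.terminal
  have hc₁ := hT.curve₁_z₂
  have hc₂ := hT.curve₂_z₁
  have hz1 := B.z₁_mem.1
  have hz := B.one_sub_z₁_pos.ne'
  have h1 := B.one_lt_invRep hT.pos
  rw [hS.payoff₂_eq hE, hS.F₁_zero]
  congr 1
  by_cases h : Real.exp (-B.lam₂ * T) = B.z₂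
  · rw [if_pos h] at hc₁
    have hle : B.curve₂ B.z₁ ≤ B.z₂ := by
      by_cases h' : B.invRep T = 1 / B.z₁
      · rw [if_pos h'] at hc₂
        rw [hc₂, h]
      · rw [if_neg h'] at hc₂
        exact hc₂.le
    rw [if_pos hle, hc₁]
    have h3 : B.invRep T - 1 ≠ 0 := by linarith
    have h4 : B.invRep T ≠ 0 := by linarith
    field_simp
    ring
  · have h' := hT.or.resolve_right h
    rw [if_pos h'] at hc₂
    have hlt : ¬ B.curve₂ B.z₁ ≤ B.z₂ := by
      rw [hc₂, not_le]
      exact lt_of_le_of_ne hT.le₂ (Ne.symm h)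
    rw [if_neg hlt, h', mul_one_div, div_self hz1.ne']
    simp

lemma ae_q_eq (hS : B.IsSolution T S₁ S₂) (hE : B.IsEquilibrium S₁ S₂) (hγ : 0 < B.γ₁) :
    ∀ᵐ t ∂(volume.restrict (Icc 0 T)), S₂.q t = B.yieldProb T S₂ t := by
  have hT := hS.terminal.pos
  have hFT := hS.F₂_const T le_rfl
  have hlt : ∀ t, t < T → S₂.F t < 1 := fun t ht => hS.F₂_lt_one ht
  rw [ae_restrict_iff' measurableSet_Icc]
  have hne : ∀ c : ℝ, ∀ᵐ t : ℝ, t ≠ c := fun c => by simp [ae_iff]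
  filter_upwards [hE.ae_q_of_lt_stopTime hγ hT hFT hlt, hE.ae_q_of_stopTime_lt hγ hT hFT hlt,
    hne 0, hne T, hne (B.stopTime T)] with t h1 h2 h3 h4 h5 ht
  have ht0 : 0 < t := lt_of_le_of_ne ht.1 h3.symm
  have htT : t < T := lt_of_le_of_ne ht.2 h4
  rw [yieldProb, hS.rep₂_eq ht0 htT.le]
  rcases h5.lt_or_gt with h6 | h6
  · rw [if_pos (lt_of_lt_stopTime ht0.le h6)]
    exact h1 ⟨ht0, h6⟩
  · rw [if_neg (not_lt.2 ((le_max_left _ _).trans h6.le))]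
    exact h2 ⟨h6, htT⟩

end IsSolution

end BargainingGame

/-! ### Existence: the closed form is an equilibrium -/

/-- A continuous function that is nondecreasing on `[0, ∞)`, extended by `0` to negative numbers. -/
noncomputable def stieltjesOfContinuous (φ : ℝ → ℝ) (hc : Continuous φ) (hm : MonotoneOn φ (Ici 0))
    (h0 : 0 ≤ φ 0) : StieltjesFunction ℝ where
  toFun t := if t < 0 then 0 else φ t
  mono' s t hst := by
    by_cases hs : s < 0
    · by_cases ht : t < 0
      · simp [hs, ht]
      · simpa [hs, ht] using h0.trans (hm self_mem_Ici (not_lt.1 ht) (not_lt.1 ht))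
    · have ht : ¬ t < 0 := not_lt.2 ((not_lt.1 hs).trans hst)
      simpa [hs, ht] using hm (not_lt.1 hs) (not_lt.1 ht) hst
  right_continuous' x := by
    by_cases hx : x < 0
    · refine ContinuousAt.continuousWithinAt ?_
      refine (continuousAt_const (y := (0 : ℝ))).congr ?_
      filter_upwards [gt_mem_nhds hx] with y hy
      simp [show y < 0 from hy]
    · refine hc.continuousWithinAt.congr (fun y hy => ?_) ?_
      · simp [not_lt.2 ((not_lt.1 hx).trans hy)]
      · simp [hx]

section

variable {φ : ℝ → ℝ} {hc : Continuous φ} {hm : MonotoneOn φ (Ici 0)} {h0 : 0 ≤ φ 0}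

lemma stieltjesOfContinuous_of_neg {t : ℝ} (ht : t < 0) :
    stieltjesOfContinuous φ hc hm h0 t = 0 := if_pos ht

lemma stieltjesOfContinuous_of_nonneg {t : ℝ} (ht : 0 ≤ t) :
    stieltjesOfContinuous φ hc hm h0 t = φ t := if_neg (not_lt.2 ht)

end

lemma StieltjesFunction.ae_le_of_const {F : StieltjesFunction ℝ} {b : ℝ}
    (h : ∀ t, b ≤ t → F t = F b) : ∀ᵐ t ∂F.measure, t ≤ b := by
  have hlim : Tendsto F atTop (𝓝 (F b)) := tendsto_const_nhds.congr' (by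
    filter_upwards [eventually_ge_atTop b] with t ht using (h t ht).symm)
  have h0 : F.measure (Ioi b) = 0 := by rw [F.measure_Ioi hlim]; simp
  rw [ae_iff]
  simpa [← Ioi_def] using h0

namespace BargainingGame

variable (B : BargainingGame)

lemma antitoneOn_nonConcSol (T : ℝ) : AntitoneOn (B.nonConcSol T) (Icc 0 T) := by
  refine antitoneOn_of_hasDerivWithinAt_nonpos (f' := fun t => -B.lam₁ * B.survSol₁ T t)
    (convex_Icc 0 T) (B.continuous_nonConcSol T).continuousOn (fun x hx => ?_) fun x hx => ?_
  · rw [interior_Icc] at hx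
    exact (B.hasDerivAt_nonConcSol T hx.1).hasDerivWithinAt
  · rw [interior_Icc] at hx
    have := mul_nonneg B.lam₁_pos.le (B.survSol₁_nonneg hx.2.le)
    linarith

lemma monotoneOn_concSol₁ {T : ℝ} (hT : 0 < T) : MonotoneOn (B.concSol₁ T) (Ici 0) := by
  intro s hs t ht hst
  have h := B.antitoneOn_nonConcSol T (a := min s T) (b := min t T)
    ⟨le_min hs hT.le, min_le_right _ _⟩ ⟨le_min ht hT.le, min_le_right _ _⟩
    (min_le_min_right T hst)
  have hz := B.one_sub_z₁_pos
  simp only [concSol₁]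
  gcongr

lemma monotone_concSol₂ (T : ℝ) : Monotone (B.concSol₂ T) := by
  intro s t hst
  have hz := B.one_sub_z₂_pos
  have hz2 := B.z₂_mem.1
  have hl := B.lam₂_pos
  have h := min_le_min_right T hst
  simp only [concSol₂]
  gcongr

lemma monotone_chalSol (T : ℝ) : Monotone (B.chalSol T) := by
  intro s t hst
  have h := mul_le_mul_of_nonneg_left (min_le_min_right (B.stopTime T) hst) B.γ₁_nonneg
  have h1 : Real.exp (-B.γ₁ * min t (B.stopTime T)) ≤ Real.exp (-B.γ₁ * min s (B.stopTime T)) := by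
    rw [Real.exp_le_exp]; linarith
  have h2 : 0 ≤ B.z₁ / (1 - B.z₁) * B.kap :=
    mul_nonneg (div_pos B.z₁_mem.1 B.one_sub_z₁_pos).le B.kap_pos.le
  simp only [chalSol]
  exact mul_le_mul_of_nonneg_left (by linarith) h2

lemma concSol₁_add_chalSol {T t : ℝ} (ht : t ≤ T) :
    (1 - B.z₁) * (1 - B.concSol₁ T t - B.chalSol T t)
      = B.z₁ * Real.exp (-B.γ₁ * t) * (B.invRep (T - t) - 1) := by
  have hz := B.one_sub_z₁_pos.ne'
  rw [concSol₁, min_eq_left ht, nonConcSol, survSol₁]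
  field_simp
  ring

lemma concSol₁_add_chalSol_le {T : ℝ} (hT : 0 < T) (t : ℝ) :
    B.concSol₁ T t + B.chalSol T t ≤ 1 := by
  have hz := B.one_sub_z₁_pos
  have hle : ∀ t ≤ T, B.concSol₁ T t + B.chalSol T t ≤ 1 := fun t ht => by
    have h1 := B.concSol₁_add_chalSol ht
    have h2 := mul_nonneg (mul_pos B.z₁_mem.1 (Real.exp_pos (-B.γ₁ * t))).le
      (sub_nonneg.2 (B.one_le_invRep (sub_nonneg.2 ht)))
    rw [← h1] at h2
    linarith [nonneg_of_mul_nonneg_right h2 hz]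
  rcases le_total t T with h | h
  · exact hle t h
  · rw [B.chalSol_terminal hT h, concSol₁, min_eq_right h]
    have := hle T le_rfl
    rwa [concSol₁, min_self] at this

lemma concSol₁_zero {T : ℝ} (hT : 0 < T) :
    B.concSol₁ T 0 = (1 - B.z₁ * B.invRep T) / (1 - B.z₁) := by
  rw [concSol₁, min_eq_left hT.le, nonConcSol, chalSol_zero, survSol₁]
  simp

variable {B}

lemma IsTerminal.concSol₁_zero_nonneg {T : ℝ} (hT : B.IsTerminal T) : 0 ≤ B.concSol₁ T 0 := by
  rw [B.concSol₁_zero hT.pos]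
  have h := hT.le₁
  rw [le_div_iff₀ B.z₁_mem.1] at h
  exact div_nonneg (by linarith) B.one_sub_z₁_pos.le

lemma IsTerminal.concSol₂_zero_nonneg {T : ℝ} (hT : B.IsTerminal T) : 0 ≤ B.concSol₂ T 0 := by
  have h := mul_le_mul_of_nonneg_right hT.le₂ (Real.exp_pos (B.lam₂ * T)).le
  rw [← Real.exp_add, neg_mul, neg_add_cancel, Real.exp_zero] at h
  rw [concSol₂, min_eq_left hT.pos.le, sub_zero]
  exact div_nonneg (by linarith) B.one_sub_z₂_pos.le

/-- The equilibrium strategy of player 1. -/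
noncomputable def IsTerminal.strategyOne {T : ℝ} (hT : B.IsTerminal T) : StrategyOne where
  F := stieltjesOfContinuous (B.concSol₁ T) (B.continuous_concSol₁ T)
    (B.monotoneOn_concSol₁ hT.pos) hT.concSol₁_zero_nonneg
  G := stieltjesOfContinuous (B.chalSol T) (B.continuous_chalSol T)
    ((B.monotone_chalSol T).monotoneOn _) (B.chalSol_zero T).ge
  F_neg _ ht := stieltjesOfContinuous_of_neg ht
  G_neg _ ht := stieltjesOfContinuous_of_neg ht
  add_le_one t := by
    rcases lt_or_ge t 0 with ht | ht
    · rw [stieltjesOfContinuous_of_neg ht, stieltjesOfContinuous_of_neg ht]; norm_num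
    · rw [stieltjesOfContinuous_of_nonneg ht, stieltjesOfContinuous_of_nonneg ht]
      exact B.concSol₁_add_chalSol_le hT.pos t

/-- The equilibrium strategy of player 2. -/
noncomputable def IsTerminal.strategyTwo {T : ℝ} (hT : B.IsTerminal T) : StrategyTwo where
  F := stieltjesOfContinuous (B.concSol₂ T) (B.continuous_concSol₂ T)
    ((B.monotone_concSol₂ T).monotoneOn _) hT.concSol₂_zero_nonneg
  F_neg _ ht := stieltjesOfContinuous_of_neg ht
  F_le_one t := by
    rcases lt_or_ge t 0 with ht | ht
    · rw [stieltjesOfContinuous_of_neg ht]; norm_num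
    · rw [stieltjesOfContinuous_of_nonneg ht, concSol₂, div_le_one B.one_sub_z₂_pos]
      have h1 : 1 ≤ Real.exp (B.lam₂ * (T - min t T)) :=
        Real.one_le_exp (mul_nonneg B.lam₂_pos.le (sub_nonneg.2 (min_le_right _ _)))
      have := mul_le_mul_of_nonneg_left h1 B.z₂_mem.1.le
      linarith
  q t := if t < T - B.tN then B.yieldSol T t else 1
  q_measurable := Measurable.ite (measurableSet_lt measurable_id measurable_const)
    (B.measurable_yieldSol T) measurable_const
  q_mem t := by
    split_ifs with h
    · exact ⟨yieldSol_nonneg (by linarith [B.tN_pos]), (yieldSol_lt_one h).le⟩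
    · norm_num

lemma IsTerminal.isSolution {T : ℝ} (hT : B.IsTerminal T) :
    B.IsSolution T hT.strategyOne hT.strategyTwo := by
  have hF₁ : ∀ t, 0 ≤ t → hT.strategyOne.F t = B.concSol₁ T t := fun t ht =>
    if_neg (not_lt.2 ht)
  have hG : ∀ t, 0 ≤ t → hT.strategyOne.G t = B.chalSol T t := fun t ht =>
    if_neg (not_lt.2 ht)
  have hF₂ : ∀ t, 0 ≤ t → hT.strategyTwo.F t = B.concSol₂ T t := fun t ht =>
    if_neg (not_lt.2 ht)
  have hz1 := B.one_sub_z₁_pos.ne'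
  have hz2 := B.one_sub_z₂_pos.ne'
  refine ⟨hT, fun t ht htT => ?_, fun t ht htT => ?_, hG, fun t ht => ?_, fun t ht => ?_⟩
  · rw [surv₁, hF₁ t ht, hG t ht, concSol₁, min_eq_left htT, nonConcSol]
    field_simp
    ring
  · rw [surv₂, hF₂ t ht, concSol₂, min_eq_left htT]
    field_simp
    ring
  · rw [hF₁ t (hT.pos.le.trans ht), hF₁ T hT.pos.le, concSol₁, concSol₁, min_self, min_eq_right ht]
  · rw [hF₂ t (hT.pos.le.trans ht), concSol₂, min_eq_right ht, sub_self, mul_zero, Real.exp_zero,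
      mul_one, div_self hz2]

namespace IsSolution

variable {S₁ : StrategyOne} {S₂ : StrategyTwo} {T : ℝ}

lemma wait₁_le (hS : B.IsSolution T S₁ S₂) {t : ℝ} (ht : 0 ≤ t) :
    B.wait₁ S₂ t ≤ (1 - B.z₂) * S₂.F 0 := by
  have hT := hS.terminal.pos
  rcases ht.eq_or_lt with rfl | h0
  · have := mul_nonneg B.one_sub_z₂_pos.le (S₂.isSubCDF.nonneg 0)
    rw [wait₁, S₂.isSubCDF.waitGain_zero]; linarith
  rcases le_total t T with h | h
  · exact (hS.wait₁_eq h0 h).le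
  · rw [← hS.wait₁_eq hT le_rfl]
    exact S₂.isSubCDF.waitGain_le_of_const (B.isSurvival_surv₂ S₂) B.z₂_mem.2 B.r₁_pos.le
      B.lam₂_pos hT.le (hS.F₂_continuousAt hT) h
      (by rw [hS.F₂_const t h, hS.F₂_const T le_rfl])

lemma wait₂_le (hS : B.IsSolution T S₁ S₂) {t : ℝ} (ht : 0 ≤ t) :
    B.wait₂ S₁ t ≤ (1 - B.z₁) * S₁.F 0 := by
  have hT := hS.terminal.pos
  rcases ht.eq_or_lt with rfl | h0
  · have := mul_nonneg B.one_sub_z₁_pos.le (S₁.isSubCDF_F.nonneg 0)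
    rw [wait₂, S₁.isSubCDF_F.waitGain_zero]; linarith
  rcases le_total t T with h | h
  · exact (hS.wait₂_eq h0 h).le
  · rw [← hS.wait₂_eq hT le_rfl]
    exact S₁.isSubCDF_F.waitGain_le_of_const (B.isSurvival_surv₁ S₁) B.z₁_mem.2 B.r₂_pos.le
      B.lam₁_pos hT.le (hS.F₁_continuousAt hT) h (hS.F₁_const t h)

lemma F_zero_or (hS : B.IsSolution T S₁ S₂) : S₁.F 0 = 0 ∨ S₂.F 0 = 0 := by
  rcases hS.terminal.or with h | h
  · left
    rw [hS.F₁_zero, h, mul_one_div, div_self B.z₁_mem.1.ne', sub_self, zero_div]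
  · right
    rw [hS.F₂_zero, h, div_self B.z₂_mem.1.ne', sub_self, zero_div]

lemma ae_ne_zero_of {F : StieltjesFunction ℝ} (hF : IsSubCDF F) (h : F 0 = 0) :
    ∀ᵐ t ∂F.measure, t ≠ 0 := by
  rw [ae_iff]
  have : F.measure {0} = 0 := by
    rw [F.measure_singleton, hF.leftLim_of_nonpos le_rfl, h]; simp
  simpa using this

/-- Conceding at 0 earns only half of player 2's initial atom. It is optimal precisely when that
atom is absent, and otherwise player 1 has no mass at 0. -/
lemma wait₁_ae (hS : B.IsSolution T S₁ S₂) :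
    ∀ᵐ t ∂S₁.F.measure, B.wait₁ S₂ t = (1 - B.z₂) * S₂.F 0 := by
  have h1 := S₁.isSubCDF_F.ae_nonneg
  have h2 := StieltjesFunction.ae_le_of_const hS.F₁_const
  rcases hS.F_zero_or with h | h
  · filter_upwards [h1, h2, ae_ne_zero_of S₁.isSubCDF_F h] with t h3 h4 h5
    exact hS.wait₁_eq (lt_of_le_of_ne h3 h5.symm) h4
  · filter_upwards [h1, h2] with t h3 h4
    rcases h3.eq_or_lt with rfl | h5
    · rw [wait₁, S₂.isSubCDF.waitGain_zero, h]; simp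
    · exact hS.wait₁_eq h5 h4

lemma wait₂_ae (hS : B.IsSolution T S₁ S₂) :
    ∀ᵐ t ∂S₂.F.measure, B.wait₂ S₁ t = (1 - B.z₁) * S₁.F 0 := by
  have h1 := S₂.isSubCDF.ae_nonneg
  have h2 := StieltjesFunction.ae_le_of_const (F := S₂.F) (b := T)
    fun t ht => by rw [hS.F₂_const t ht, hS.F₂_const T le_rfl]
  rcases hS.F_zero_or.symm with h | h
  · filter_upwards [h1, h2, ae_ne_zero_of S₂.isSubCDF h] with t h3 h4 h5
    exact hS.wait₂_eq (lt_of_le_of_ne h3 h5.symm) h4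
  · filter_upwards [h1, h2] with t h3 h4
    rcases h3.eq_or_lt with rfl | h5
    · rw [wait₂, S₁.isSubCDF_F.waitGain_zero, h]; simp
    · exact hS.wait₂_eq h5 h4

lemma G_const (hS : B.IsSolution T S₁ S₂) {t : ℝ} (ht : B.stopTime T ≤ t) :
    S₁.G t = S₁.G (B.stopTime T) := by
  have h0 := B.stopTime_nonneg T
  rw [hS.G_eq _ (h0.trans ht), hS.G_eq _ h0, chalSol, chalSol, min_self, min_eq_right ht]

lemma mass_F₂ (hS : B.IsSolution T S₁ S₂) : S₂.F.measure.real univ = 1 :=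
  tendsto_nhds_unique S₂.isSubCDF.tendsto_atTop (tendsto_const_nhds.congr' (by
    filter_upwards [eventually_ge_atTop T] with t ht using (hS.F₂_const t ht).symm))

lemma mass_F₁_add_G (hS : B.IsSolution T S₁ S₂) :
    S₁.F.measure.real univ + S₁.G.measure.real univ = 1 := by
  have hT := hS.terminal.pos
  have h1 := hS.one_sub_F₁_sub_G hT.le le_rfl
  rw [sub_self, invRep_zero, sub_self, mul_zero, mul_eq_zero,
    or_iff_right B.one_sub_z₁_pos.ne'] at h1
  refine tendsto_nhds_unique
    (S₁.isSubCDF_F.tendsto_atTop.add S₁.isSubCDF_G.tendsto_atTop)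
    (tendsto_const_nhds.congr' ?_)
  filter_upwards [eventually_ge_atTop T] with t ht
  rw [hS.F₁_const t ht, hS.G_const ((B.stopTime_lt hT).le.trans ht),
    ← hS.G_const (B.stopTime_lt hT).le]
  linarith

lemma G_measure (hS : B.IsSolution T S₁ S₂) :
    S₁.G.measure = (volume.restrict (Ioc 0 (B.stopTime T))).withDensity
      (fun s => ENNReal.ofReal (B.z₁ / (1 - B.z₁) * B.kap * (B.γ₁ * Real.exp (-B.γ₁ * s)))) := by
  set c := B.z₁ / (1 - B.z₁) * B.kap with hc
  have hc0 : 0 ≤ c := mul_nonneg (div_pos B.z₁_mem.1 B.one_sub_z₁_pos).le B.kap_pos.le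
  -- Clipping `t` to `[0, stopTime]` gives one formula on the whole line, so the mass of `(a, b]` is
  -- the integral of the density over the clipped interval.
  have hG : ∀ t, S₁.G t = c * (1 - Real.exp (-B.γ₁ * max 0 (min t (B.stopTime T)))) := by
    intro t
    have hp := B.stopTime_nonneg T
    rcases lt_or_ge t 0 with h | h
    · rw [S₁.G_neg t h, max_eq_left ((min_le_left _ _).trans h.le)]; simp
    · rw [hS.G_eq t h, max_eq_right (le_min h hp), chalSol]
  have hcont : Continuous fun s => c * (B.γ₁ * Real.exp (-B.γ₁ * s)) := by fun_prop
  refine Measure.ext_of_Ioc _ _ fun a b hab => ?_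
  rw [S₁.G.measure_Ioc, withDensity_apply _ measurableSet_Ioc,
    Measure.restrict_restrict measurableSet_Ioc, Ioc_inter_Ioc, hG, hG]
  have hmm : max 0 (min a (B.stopTime T)) ≤ max 0 (min b (B.stopTime T)) :=
    max_le_max_left 0 (min_le_min_right _ hab.le)
  rcases le_total (min b (B.stopTime T)) (max a 0) with h | h
  · have heq : max 0 (min a (B.stopTime T)) = max 0 (min b (B.stopTime T)) := by
      refine le_antisymm hmm (max_le (le_max_left _ _) ?_)
      rcases le_max_iff.1 h with h' | h'
      · exact (le_min h' (min_le_right _ _)).trans (le_max_right _ _)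
      · exact h'.trans (le_max_left _ _)
    rw [heq, sub_self, Ioc_eq_empty (not_lt.2 h)]
    simp
  · have h1 : max 0 (min b (B.stopTime T)) = min b (B.stopTime T) :=
      max_eq_right ((le_max_right _ _).trans h)
    have h2 : max 0 (min a (B.stopTime T)) = max a 0 := by
      rw [min_eq_left (((le_max_left _ _).trans h).trans (min_le_right _ _)), max_comm]
    rw [h1, h2, ← ofReal_integral_eq_lintegral_ofReal
      (hcont.integrableOn_Ioc) (Eventually.of_forall fun s =>
        mul_nonneg hc0 (mul_nonneg B.γ₁_nonneg (Real.exp_pos _).le)),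
      ← intervalIntegral.integral_of_le h, intervalIntegral.integral_eq_sub_of_hasDerivAt
        (f := fun s => c * (1 - Real.exp (-B.γ₁ * s)))]
    · intro s _
      exact (((hasDerivAt_exp_const_mul (-B.γ₁) s).const_sub 1).const_mul c).congr_deriv (by ring)
    · exact hcont.intervalIntegrable _ _

lemma seeG_eq (hS : B.IsSolution T S₁ S₂) (ψ : ℝ → ℝ) (t : ℝ) :
    B.seeG S₁ ψ t = (B.z₁ / (1 - B.z₁) * B.kap) * ∫ s in Ico 0 t ∩ Ioc 0 (B.stopTime T),
      ψ s * (Real.exp (-B.r₂ * s) * (B.γ₁ * Real.exp (-B.γ₁ * s))) := by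
  have hc0 : 0 ≤ B.z₁ / (1 - B.z₁) * B.kap :=
    mul_nonneg (div_pos B.z₁_mem.1 B.one_sub_z₁_pos).le B.kap_pos.le
  rw [seeG, hS.G_measure, setIntegral_withDensity_eq_setIntegral_toReal_smul (by fun_prop)
    (Eventually.of_forall fun _ => ENNReal.ofReal_lt_top) _ measurableSet_Ico,
    Measure.restrict_restrict measurableSet_Ico, ← integral_const_mul]
  congr 1
  ext s
  rw [ENNReal.toReal_ofReal (mul_nonneg hc0 (mul_nonneg B.γ₁_nonneg (Real.exp_pos _).le)),
    smul_eq_mul]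
  ring

/-- Until `stopTime` challenges come in the proportion that makes player 2 indifferent; later all
are justified. Restricting a nonnegative integral to the earlier period therefore favours yielding.
-/
lemma seeG_le_seeL (hS : B.IsSolution T S₁ S₂) {ψ : ℝ → ℝ} (hψ : Measurable ψ)
    (hψ1 : ∀ t, 0 ≤ ψ t ∧ ψ t ≤ 1) (t : ℝ) :
    B.alpha * B.seeG S₁ ψ t ≤ B.z₁ * B.k₂ * B.seeL ψ t := by
  have hc0 : 0 ≤ B.z₁ / (1 - B.z₁) * B.kap :=
    mul_nonneg (div_pos B.z₁_mem.1 B.one_sub_z₁_pos).le B.kap_pos.le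
  rw [hS.seeG_eq, z₁_mul_k₂, mul_assoc B.alpha _ (B.seeL ψ t)]
  refine mul_le_mul_of_nonneg_left (mul_le_mul_of_nonneg_left ?_ hc0) B.alpha_pos.le
  refine setIntegral_mono_set (integrableOn_bdd_mul (C := 1) hψ
    (fun s => abs_le.2 ⟨by linarith [hψ1 s], (hψ1 s).2⟩) (by fun_prop) t)
    (Eventually.of_forall fun s => mul_nonneg (hψ1 s).1 (mul_nonneg (Real.exp_pos _).le
      (mul_nonneg B.γ₁_nonneg (Real.exp_pos _).le))) inter_subset_left.eventuallyLE

lemma seeG_eq_seeL (hS : B.IsSolution T S₁ S₂) {ψ : ℝ → ℝ}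
    (hψ : ∀ t, B.stopTime T < t → ψ t = 0) (t : ℝ) :
    B.alpha * B.seeG S₁ ψ t = B.z₁ * B.k₂ * B.seeL ψ t := by
  rw [hS.seeG_eq, z₁_mul_k₂, mul_assoc B.alpha _ (B.seeL ψ t)]
  congr 2
  rw [inter_comm, ← integral_indicator (measurableSet_Ioc.inter measurableSet_Ico),
    ← indicator_indicator, integral_indicator measurableSet_Ioc, seeL,
    ← integral_indicator measurableSet_Ico, ← integral_indicator measurableSet_Ioc]
  refine integral_congr_ae ?_
  have hne : ∀ᵐ s : ℝ, s ≠ 0 := by simp [ae_iff]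
  filter_upwards [hne] with s hs
  by_cases h1 : s ∈ Ioc 0 (B.stopTime T)
  · rw [indicator_of_mem h1]
  · rw [indicator_of_notMem h1]
    by_cases h2 : s ∈ Ico 0 t
    · rw [indicator_of_mem h2]
      have h3 : B.stopTime T < s := by
        by_contra h4
        exact h1 ⟨lt_of_le_of_ne h2.1 hs.symm, not_lt.1 h4⟩
      rw [hψ s h3, zero_mul]
    · rw [indicator_of_notMem h2]

/-- The closed form is an equilibrium if player 2 responds to challenges accordingly. -/
theorem isEquilibrium (hS : B.IsSolution T S₁ S₂)
    (hq : ∀ t, S₂.q t = if t < T - B.tN then B.yieldSol T t else 1) : B.IsEquilibrium S₁ S₂ := by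
  have hT := hS.terminal.pos
  have hD := B.D_pos
  have := S₁.isSubCDF_F.isFiniteMeasure
  have := S₁.isSubCDF_G.isFiniteMeasure
  have := S₂.isSubCDF.isFiniteMeasure
  -- Before `T - tN` player 2 yields at the break-even rate. From then until `T` the break-even rate
  -- is at least one, and after `T` only the justified type remains.
  have hchal : ∀ t, 0 ≤ t → B.chalGain S₂ t ≤ 0 := by
    intro t ht
    rcases lt_or_ge t T with htT | htT
    · rw [B.chalGain_nonpos_iff htT (hS.surv₂_eq t ht htT.le), hq]
      split_ifs with h
      · exact le_rfl
      · rw [← B.yieldSol_sub_tN T]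
        rcases (not_lt.1 h).eq_or_lt with h' | h'
        · rw [h']
        · exact (B.strictMono_yieldSol h' htT).le
    · have h1 : 0 < B.c₁ := by linarith [B.c₁_mem.1, B.w₁_nonneg]
      have h2 := mul_pos h1 ((B.isSurvival_surv₂ S₂).pos t)
      rw [chalGain, hS.F₂_const t htT]; simp; linarith
  set u₁ := 1 - B.a₂ + B.D * ((1 - B.z₂) * S₂.F 0) with hu₁
  set u₂ := 1 - B.a₁ + B.D * ((1 - B.z₁) * S₁.F 0) with hu₂
  have hu₁0 : 0 ≤ u₁ := add_nonneg (by linarith [B.a₂_mem.2])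
    (mul_nonneg hD.le (mul_nonneg B.one_sub_z₂_pos.le (S₂.isSubCDF.nonneg 0)))
  have hu₂0 : 0 ≤ u₂ := add_nonneg (by linarith [B.a₁_mem.2])
    (mul_nonneg hD.le (mul_nonneg B.one_sub_z₁_pos.le (S₁.isSubCDF_F.nonneg 0)))
  have hU₁ : ∀ t, 0 ≤ t → B.U₁ S₂ t ≤ u₁ := fun t ht => by
    rw [B.U₁_eq S₂ ht]
    have := mul_le_mul_of_nonneg_left (hS.wait₁_le ht) hD.le
    linarith
  have hV₁ : ∀ t, 0 ≤ t → B.V₁ S₂ t ≤ u₁ := fun t ht => by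
    rw [B.V₁_eq S₂ ht]
    have h1 := mul_le_mul_of_nonneg_left
      (B.wait₁_add_jump_le S₂ (fun t ht => hS.wait₁_le ht) ht) hD.le
    have h2 := mul_nonneg (mul_pos (Real.exp_pos (-B.r₁ * t)) hD).le
      (neg_nonneg.2 (hchal t ht))
    linarith
  have hU₁e : ∀ᵐ t ∂S₁.F.measure, B.U₁ S₂ t = u₁ := by
    filter_upwards [S₁.isSubCDF_F.ae_nonneg, hS.wait₁_ae] with t ht h
    rw [B.U₁_eq S₂ ht, h]
  have hV₁e : ∀ᵐ t ∂S₁.G.measure, B.V₁ S₂ t = u₁ := by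
    filter_upwards [S₁.isSubCDF_G.ae_nonneg, ae_ne_zero_of S₁.isSubCDF_G hS.G_zero,
      StieltjesFunction.ae_le_of_const fun t ht => hS.G_const ht] with t h1 h2 h3
    have ht : 0 < t := lt_of_le_of_ne h1 h2.symm
    have htT := h3.trans_lt (B.stopTime_lt hT)
    have h4 : 0 ≤ B.chalGain S₂ t := by
      rw [B.chalGain_nonneg_iff htT (hS.surv₂_eq t h1 htT.le), hq]
      split_ifs with h
      · exact le_rfl
      -- A positive time in the support of `G` at which player 2 yields with certainty can only be
      -- the boundary time, where break-even yielding equals one.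
      · have h5 : t = T - B.tN := by
          refine le_antisymm ?_ (not_lt.1 h)
          rcases le_max_iff.1 h3 with h6 | h6
          · exact h6
          · linarith
        rw [h5, B.yieldSol_sub_tN]
    rw [B.V₁_eq S₂ h1, hS.wait₁_eq ht htT.le, le_antisymm (hchal t h1) h4,
      (IsSubCDF.continuousAt_iff _ _).1 (hS.F₂_continuousAt ht)]
    simp [hu₁]
  have hp₁ : B.payoff₁ S₁ S₂ = u₁ := by
    rw [B.payoff₁_eq, integral_congr_ae hU₁e, integral_congr_ae hV₁e, integral_const,
      integral_const, smul_eq_mul, smul_eq_mul, ← add_mul, hS.mass_F₁_add_G, one_mul]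
  have hU₂ : ∀ (q : ℝ → ℝ), Measurable q → (∀ t, 0 ≤ q t ∧ q t ≤ 1) → ∀ t, 0 ≤ t →
      B.U₂ S₁ q t ≤ u₂ := fun q hqm hq1 t ht => by
    rw [B.U₂_eq S₁ hqm hq1 ht]
    have h1 := mul_le_mul_of_nonneg_left (hS.wait₂_le ht) hD.le
    have h2 := hS.seeG_le_seeL (ψ := fun s => 1 - q s) (hqm.const_sub 1)
      (fun s => ⟨by linarith [(hq1 s).2], by linarith [(hq1 s).1]⟩) t
    rw [alpha] at h2
    have h3 := mul_nonneg hD.le (sub_nonneg.2 h2)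
    linarith
  have hU₂e : ∀ᵐ t ∂S₂.F.measure, B.U₂ S₁ S₂.q t = u₂ := by
    filter_upwards [S₂.isSubCDF.ae_nonneg, hS.wait₂_ae] with t ht h
    have h1 := hS.seeG_eq_seeL (ψ := fun s => 1 - S₂.q s) (fun s hs => by
      rw [hq, if_neg (not_lt.2 ((le_max_left _ _).trans hs.le)), sub_self]) t
    rw [alpha] at h1
    rw [B.U₂_eq S₁ S₂.q_measurable S₂.q_mem ht, h, h1]
    ring
  have hp₂ : B.payoff₂ S₁ S₂ = u₂ := by
    rw [B.payoff₂_eq, integral_congr_ae hU₂e, integral_const, smul_eq_mul, hS.mass_F₂, one_mul]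
  refine ⟨fun S₁' => ?_, fun S₂' => ?_⟩
  · have := S₁'.isSubCDF_F.isFiniteMeasure
    have := S₁'.isSubCDF_G.isFiniteMeasure
    have h1 := integral_le_mul_mass (μ := S₁'.F.measure) hu₁0
      (S₁'.isSubCDF_F.ae_nonneg.mono fun t ht => hU₁ t ht)
    have h2 := integral_le_mul_mass (μ := S₁'.G.measure) hu₁0
      (S₁'.isSubCDF_G.ae_nonneg.mono fun t ht => hV₁ t ht)
    have h3 := mul_le_mul_of_nonneg_left (mass_add_le S₁') hu₁0
    rw [hp₁, B.payoff₁_eq]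
    linarith
  · have := S₂'.isSubCDF.isFiniteMeasure
    have h1 := integral_le_mul_mass (μ := S₂'.F.measure) hu₂0
      (S₂'.isSubCDF.ae_nonneg.mono fun t ht => hU₂ _ S₂'.q_measurable S₂'.q_mem t ht)
    have h3 := mul_le_mul_of_nonneg_left S₂'.isSubCDF.real_univ_le hu₂0
    rw [hp₂, B.payoff₂_eq]
    linarith

end IsSolution

end BargainingGame

end

theorem mainTheorem9 (B : BargainingGame) :
    ∃ T : ℝ, 0 < T ∧
      -- `T` is the smaller of the backward times at which the two paths reach the priors
      IsLeast {t : ℝ | 0 ≤ t ∧ (B.muCheck₁ (-t) = B.z₁ ∨ B.muCheck₂ (-t) = B.z₂)} T ∧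
      (∃ (S₁ : StrategyOne) (S₂ : StrategyTwo), B.IsEquilibrium S₁ S₂) ∧
      ∀ (S₁ : StrategyOne) (S₂ : StrategyTwo), B.IsEquilibrium S₁ S₂ →
        -- concession and challenge distributions
        HasAtomAndDensity S₁.F (B.f₁ T S₁) ∧
        HasAtomAndDensity S₂.F (B.f₂ T S₂) ∧
        HasAtomAndDensity S₁.G (B.g₁ T S₁) ∧
        S₁.G 0 = 0 ∧
        S₁.F 0 = (if B.z₁ < B.curve₁ B.z₂ then
          1 - B.z₁ / (1 - B.z₁) / (B.curve₁ B.z₂ / (1 - B.curve₁ B.z₂)) else 0) ∧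
        S₂.F 0 = (if B.z₂ < B.curve₂ B.z₁ then
          1 - B.z₂ / (1 - B.z₂) / (B.curve₂ B.z₁ / (1 - B.curve₂ B.z₁)) else 0) ∧
        -- response to a challenge
        (0 < B.γ₁ → ∀ᵐ t ∂(volume.restrict (Set.Icc 0 T)), S₂.q t = B.yieldProb T S₂ t) ∧
        -- reputations
        (∀ t, 0 ≤ t → t < T →
          B.rep₁ S₁ (T - t) = B.muCheck₁ (-t) ∧ B.rep₂ S₂ (T - t) = B.muCheck₂ (-t)) ∧
        B.rep₁ S₁ T = 1 ∧ B.rep₂ S₂ T = 1 ∧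
        (∀ t, 0 < t → t < T →
          HasDerivAt (B.rep₂ S₂) (B.lam₂ * B.rep₂ S₂ t) t ∧
          (t < T - B.tN → HasDerivAt (B.rep₁ S₁)
            ((B.lam₁ - B.γ₁) * B.rep₁ S₁ t + B.γ₁ / B.nuStar * B.rep₁ S₁ t ^ 2) t) ∧
          (T - B.tN < t → HasDerivAt (B.rep₁ S₁)
            ((B.lam₁ - B.γ₁) * B.rep₁ S₁ t + B.γ₁ * B.rep₁ S₁ t ^ 2) t)) ∧
        -- payoffs
        B.payoff₁ S₁ S₂ = 1 - B.a₂ + (if B.curve₁ B.z₂ ≤ B.z₁ then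
          (1 - B.z₂) * (1 - B.z₂ / (1 - B.z₂) / (B.curve₂ B.z₁ / (1 - B.curve₂ B.z₁))) * B.D
          else 0) ∧
        B.payoff₂ S₁ S₂ = 1 - B.a₁ + (if B.curve₂ B.z₁ ≤ B.z₂ then
          (1 - B.z₁) * (1 - B.z₁ / (1 - B.z₁) / (B.curve₁ B.z₂ / (1 - B.curve₁ B.z₂))) * B.D
          else 0) := by
  obtain ⟨T, hT⟩ := B.exists_isTerminal
  refine ⟨T, hT.pos, hT.isLeast, ⟨hT.strategyOne, hT.strategyTwo,
    hT.isSolution.isEquilibrium fun _ => rfl⟩, fun S₁ S₂ hE => ?_⟩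
  obtain ⟨T', hS⟩ := hE.exists_isSolution
  -- A priori each equilibrium has its own terminal time; all of them coincide with the `T` fixed by
  -- the priors.
  obtain rfl := hT.unique hS.terminal
  refine ⟨hS.hasAtomAndDensity_F₁, hS.hasAtomAndDensity_F₂, hS.hasAtomAndDensity_G, hS.G_zero,
    hS.F₁_zero_eq_ite, hS.F₂_zero_eq_ite, hS.ae_q_eq hE, fun t ht htT => ⟨?_, ?_⟩, ?_, ?_,
    fun t ht htT => ⟨hS.rep₂_hasDerivAt ht htT, fun h => ?_, fun h => ?_⟩,
    hS.payoff₁_eq_ite hE, hS.payoff₂_eq_ite hE⟩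
  · rw [hS.rep₁_eq (sub_pos.2 htT) (sub_le_self _ ht), sub_sub_cancel, B.muCheck₁_neg]
  · rw [hS.rep₂_eq (sub_pos.2 htT) (sub_le_self _ ht), sub_sub_cancel, B.muCheck₂_neg]
  · rw [hS.rep₁_eq hT.pos le_rfl, sub_self, B.invRep_zero, div_one]
  · rw [hS.rep₂_eq hT.pos le_rfl, sub_self, mul_zero, Real.exp_zero]
  · exact hS.rep₁_hasDerivAt ht htT (B.hasDerivAt_invRep_of_gt (by linarith))
  · exact hS.rep₁_hasDerivAt ht htT (B.hasDerivAt_invRep_of_lt (by linarith))
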